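/- Let $U\subset\mathbb R^3$ be open and let $T\subset\mathbb R$ be an open interval containing $0$. Let $(A_t)_{t\in T}$ be a real-analytic one-parameter family of Riemannian metrics on $U$; that is, each $A_t(x)$ is a symmetric positive definite $3\times3$ matrix whose entries are real-analytic functions of $(x,t)\in U\times T$. Let $z_k=x_k+iy_k$ be the coordinates of $\mathbb C^3$. A standard complexification of $U$ is an open neighbourhood $U_{\mathbb C}\subset\mathbb C^3$ of $U$ (included in $\mathbb C^3$ as the real part) with $\operatorname{Re}(U_{\mathbb C})=U$. For $t\in\mathbb R$ its horizontal slice is $U_t=U_{\mathbb C}\cap\{y_1=t,\ y_2=y_3=0\}$, which is identified through the coordinate $x$ with an open subset of $U$. A Calabi–Yau structure with constant $c\in\mathbb C$ on $U_{\mathbb C}$ is a pair $(\Omega,\omega)$ of a nowhere vanishing holomorphic $3$-form $\Omega$ and a Kähler form $\omega$ (a smooth closed real $(1,1)$-form with positive definite metric $\omega(\cdot,J\,\cdot)$) such that $\omega^3=c\,\Omega\wedge\overline\Omega$. It is normalized if $\omega^3/3!=-(i/2)^3\,\Omega\wedge\overline\Omega$. A one-form $\theta$ on $U$ is harmonic with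 respect to a metric if $d\theta=0$ and $d\star\theta=0$. Then the following are equivalent. 1. $\det(A_t(x))$ does not depend on $t$, for every $x\in U$, and for every $t\in T$ the one-form $(\partial/\partial x_1)^\flat=A_t(\partial/\partial x_1,\cdot)$ is harmonic on $U$ with respect to $A_t$. 2. On some standard complexification $U_{\mathbb C}$ of $U$ there is a Calabi–Yau structure $(\Omega,\omega)$, with some constant $c$, such that for every $t\in T$ the slice $U_t$ is special Lagrangian in the sense that $\omega|_{U_t}=0$ and $\operatorname{Im}\Omega|_{U_t}=0$, and the induced metric on $U_t$ is $A_t$. 3. On some standard complexification $U_{\mathbb C}$ of $U$ there is a normalized Calabi–Yau structure $(\Omega,\omega)$ such that for every $t\in T$ the slice $U_t$ is special Lagrangian in the sense that $\operatorname{Re}\Omega|_{U_t}=\operatorname{Vol}_{A_t}=\sqrt{\det A_t}\,dx_1\wedge dx_2\wedge dx_3$, and the induced metric on $U_t$ is $A_t$. 4. On some standard complexification $U_{\mathbb C}$ of $U$ for which $U_t$ is (a copy of) all of $U$ for every $t\in T$ and is empty for every $t\notin T$, there is a normalized Calabi–Yau structure $(\Omega,\omega)$ such that for every $t\in T$ one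 has $\omega|_{U_t}=0$, $\operatorname{Im}\Omega|_{U_t}=0$, $\operatorname{Re}\Omega|_{U_t}=\operatorname{Vol}_{A_t}$, and the induced metric on $U_t$ is $A_t$. -/

import Mathlib

noncomputable section

namespace SLag

/-- Real coordinate space with coordinates `(x₁, x₂, x₃)` (indexed by `0, 1, 2`). -/
abbrev R3 : Type := Fin 3 → ℝ

/-- Complex coordinate space with coordinates `zₖ = xₖ + i yₖ`. -/
abbrev C3 : Type := Fin 3 → ℂ

/-! ### Differential forms on open subsets of real coordinate space -/

/-- The standard volume form `dx₁ ∧ dx₂ ∧ dx₃`. -/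
def stdVol : R3 [⋀^Fin 3]→L[ℝ] ℝ :=
  { (Matrix.detRowAlternating : R3 [⋀^Fin 3]→ₗ[ℝ] ℝ) with
    cont := Continuous.matrix_det (A := fun v : Fin 3 → R3 => Matrix.of v) continuous_id }

/-- The Riemannian volume form `√(det G) dx₁ ∧ dx₂ ∧ dx₃` of the metric with matrix `G`. -/
def volForm (G : R3 → Matrix (Fin 3) (Fin 3) ℝ) (x : R3) : R3 [⋀^Fin 3]→L[ℝ] ℝ :=
  √((G x).det) • stdVol

/-- The one-form `X^♭ = G(X, ·)`. -/
def flat (G : R3 → Matrix (Fin 3) (Fin 3) ℝ) (X : R3 → R3) (x : R3) : R3 [⋀^Fin 1]→L[ℝ] ℝ :=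
  ContinuousAlternatingMap.ofSubsingleton ℝ R3 ℝ (0 : Fin 1)
    (LinearMap.toContinuousLinearMap (Matrix.toBilin' (G x) (X x)))

/-- The vector field `θ^♯` dual to a one-form, with components `∑ⱼ gⁱʲ θⱼ`. -/
def sharp (G : R3 → Matrix (Fin 3) (Fin 3) ℝ) (θ : R3 → R3 [⋀^Fin 1]→L[ℝ] ℝ) (x : R3) : R3 :=
  (G x)⁻¹.mulVec (fun j => θ x (fun _ => Pi.single j 1))

/-- The Hodge star of a one-form, `⋆θ = ι_{θ^♯} Vol`. -/
def hodgeStar (G : R3 → Matrix (Fin 3) (Fin 3) ℝ) (θ : R3 → R3 [⋀^Fin 1]→L[ℝ] ℝ) (x : R3) :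
    R3 [⋀^Fin 2]→L[ℝ] ℝ :=
  (volForm G x).curryLeft (sharp G θ x)

/-- A one-form is harmonic on `U` if it is closed and coclosed: `dθ = 0` and `d⋆θ = 0`. -/
def IsHarmonicOn (G : R3 → Matrix (Fin 3) (Fin 3) ℝ) (θ : R3 → R3 [⋀^Fin 1]→L[ℝ] ℝ)
    (U : Set R3) : Prop :=
  (∀ x ∈ U, extDeriv θ x = 0) ∧ (∀ x ∈ U, extDeriv (hodgeStar G θ) x = 0)

/-! ### Calabi-Yau structures on open subsets of complex coordinate space -/

/-- The wedge product of complex-valued real alternating forms (shuffle normalization). -/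
def wedge {k l : ℕ} (a : C3 [⋀^Fin k]→ₗ[ℝ] ℂ) (b : C3 [⋀^Fin l]→ₗ[ℝ] ℂ) :
    C3 [⋀^Fin (k + l)]→ₗ[ℝ] ℂ :=
  ((LinearMap.mul' ℝ ℂ).compAlternatingMap (a.domCoprod b)).domDomCongr finSumFinEquiv

/-- A real form regarded as a complex-valued form. -/
def complexify {k : ℕ} (a : C3 [⋀^Fin k]→L[ℝ] ℝ) : C3 [⋀^Fin k]→ₗ[ℝ] ℂ :=
  (Complex.ofRealCLM : ℝ →ₗ[ℝ] ℂ).compAlternatingMap a.toAlternatingMap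

/-- A complex-multilinear form regarded as a complex-valued real form. -/
def realify {k : ℕ} (a : C3 [⋀^Fin k]→L[ℂ] ℂ) : C3 [⋀^Fin k]→ₗ[ℝ] ℂ :=
  (a.restrictScalars ℝ).toAlternatingMap

/-- The complex conjugate of a complex-valued form. -/
def conjForm {k : ℕ} (a : C3 [⋀^Fin k]→ₗ[ℝ] ℂ) : C3 [⋀^Fin k]→ₗ[ℝ] ℂ :=
  (Complex.conjCLE : ℂ →ₗ[ℝ] ℂ).compAlternatingMap a

/-- `ω` is a Kähler form on `V`: a smooth closed real form of type `(1, 1)` such that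
`(u, v) ↦ ω(u, i v)` is positive definite. -/
structure IsKahlerForm (V : Set C3) (ω : C3 → C3 [⋀^Fin 2]→L[ℝ] ℝ) : Prop where
  smooth : ContDiffOn ℝ ((⊤ : ℕ∞) : WithTop ℕ∞) ω V
  closed : ∀ z ∈ V, extDeriv ω z = 0
  type_one_one : ∀ z ∈ V, ∀ u v : C3, ω z ![Complex.I • u, Complex.I • v] = ω z ![u, v]
  pos : ∀ z ∈ V, ∀ u : C3, u ≠ 0 → 0 < ω z ![u, Complex.I • u]

/-- `(V, Ω, ω)` is a Calabi-Yau manifold with constant `c`: `Ω` is a nowhere vanishing holomorphic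
`3`-form, `ω` is a Kähler form and `ω³ = c Ω ∧ Ω̄`. -/
structure IsCalabiYau (V : Set C3) (Ω : C3 → C3 [⋀^Fin 3]→L[ℂ] ℂ)
    (ω : C3 → C3 [⋀^Fin 2]→L[ℝ] ℝ) (c : ℂ) : Prop where
  holomorphic : DifferentiableOn ℂ Ω V
  ne_zero : ∀ z ∈ V, Ω z ≠ 0
  kahler : IsKahlerForm V ω
  volume_eq : ∀ z ∈ V,
    wedge (wedge (complexify (ω z)) (complexify (ω z))) (complexify (ω z))
      = c • wedge (realify (Ω z)) (conjForm (realify (Ω z)))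

/-- The constant for which `ω³ / 3! = -(i/2)³ Ω ∧ Ω̄`. -/
def normalizedConst : ℂ := -((Nat.factorial 3 : ℂ) * (Complex.I / 2) ^ 3)

/-! ### Standard complexifications and horizontal slices -/

/-- The inclusion of the real part. -/
def realIncl (x : R3) : C3 := fun k => (x k : ℂ)

/-- A standard complexification of `U`: an open neighbourhood `V` of `U` whose set of real parts
is `U`. -/
structure IsStandardComplexification (U : Set R3) (V : Set C3) : Prop where
  isOpen : IsOpen V
  subset : ∀ x ∈ U, realIncl x ∈ V
  re_eq : (fun z : C3 => (fun k => (z k).re : R3)) '' V = U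

/-- The parametrization `x ↦ x + i t e₁` of `{y₁ = t, y₂ = y₃ = 0}`; its differential at every
point is `realIncl`. -/
def sliceMap (t : ℝ) (x : R3) : C3 := realIncl x + Pi.single 0 ((t : ℂ) * Complex.I)

/-- The horizontal slice `V ∩ {y₁ = t, y₂ = y₃ = 0}` in the coordinate `x`. -/
def slice (V : Set C3) (t : ℝ) : Set R3 := {x | sliceMap t x ∈ V}

/-- The Kähler metric `(u, v) ↦ ω(u, i v)` induces the metric `G` on the slice. -/
def InducesMetricOnSlice (V : Set C3) (ω : C3 → C3 [⋀^Fin 2]→L[ℝ] ℝ) (t : ℝ)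
    (G : R3 → Matrix (Fin 3) (Fin 3) ℝ) : Prop :=
  ∀ x ∈ slice V t, ∀ u v : R3,
    ω (sliceMap t x) ![realIncl u, Complex.I • realIncl v] = Matrix.toBilin' (G x) u v

/-- `ω` and `Im Ω` restrict to zero on the slice. -/
def IsSpecialLagrangianSlice (V : Set C3) (Ω : C3 → C3 [⋀^Fin 3]→L[ℂ] ℂ)
    (ω : C3 → C3 [⋀^Fin 2]→L[ℝ] ℝ) (t : ℝ) : Prop :=
  ∀ x ∈ slice V t,
    (∀ u : Fin 3 → R3, (Ω (sliceMap t x) (fun k => realIncl (u k))).im = 0) ∧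
    (∀ u : Fin 2 → R3, ω (sliceMap t x) (fun k => realIncl (u k)) = 0)

/-- `Re Ω` restricts to the volume form of the metric `G` on the slice. -/
def IsCalibratedSlice (V : Set C3) (Ω : C3 → C3 [⋀^Fin 3]→L[ℂ] ℂ) (t : ℝ)
    (G : R3 → Matrix (Fin 3) (Fin 3) ℝ) : Prop :=
  ∀ x ∈ slice V t, ∀ u : Fin 3 → R3,
    (Ω (sliceMap t x) (fun k => realIncl (u k))).re = volForm G x u

end SLag

end

set_option linter.unusedSectionVars false

/-! The implications 4 → 3 → 2 → 1 rest on differential identities along the slices; 1 → 4 is a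
Cauchy problem for the complex Monge-Ampère equation.

For 2 → 1, write Ω = g dz₁ ∧ dz₂ ∧ dz₃. On the slices g is real, along x₁ as well as along t = y₁,
so the Cauchy-Riemann equation in z₁ makes both derivatives vanish, and the volume equation turns
this into stationarity of det A_t in t and in x₁ (`fderiv_det_eq_zero`). Closedness of ω on ∂/∂y₁,
∂/∂xⱼ, ∂/∂xₖ, together with ω = 0 on all slices, makes the first row of A_t a closed one-form
(`fderiv_row_symm`). Over a given x the complexification may contain slice points for small t only,
so these identities are continued analytically in t (`harmonic_of_calabiYau`). For 3 → 2, if ω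
restricts to B on a slice, its Hermitian determinant is det A - bᵀAb with b the axial vector of B,
while the normalized volume equation gives det A + (Im g)²; hence b = 0 and Im g = 0.

For 1 → 4, harmonicity means that the first row is closed and that ∂₁√det A_t = 0. The holomorphic
density g is then the holomorphic extension of √det A_t, a function of z₂, z₃ alone. A background
closed (1,1)-form with the right components on {y₂ = y₃ = 0} is -Im(dk ∧ dz̄₁), with k a potential
of the first row, plus dd^c of a quadratic expression in y₂, y₃. It is corrected by dd^cψ, where ψ
has zero Cauchy data on {y₃ = 0} and the total determinant is |g|². The equation is
noncharacteristic because the coefficient of ∂²ψ/∂y₃² is a quarter of a principal minor of a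
positive matrix (`exists_mongeAmpere_solution`). In place of a majorant argument, the equation is
posed in a weighted Banach algebra of power series in which ∂ᵢ∫dy₃ has norm at most one; an
anisotropic dilation by a small r makes it a perturbation of an invertible affine equation, and the
surjective form of the inverse function theorem applies (`exists_formal_solution`).

The local solutions glue because they are unique once three components are prescribed on {y₃ = 0} as
a gauge. The difference of two solutions obeys evolution equations, in y₂ inside {y₃ = 0} and then
in y₃, the component a₃₃ being recovered from the determinant; so it vanishes to infinite order
(`IsSolution.unique`, `exists_global_solution`). -/

namespace SLag

/-! ### Absolutely convergent power series in several variables -/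

section PowerSeries

open MvPowerSeries Topology

variable {σ : Type*} [Fintype σ] {𝕜 : Type*} [RCLike 𝕜]

/-- The series converges absolutely on the closed polydisc of radius `ρ`. -/
def AbsConv (ρ : ℝ) (c : MvPowerSeries σ 𝕜) : Prop :=
  Summable fun a : σ →₀ ℕ => ‖coeff a c‖ * ρ ^ a.degree

/-- The value at `x` of the sum of a power series. -/
noncomputable def evalSeries (c : MvPowerSeries σ 𝕜) (x : σ → 𝕜) : 𝕜 :=
  ∑' a : σ →₀ ℕ, coeff a c * ∏ i, x i ^ a i

theorem norm_prod_pow_le {ρ : ℝ} {x : σ → 𝕜} (hx : ‖x‖ ≤ ρ) (a : σ →₀ ℕ) :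
    ‖∏ i, x i ^ a i‖ ≤ ρ ^ a.degree := by
  rw [Finsupp.degree_eq_sum, norm_prod, ← Finset.prod_pow_eq_pow_sum]
  refine Finset.prod_le_prod (fun _ _ => norm_nonneg _) fun i _ => ?_
  rw [norm_pow]
  exact pow_le_pow_left₀ (norm_nonneg _) ((norm_le_pi_norm x i).trans hx) _

theorem AbsConv.mono {ρ ρ' : ℝ} {c : MvPowerSeries σ 𝕜} (h : AbsConv ρ c) (h0 : 0 ≤ ρ')
    (hρ : ρ' ≤ ρ) : AbsConv ρ' c :=
  Summable.of_nonneg_of_le (fun _ => by positivity)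
    (fun a => by gcongr) h

theorem AbsConv.summable_norm {ρ : ℝ} {c : MvPowerSeries σ 𝕜} (h : AbsConv ρ c) {x : σ → 𝕜}
    (hx : ‖x‖ ≤ ρ) : Summable fun a : σ →₀ ℕ => ‖coeff a c * ∏ i, x i ^ a i‖ :=
  Summable.of_nonneg_of_le (fun _ => norm_nonneg _)
    (fun a => by rw [norm_mul]; gcongr; exact norm_prod_pow_le hx a) h

theorem AbsConv.summable {ρ : ℝ} {c : MvPowerSeries σ 𝕜} (h : AbsConv ρ c) {x : σ → 𝕜}
    (hx : ‖x‖ ≤ ρ) : Summable fun a : σ →₀ ℕ => coeff a c * ∏ i, x i ^ a i :=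
  (h.summable_norm hx).of_norm

theorem AbsConv.add {ρ : ℝ} (hρ : 0 ≤ ρ) {c d : MvPowerSeries σ 𝕜} (hc : AbsConv ρ c)
    (hd : AbsConv ρ d) : AbsConv ρ (c + d) :=
  Summable.of_nonneg_of_le (fun _ => by positivity)
    (fun a => by rw [← add_mul, map_add]; gcongr; exact norm_add_le _ _) (Summable.add hc hd)

theorem AbsConv.smul {ρ : ℝ} {c : MvPowerSeries σ 𝕜} (hc : AbsConv ρ c) (r : 𝕜) :
    AbsConv ρ (r • c) := by
  refine (Summable.mul_left ‖r‖ hc).congr fun a => ?_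
  simp [mul_assoc]

theorem evalSeries_add {ρ : ℝ} {c d : MvPowerSeries σ 𝕜} (hc : AbsConv ρ c) (hd : AbsConv ρ d)
    {x : σ → 𝕜} (hx : ‖x‖ ≤ ρ) : evalSeries (c + d) x = evalSeries c x + evalSeries d x := by
  unfold evalSeries
  rw [← Summable.tsum_add (hc.summable hx) (hd.summable hx)]
  simp [add_mul]

theorem evalSeries_smul (r : 𝕜) (c : MvPowerSeries σ 𝕜) (x : σ → 𝕜) :
    evalSeries (r • c) x = r * evalSeries c x := by
  unfold evalSeries
  rw [← tsum_mul_left]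
  simp [mul_assoc]

theorem evalSeries_mul {ρ : ℝ} {c d : MvPowerSeries σ 𝕜} (hc : AbsConv ρ c) (hd : AbsConv ρ d)
    {x : σ → 𝕜} (hx : ‖x‖ ≤ ρ) : evalSeries (c * d) x = evalSeries c x * evalSeries d x := by
  classical
  unfold evalSeries
  have h := summable_mul_of_summable_norm (hc.summable_norm hx) (hd.summable_norm hx)
  rw [(hc.summable hx).tsum_mul_tsum_eq_tsum_sum_antidiagonal (hd.summable hx) h]
  refine tsum_congr fun a => ?_
  rw [coeff_mul, Finset.sum_mul]
  refine Finset.sum_congr rfl fun p hp => ?_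
  rw [← Finset.HasAntidiagonal.mem_antidiagonal.1 hp]
  simp only [Finsupp.add_apply, pow_add, Finset.prod_mul_distrib]
  ring

theorem evalSeries_zero_right (c : MvPowerSeries σ 𝕜) : evalSeries c 0 = coeff 0 c := by
  unfold evalSeries
  rw [tsum_eq_single 0]
  · simp
  · intro a ha
    obtain ⟨i, hi⟩ : ∃ i, a i ≠ 0 := by
      by_contra! h
      exact ha (Finsupp.ext h)
    rw [Finset.prod_eq_zero (Finset.mem_univ i) (by simp [hi]), mul_zero]

/-- The factor produced by differentiating a monomial grows linearly in the degree and is absorbed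
by the geometric gap between the two radii. -/
theorem AbsConv.pderiv {ρ ρ' : ℝ} {c : MvPowerSeries σ 𝕜} (h : AbsConv ρ c) (h0 : 0 ≤ ρ')
    (hρ : ρ' < ρ) (i : σ) : AbsConv ρ' (pderiv 𝕜 i c) := by
  have hρ0 : 0 < ρ := h0.trans_lt hρ
  -- Each term of the convergent series ∑ (n + 1)(ρ'/ρ)ⁿ is bounded by its sum.
  have hC : ∃ C : ℝ, ∀ n : ℕ, (n + 1) * ρ' ^ n ≤ C * ρ ^ (n + 1) := by
    have hq : ρ' / ρ < 1 := (div_lt_one hρ0).2 hρ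
    have hq0 : 0 ≤ ρ' / ρ := by positivity
    have h1 : Summable fun n : ℕ => ((n : ℝ) + 1) * (ρ' / ρ) ^ n := by
      have := (summable_pow_mul_geometric_of_norm_lt_one 1 (r := ρ' / ρ)
        (by rwa [Real.norm_of_nonneg hq0])).add (summable_geometric_of_lt_one hq0 hq)
      exact this.congr fun n => by ring
    refine ⟨(∑' n : ℕ, ((n : ℝ) + 1) * (ρ' / ρ) ^ n) / ρ, fun n => ?_⟩
    have h2 := h1.le_tsum n (fun j _ => by positivity)
    rw [div_pow, ← mul_div_assoc, div_le_iff₀ (by positivity)] at h2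
    calc _ ≤ _ := h2
      _ = _ := by rw [pow_succ]; field_simp
  obtain ⟨C, hC⟩ := hC
  have hinj : Function.Injective fun a : σ →₀ ℕ => a + Finsupp.single i 1 :=
    fun a b hab => by simpa using hab
  refine Summable.of_nonneg_of_le (fun _ => by positivity) (fun a => ?_)
    ((h.comp_injective hinj).mul_left C)
  have hd : (a + Finsupp.single i 1).degree = a.degree + 1 := by simp
  have ha : (a i : ℝ) ≤ a.degree := by exact_mod_cast Finsupp.le_degree i a
  rw [coeff_pderiv, norm_mul]
  simp only [Function.comp_apply, hd]
  have h3 : ‖(a i : 𝕜) + 1‖ ≤ a.degree + 1 := by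
    refine (norm_add_le _ _).trans ?_
    simpa using ha
  calc _ ≤ ‖coeff (a + Finsupp.single i 1) c‖ * (a.degree + 1) * ρ' ^ a.degree := by gcongr
    _ = ‖coeff (a + Finsupp.single i 1) c‖ * ((a.degree + 1) * ρ' ^ a.degree) := by ring
    _ ≤ ‖coeff (a + Finsupp.single i 1) c‖ * (C * ρ ^ (a.degree + 1)) := by
        exact mul_le_mul_of_nonneg_left (hC _) (norm_nonneg _)
    _ = _ := by ring

end PowerSeries

end SLag

/-! ### Termwise differentiation and analyticity of convergent power series. -/

namespace SLag

section PowerSeriesCalculus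

open MvPowerSeries Topology

variable {σ : Type*} [Fintype σ] {𝕜 : Type*} [RCLike 𝕜]

theorem hasDerivAt_prod_pow [DecidableEq σ] (a : σ →₀ ℕ) (i : σ) (x : σ → 𝕜) (s : 𝕜) :
    HasDerivAt (fun s : 𝕜 => ∏ j, (x + s • Pi.single i (1 : 𝕜) : σ → 𝕜) j ^ a j)
      (a i * ∏ j, (x + s • Pi.single i (1 : 𝕜) : σ → 𝕜) j ^ (a - Finsupp.single i 1 : σ →₀ ℕ) j) s := by
  have h1 : ∀ (b : σ →₀ ℕ) (s : 𝕜), ∏ j, (x + s • Pi.single i (1 : 𝕜) : σ → 𝕜) j ^ b j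
      = (x i + s) ^ b i * ∏ j ∈ Finset.univ.erase i, x j ^ b j := by
    intro b s
    rw [← Finset.mul_prod_erase _ _ (Finset.mem_univ i)]
    congr 1
    · simp
    · refine Finset.prod_congr rfl fun j hj => ?_
      simp [Finset.ne_of_mem_erase hj]
  simp only [h1]
  have h2 : ∏ j ∈ Finset.univ.erase i, x j ^ (a - Finsupp.single i 1 : σ →₀ ℕ) j
      = ∏ j ∈ Finset.univ.erase i, x j ^ a j := by
    refine Finset.prod_congr rfl fun j hj => ?_
    simp [(Finset.ne_of_mem_erase hj).symm]
  rw [h2, ← mul_assoc]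
  have h3 := (((hasDerivAt_id s).const_add (x i)).pow (a i)).mul_const
    (∏ j ∈ Finset.univ.erase i, x j ^ a j)
  simpa using h3

-- Termwise differentiation along a coordinate line: for x + s eᵢ in a ball of radius ρ' < ρ, the
-- differentiated terms are dominated by the summable majorant of the formal derivative. The shift a
-- ↦ a + eᵢ matches the two index sets, the exponents with aᵢ = 0 contributing nothing.
set_option maxHeartbeats 1000000 in
theorem hasDerivAt_evalSeries [DecidableEq σ] {ρ : ℝ} {c : MvPowerSeries σ 𝕜} (h : AbsConv ρ c)
    {x : σ → 𝕜} (hx : ‖x‖ < ρ) (i : σ) :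
    HasDerivAt (fun s : 𝕜 => evalSeries c (x + s • Pi.single i (1 : 𝕜)))
      (evalSeries (pderiv 𝕜 i c) x) 0 := by
  obtain ⟨ρ', hxρ', hρ'⟩ := exists_between hx
  have h0 : 0 ≤ ρ' := (norm_nonneg x).trans hxρ'.le
  have hinj : Function.Injective fun a : σ →₀ ℕ => a + Finsupp.single i 1 :=
    fun a b hab => by simpa using hab
  have hrange : ∀ a : σ →₀ ℕ, a ∉ Set.range (fun a : σ →₀ ℕ => a + Finsupp.single i 1) →
      a i = 0 := by
    intro a ha
    by_contra h'
    refine ha ⟨a - Finsupp.single i 1, ?_⟩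
    ext j
    by_cases hj : j = i
    · subst hj; simp; omega
    · simp [Ne.symm hj]
  set y : 𝕜 → σ → 𝕜 := fun s => x + s • Pi.single i (1 : 𝕜) with hy
  have hd := h.pderiv h0 hρ' i
  have hu : Summable fun a : σ →₀ ℕ =>
      ‖coeff a c‖ * (a i * ρ' ^ (a - Finsupp.single i 1).degree) := by
    rw [← hinj.summable_iff]
    · refine hd.congr fun a => ?_
      have : ‖(a i : 𝕜) + 1‖ = a i + 1 := by
        have : (a i : 𝕜) + 1 = ((a i + 1 : ℕ) : 𝕜) := by push_cast; rfl
        rw [this, RCLike.norm_natCast]; push_cast; rfl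
      simp [coeff_pderiv, this, mul_assoc]
    · intro a ha
      simp [hrange a ha]
  have hball : ∀ s ∈ Metric.ball (0 : 𝕜) (ρ' - ‖x‖), ‖y s‖ ≤ ρ' := by
    intro s hs
    rw [mem_ball_zero_iff] at hs
    calc ‖y s‖ ≤ ‖x‖ + ‖s • (Pi.single i (1 : 𝕜) : σ → 𝕜)‖ := norm_add_le _ _
      _ = ‖x‖ + ‖s‖ := by rw [norm_smul, Pi.norm_single]; simp
      _ ≤ ρ' := by linarith
  have key := hasDerivAt_tsum_of_isPreconnected (𝕜 := 𝕜)
    (g := fun a s => coeff a c * ∏ j, y s j ^ a j)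
    (g' := fun a s => coeff a c * (a i * ∏ j, y s j ^ (a - Finsupp.single i 1 : σ →₀ ℕ) j))
    (t := Metric.ball 0 (ρ' - ‖x‖)) (y₀ := 0) (y := 0) hu Metric.isOpen_ball
    (convex_ball _ _).isPreconnected
    (fun a s _ => (hasDerivAt_prod_pow a i x s).const_mul _)
    (fun a s hs => by
      rw [norm_mul, norm_mul, RCLike.norm_natCast]
      gcongr
      exact norm_prod_pow_le (hball s hs) _)
    (by simpa using hxρ')
    (h.summable (by simpa [hy] using hx.le)) (by simpa using hxρ')
  have hy0 : y 0 = x := by simp [hy]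
  refine key.congr_deriv ?_
  rw [hy0]
  unfold evalSeries
  rw [← hinj.tsum_eq (f := fun a : σ →₀ ℕ =>
    coeff a c * (a i * ∏ j, x j ^ (a - Finsupp.single i 1 : σ →₀ ℕ) j))]
  · refine tsum_congr fun a => ?_
    simp [coeff_pderiv, mul_assoc]
  · intro a ha
    by_contra h'
    simp [hrange a h'] at ha

/-- Presents a monomial as the diagonal of a multilinear map of norm at most one, so that a power
series can be repackaged as a `FormalMultilinearSeries` with the same majorant. -/
theorem exists_multilinear_prod_pow (a : σ →₀ ℕ) :
    ∃ m : ContinuousMultilinearMap 𝕜 (fun _ : Fin a.degree => σ → 𝕜) 𝕜,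
      ‖m‖ ≤ 1 ∧ ∀ x, m (fun _ => x) = ∏ i, x i ^ a i := by
  classical
  have hlen : (Finsupp.toMultiset a).toList.length = a.degree := by
    rw [Multiset.length_toList, Finsupp.card_toMultiset, Finsupp.degree_eq_sum,
      Finsupp.sum_fintype _ _ (fun _ => rfl)]
    rfl
  set l := (Finsupp.toMultiset a).toList with hl
  refine ⟨(ContinuousMultilinearMap.mkPiAlgebraFin 𝕜 a.degree 𝕜).compContinuousLinearMap
    fun j => ContinuousLinearMap.proj (l.get (j.cast hlen.symm)), ?_, fun x => ?_⟩
  · refine ContinuousMultilinearMap.opNorm_le_bound zero_le_one fun v => ?_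
    simp only [ContinuousMultilinearMap.compContinuousLinearMap_apply,
      ContinuousMultilinearMap.mkPiAlgebraFin_apply, ContinuousLinearMap.proj_apply, one_mul]
    rw [List.prod_ofFn, norm_prod]
    exact Finset.prod_le_prod (fun _ _ => norm_nonneg _) fun j _ => norm_le_pi_norm _ _
  · simp only [ContinuousMultilinearMap.compContinuousLinearMap_apply,
      ContinuousMultilinearMap.mkPiAlgebraFin_apply, ContinuousLinearMap.proj_apply]
    have h1 : (List.ofFn fun j : Fin a.degree => x (l.get (j.cast hlen.symm))) = l.map x := by
      refine List.ext_get (by simp [hlen]) fun n h1 h2 => ?_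
      simp
    rw [h1, ← Multiset.prod_coe, ← Multiset.map_coe, hl, Multiset.coe_toList,
      Finsupp.toMultiset_map, Finsupp.prod_toMultiset, Finsupp.prod_mapDomain_index
        (by simp) (by intros; exact pow_add _ _ _), Finsupp.prod_fintype _ _ (by simp)]

theorem hasSum_fiberwise_degree {E : Type*} [NormedAddCommGroup E] [CompleteSpace E]
    {f : (σ →₀ ℕ) → E} (hf : Summable f) :
    HasSum (fun n : ℕ => ∑' a : {a : σ →₀ ℕ // a.degree = n}, f a) (∑' a, f a) := by
  have h1 : HasSum (f ∘ Equiv.sigmaFiberEquiv (fun a : σ →₀ ℕ => a.degree)) (∑' a, f a) :=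
    (Equiv.hasSum_iff _).2 hf.hasSum
  exact h1.sigma fun n => (h1.summable.sigma_factor n).hasSum

/-- Grouping the monomials by total degree gives a formal multilinear series whose radius is at
least ρ. -/
theorem analyticOnNhd_evalSeries {ρ : ℝ} {c : MvPowerSeries σ 𝕜} (h : AbsConv ρ c) :
    AnalyticOnNhd 𝕜 (evalSeries c) (Metric.ball 0 ρ) := by
  classical
  intro x₀ hx₀
  have hρ : 0 < ρ := Metric.pos_of_mem_ball hx₀
  choose m hm hmx using exists_multilinear_prod_pow (σ := σ) (𝕜 := 𝕜)
  let M : ∀ n, {a : σ →₀ ℕ // a.degree = n} →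
      ContinuousMultilinearMap 𝕜 (fun _ : Fin n => σ → 𝕜) 𝕜 :=
    fun n a => a.2 ▸ (coeff a.1 c • m a.1)
  have hM : ∀ n a, ‖M n a‖ ≤ ‖coeff a.1 c‖ := by
    rintro n ⟨a, rfl⟩
    simp only [M]
    rw [norm_smul]
    exact mul_le_of_le_one_right (norm_nonneg _) (hm a)
  have hMx : ∀ n a x, M n a (fun _ => x) = coeff a.1 c * ∏ i, x i ^ a.1 i := by
    rintro n ⟨a, rfl⟩ x
    simp [M, hmx]
  have hsub : ∀ n, Summable fun a : {a : σ →₀ ℕ // a.degree = n} => ‖coeff a.1 c‖ := by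
    intro n
    have := (h.comp_injective (Subtype.val_injective (p := fun a : σ →₀ ℕ => a.degree = n)))
    refine (this.mul_right ((ρ ^ n)⁻¹)).congr ?_
    rintro ⟨a, rfl⟩
    simp only [Function.comp_apply]
    field_simp
  have hMs : ∀ n, Summable (M n) := fun n =>
    Summable.of_norm_bounded (hsub n) (hM n)
  let p : FormalMultilinearSeries 𝕜 (σ → 𝕜) 𝕜 := fun n => ∑' a, M n a
  have hrad : ENNReal.ofReal ρ ≤ p.radius := by
    refine FormalMultilinearSeries.le_radius_of_summable_norm p ?_
    refine Summable.of_nonneg_of_le (fun _ => by positivity) (fun n => ?_)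
      (hasSum_fiberwise_degree h).summable
    rw [Real.coe_toNNReal _ hρ.le]
    have h1 : ‖p n‖ ≤ ∑' a : {a : σ →₀ ℕ // a.degree = n}, ‖coeff a.1 c‖ :=
      tsum_of_norm_bounded (hsub n).hasSum (hM n)
    calc ‖p n‖ * ρ ^ n ≤ (∑' a : {a : σ →₀ ℕ // a.degree = n}, ‖coeff a.1 c‖) * ρ ^ n := by gcongr
      _ = _ := by
        rw [← tsum_mul_right]
        refine tsum_congr ?_
        rintro ⟨a, rfl⟩
        rfl
  have hp : HasFPowerSeriesOnBall (evalSeries c) p 0 (ENNReal.ofReal ρ) := by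
    refine ⟨hrad, by simpa using hρ, fun {y} hy => ?_⟩
    have hy' : ‖y‖ ≤ ρ := by
      rw [Metric.eball_ofReal, mem_ball_zero_iff] at hy
      exact hy.le
    rw [zero_add]
    have h1 : HasSum _ (evalSeries c y) := hasSum_fiberwise_degree (h.summable hy')
    suffices h3 : (fun n => p n fun _ => y) = fun n : ℕ =>
        ∑' a : {a : σ →₀ ℕ // a.degree = n}, coeff a.1 c * ∏ i, y i ^ a.1 i by
      rw [h3]; exact h1
    funext n
    have h2 := (hMs n).hasSum.mapL (ContinuousMultilinearMap.apply 𝕜 _ 𝕜 (fun _ : Fin n => y))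
    refine h2.tsum_eq.symm.trans ?_
    exact tsum_congr fun a => hMx n a y
  exact hp.analyticAt_of_mem (by simpa [Metric.eball_ofReal] using hx₀)

end PowerSeriesCalculus

end SLag

/-! ### Taylor coefficients of analytic functions and uniqueness of coefficients. -/

namespace SLag

section PowerSeriesTaylor

open MvPowerSeries Topology

variable {σ : Type*} [Fintype σ] {𝕜 : Type*} [RCLike 𝕜]

/-- Each homogeneous part is expanded over words in the basis vectors, and words with the same
letter counts are collected into one monomial. Counting words costs an exponential factor, paid for
by a smaller radius. -/
theorem exists_evalSeries_of_analyticAt {f : (σ → 𝕜) → 𝕜} {x₀ : σ → 𝕜} (hf : AnalyticAt 𝕜 f x₀) :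
    ∃ ρ > 0, ∃ c : MvPowerSeries σ 𝕜, AbsConv ρ c ∧
      ∀ x, ‖x‖ < ρ → f (x₀ + x) = evalSeries c x := by
  classical
  obtain ⟨p, r, hp⟩ := hf
  obtain ⟨r', hr'0, hr'⟩ := ENNReal.lt_iff_exists_nnreal_btwn.1 hp.r_pos
  have hr'1 : (0 : ℝ) < r' := by exact_mod_cast hr'0
  obtain ⟨C, hC0, hC⟩ := p.norm_mul_pow_le_of_lt_radius (hr'.trans_le hp.r_le)
  -- There are at most Nⁿ words of length n; dividing the radius by 2N leaves a factor 2⁻ⁿ. The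
  -- added one keeps N positive when there are no variables.
  set N : ℝ := Fintype.card σ + 1 with hN
  have hN0 : 0 < N := by positivity
  set ρ : ℝ := r' / (2 * N) with hρ
  have hρ0 : 0 < ρ := by positivity
  let cnt : (Σ n : ℕ, Fin n → σ) → (σ →₀ ℕ) := fun w => ∑ j, Finsupp.single (w.2 j) 1
  have hdeg : ∀ w, (cnt w).degree = w.1 := by
    intro w
    simp [cnt, map_sum]
  have hprod : ∀ (w : Σ n : ℕ, Fin n → σ) (x : σ → 𝕜),
      ∏ i, x i ^ cnt w i = ∏ j, x (w.2 j) := by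
    intro w x
    simp only [cnt, Finsupp.finsetSum_apply, ← Finset.prod_pow_eq_pow_sum]
    rw [Finset.prod_comm]
    refine Finset.prod_congr rfl fun j _ => ?_
    rw [Finset.prod_eq_single (w.2 j)] <;> simp +contextual [eq_comm]
  let P : (Σ n : ℕ, Fin n → σ) → 𝕜 := fun w => p w.1 fun j => Pi.single (w.2 j) 1
  have hP : ∀ w, ‖P w‖ ≤ ‖p w.1‖ := by
    intro w
    refine ((p w.1).le_opNorm _).trans (mul_le_of_le_one_right (norm_nonneg _) ?_)
    refine Finset.prod_le_one (fun _ _ => norm_nonneg _) fun j _ => ?_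
    rw [Pi.norm_single]
    simp
  have hsum : Summable fun w => ‖P w‖ * ρ ^ w.1 := by
    rw [summable_sigma_of_nonneg (fun _ => by positivity)]
    refine ⟨fun n => Summable.of_finite, ?_⟩
    refine Summable.of_nonneg_of_le (fun n => tsum_nonneg fun _ => by positivity) (fun n => ?_)
      ((summable_geometric_of_lt_one (r := (1 / 2 : ℝ)) (by norm_num) (by norm_num)).mul_left C)
    rw [tsum_fintype]
    calc ∑ w : Fin n → σ, ‖P ⟨n, w⟩‖ * ρ ^ n ≤ ∑ w : Fin n → σ, ‖p n‖ * ρ ^ n := by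
          gcongr with w; exact hP ⟨n, w⟩
      _ = (Fintype.card σ : ℝ) ^ n * (‖p n‖ * ρ ^ n) := by simp
      _ ≤ N ^ n * (‖p n‖ * ρ ^ n) := by
          gcongr; linarith
      _ = (‖p n‖ * r' ^ n) * (1 / 2) ^ n := by
          rw [hρ]; simp only [div_pow, mul_pow]; field_simp; simp
      _ ≤ _ := by gcongr; exact hC n
  let e := Equiv.sigmaFiberEquiv cnt
  refine ⟨ρ, hρ0, fun a => ∑' w : {w // cnt w = a}, P w, ?_, fun x hx => ?_⟩
  · have h1 : Summable fun q : (Σ a, {w // cnt w = a}) => ‖P q.2‖ * ρ ^ q.1.degree := by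
      rw [← e.summable_iff] at hsum
      refine hsum.congr ?_
      rintro ⟨a, w, rfl⟩
      simp [e, hdeg]
    refine Summable.of_nonneg_of_le (fun _ => by positivity) (fun a => ?_) h1.sigma
    change ‖∑' w : {w // cnt w = a}, P w‖ * _ ≤ _
    change _ ≤ ∑' w : {w // cnt w = a}, ‖P w‖ * ρ ^ a.degree
    rw [tsum_mul_right]
    have h2 : Summable fun w : {w // cnt w = a} => ‖P w‖ :=
      ((h1.sigma_factor a).mul_right ((ρ ^ a.degree)⁻¹)).congr fun w => by field_simp
    gcongr
    exact norm_tsum_le_tsum_norm h2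
  · have hxw : ∀ w : Σ n : ℕ, Fin n → σ, ‖∏ j, x (w.2 j)‖ ≤ ρ ^ w.1 := by
      intro w
      rw [← hprod, ← hdeg w]
      exact norm_prod_pow_le hx.le _
    have hs : Summable fun w => P w * ∏ j, x (w.2 j) := by
      refine Summable.of_norm_bounded hsum fun w => ?_
      rw [norm_mul]
      gcongr
      exact hxw w
    have hxr : x ∈ Metric.eball (0 : σ → 𝕜) r := by
      rw [Metric.mem_eball, edist_zero_right]
      refine lt_trans ?_ hr'
      rw [← ofReal_norm, ← ENNReal.ofReal_coe_nnreal]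
      refine (ENNReal.ofReal_lt_ofReal_iff hr'1).2 (hx.trans_le ?_)
      rw [hρ]
      refine div_le_self hr'1.le ?_
      rw [hN]
      have : (0 : ℝ) ≤ Fintype.card σ := by positivity
      linarith
    have h1 := hp.hasSum hxr
    have h2 : HasSum (fun n => p n fun _ => x) (∑' w, P w * ∏ j, x (w.2 j)) := by
      refine hs.hasSum.sigma fun n => ?_
      convert hasSum_fintype _ using 1
      have hxe : x = ∑ i, x i • (Pi.single i 1 : σ → 𝕜) := by
        ext k; simp [Finset.sum_apply, Pi.single_apply]
      conv_lhs => rw [hxe]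
      rw [ContinuousMultilinearMap.map_sum]
      refine Finset.sum_congr rfl fun w _ => ?_
      rw [ContinuousMultilinearMap.map_smul_univ, smul_eq_mul, mul_comm]
    rw [h1.unique h2]
    rw [← e.tsum_eq]
    refine (Summable.tsum_sigma ((e.summable_iff).2 hs)).trans ?_
    unfold evalSeries
    refine tsum_congr fun a => ?_
    change _ = (∑' w : {w // cnt w = a}, P w) * _
    rw [← tsum_mul_right]
    refine tsum_congr ?_
    rintro ⟨w, rfl⟩
    rw [hprod]; rfl

/-- Induction on the degree: a coefficient of degree n + 1 is, up to a nonzero factor, a coefficient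
of degree n of a partial derivative, whose sum also vanishes. The radius is generalized because each
derivative halves it. -/
theorem eq_zero_of_evalSeries_eq_zero {ρ : ℝ} (hρ : 0 < ρ) {c : MvPowerSeries σ 𝕜}
    (hc : AbsConv ρ c) (h : ∀ x, ‖x‖ < ρ → evalSeries c x = 0) : c = 0 := by
  classical
  suffices H : ∀ (n : ℕ) (ρ : ℝ), 0 < ρ → ∀ c : MvPowerSeries σ 𝕜, AbsConv ρ c →
      (∀ x, ‖x‖ < ρ → evalSeries c x = 0) → ∀ a : σ →₀ ℕ, a.degree = n → coeff a c = 0 by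
    ext a
    exact H _ ρ hρ c hc h a rfl
  intro n
  induction n with
  | zero =>
    intro ρ hρ c _ h a ha
    rw [Finsupp.degree_eq_zero_iff] at ha
    rw [ha, ← evalSeries_zero_right]
    exact h 0 (by simpa using hρ)
  | succ n ih =>
    intro ρ hρ c hc h a ha
    obtain ⟨i, hi⟩ : ∃ i, a i ≠ 0 := by
      by_contra! h'
      have : a = 0 := Finsupp.ext h'
      simp [this] at ha
    have hab : a = (a - Finsupp.single i 1) + Finsupp.single i 1 := by
      ext j
      by_cases hj : j = i
      · subst hj; simp; omega
      · simp [Ne.symm hj]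
    have h1 := ih (ρ / 2) (by positivity) (MvPowerSeries.pderiv 𝕜 i c)
      (hc.pderiv (by positivity) (by linarith) i) (fun x hx => ?_) (a - Finsupp.single i 1) ?_
    · rw [coeff_pderiv, ← hab] at h1
      refine (mul_eq_zero.1 h1).resolve_right ?_
      exact_mod_cast Nat.succ_ne_zero ((a - Finsupp.single i (1 : ℕ) : σ →₀ ℕ) i)
    · have hx' : ‖x‖ < ρ := by linarith
      have h2 := hasDerivAt_evalSeries hc hx' i
      refine h2.unique ((hasDerivAt_const (0 : 𝕜) (0 : 𝕜)).congr_of_eventuallyEq ?_)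
      have h3 : ContinuousAt (fun s : 𝕜 => ‖x + s • (Pi.single i (1 : 𝕜) : σ → 𝕜)‖) 0 := by
        fun_prop
      filter_upwards [h3.eventually_lt_const (by simpa using hx')] with s hs using h _ hs
    · have h2 : a.degree = (a - Finsupp.single i 1).degree + 1 := by
        conv_lhs => rw [hab]
        simp
      omega

theorem absConv_map_ofReal {ρ : ℝ} {c : MvPowerSeries σ ℝ} (hc : AbsConv ρ c) :
    AbsConv ρ (MvPowerSeries.map (algebraMap ℝ 𝕜) c) :=
  hc.congr fun a => by simp

theorem evalSeries_map_ofReal (c : MvPowerSeries σ ℝ) (x : σ → ℝ) :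
    evalSeries (MvPowerSeries.map (algebraMap ℝ 𝕜) c) (fun i => (x i : 𝕜))
      = ((evalSeries c x : ℝ) : 𝕜) := by
  unfold evalSeries
  rw [RCLike.ofReal_tsum]
  refine tsum_congr fun a => ?_
  simp

end PowerSeriesTaylor

end SLag

/-! ### A weighted ℓ¹ Banach algebra of power series. -/

namespace SLag

section WeightedAlgebra

open MvPowerSeries Topology

variable {σ : Type*} [Fintype σ]

/-- The weight `k! n! / (k + n)!` where `k` is the exponent of the variable `e` and `n` the total
exponent of the other variables. -/
noncomputable def weight (e : σ) (a : σ →₀ ℕ) : ℝ := ((a.degree.choose (a e) : ℕ) : ℝ)⁻¹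

theorem choose_degree_pos (e : σ) (a : σ →₀ ℕ) : 0 < a.degree.choose (a e) :=
  Nat.choose_pos (Finsupp.le_degree e a)

theorem weight_pos (e : σ) (a : σ →₀ ℕ) : 0 < weight e a := by
  have := choose_degree_pos e a
  unfold weight
  positivity

theorem weight_le_one (e : σ) (a : σ →₀ ℕ) : weight e a ≤ 1 :=
  inv_le_one_of_one_le₀ (by exact_mod_cast choose_degree_pos e a)

/-- The product of the two binomial coefficients is one term of the Vandermonde sum for the third;
this makes the weighted norm submultiplicative. -/
theorem weight_add_le (e : σ) (a b : σ →₀ ℕ) : weight e (a + b) ≤ weight e a * weight e b := by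
  unfold weight
  have ha := choose_degree_pos e a
  have hb := choose_degree_pos e b
  rw [← mul_inv]
  refine inv_anti₀ (by positivity) ?_
  norm_cast
  rw [map_add, Finsupp.add_apply, Nat.add_choose_eq]
  exact Finset.single_le_sum (f := fun ij : ℕ × ℕ => a.degree.choose ij.1 * b.degree.choose ij.2)
    (fun _ _ => Nat.zero_le _) (a := (a e, b e))
    (Finset.HasAntidiagonal.mem_antidiagonal.2 rfl)

/-- A binomial coefficient of n is at most 2ⁿ, so weighted summability implies absolute convergence
on the polydisc of radius 1/2. -/
theorem pow_half_le_weight (e : σ) (a : σ →₀ ℕ) : (1 / 2 : ℝ) ^ a.degree ≤ weight e a := by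
  have ha := choose_degree_pos e a
  unfold weight
  rw [one_div, inv_pow]
  refine inv_anti₀ (by positivity) ?_
  exact_mod_cast Nat.choose_le_two_pow _ _

/-- Termwise estimate for `∂ᵢ ∫ de` on the weighted coefficients. -/
theorem weight_add_single_mul_le [DecidableEq σ] {e i : σ} (hi : i ≠ e) (a : σ →₀ ℕ) :
    weight e (a + Finsupp.single e 1) * ((a i + 1) / (a e + 1))
      ≤ weight e (a + Finsupp.single i 1) := by
  unfold weight
  have h1 := choose_degree_pos e (a + Finsupp.single e 1)
  have h2 := choose_degree_pos e (a + Finsupp.single i 1)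
  have hd1 : (a + Finsupp.single e 1).degree = a.degree + 1 := by simp
  have hd2 : (a + Finsupp.single i 1).degree = a.degree + 1 := by simp
  have he1 : (a + Finsupp.single e 1 : σ →₀ ℕ) e = a e + 1 := by simp
  have he2 : (a + Finsupp.single i 1 : σ →₀ ℕ) e = a e := by simp [hi]
  rw [hd1, he1] at h1 ⊢
  rw [hd2, he2] at h2 ⊢
  -- With n the degree and k the exponent of `e`, C(n+1, k+1)(k+1) = C(n+1, k)(n+1-k), and the
  -- estimate reduces to aᵢ + 1 ≤ n + 1 - k.
  have h3 := Nat.choose_succ_right_eq (a.degree + 1) (a e)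
  have h4 : a i + a e ≤ a.degree := by
    rw [Finsupp.degree_eq_sum, ← Finset.sum_pair hi]
    exact Finset.sum_le_sum_of_subset (Finset.subset_univ _)
  have h5 : (((a.degree + 1).choose (a e + 1) : ℕ) : ℝ) * (a e + 1)
      = ((a.degree + 1).choose (a e) : ℕ) * ((a.degree + 1 - a e : ℕ) : ℝ) := by exact_mod_cast h3
  have h6 : (a i : ℝ) + 1 ≤ ((a.degree + 1 - a e : ℕ) : ℝ) := by
    have : a i + 1 ≤ a.degree + 1 - a e := by omega
    exact_mod_cast this
  have h1' : (0 : ℝ) < ((a.degree + 1).choose (a e + 1) : ℕ) := by exact_mod_cast h1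
  have h2' : (0 : ℝ) < ((a.degree + 1).choose (a e) : ℕ) := by exact_mod_cast h2
  have h7 : (0 : ℝ) < (a e : ℝ) + 1 := by positivity
  rw [← div_eq_inv_mul, div_div, mul_comm ((a e : ℝ) + 1), h5, ← one_div,
    div_le_div_iff₀ (by have : (0:ℝ) < (a i : ℝ) + 1 := by positivity
                        have := this.trans_le h6
                        positivity) h2', one_mul, mul_comm]
  gcongr

/-- The analytic core of completeness: an absolutely convergent series in a weighted ℓ¹ space
converges coefficientwise, and Tonelli bounds the remainder by the tail of the norms. -/
theorem summable_weighted_tsum {A : Type*} (v : ℕ → A → ℝ) (w : A → ℝ) (hw : ∀ a, 0 < w a)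
    (hv : ∀ n, Summable fun a => ‖v n a‖ * w a) (hs : Summable fun n => ∑' a, ‖v n a‖ * w a) :
    (Summable fun a => ‖∑' n, v n a‖ * w a) ∧
      ∀ N, ∑' a, ‖∑' n, v n a - ∑ n ∈ Finset.range N, v n a‖ * w a
        ≤ ∑' n, ∑' a, ‖v (n + N) a‖ * w a := by
  have hprod : Summable fun q : ℕ × A => ‖v q.1 q.2‖ * w q.2 := by
    rw [summable_prod_of_nonneg (fun q => mul_nonneg (norm_nonneg _) (hw q.2).le)]
    exact ⟨hv, hs⟩
  have hswapN : ∀ N, Summable fun q : A × ℕ => ‖v (q.2 + N) q.1‖ * w q.1 := by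
    intro N
    have h1 : Function.Injective fun q : A × ℕ => (q.2 + N, q.1) := by
      rintro ⟨a, b⟩ ⟨c, d⟩ h
      simp only [Prod.mk.injEq, add_left_inj] at h
      rw [h.1, h.2]
    have h2 := Summable.comp_injective (f := fun q : ℕ × A => ‖v q.1 q.2‖ * w q.2) hprod h1
    exact h2
  have hcoef : ∀ a, Summable fun n => ‖v n a‖ := by
    intro a
    have h1 : Summable fun n => ‖v (n + 0) a‖ * w a :=
      Summable.prod_factor (f := fun q : A × ℕ => ‖v (q.2 + 0) q.1‖ * w q.1) (hswapN 0) a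
    simpa using (summable_mul_right_iff (hw a).ne').1 h1
  have hprodN : ∀ N, Summable fun a => ∑' n, ‖v (n + N) a‖ * w a := fun N =>
    Summable.prod (f := fun q : A × ℕ => ‖v (q.2 + N) q.1‖ * w q.1) (hswapN N)
  have hbound : ∀ (N : ℕ) (a : A),
      ‖∑' n, v (n + N) a‖ * w a ≤ ∑' n, ‖v (n + N) a‖ * w a := by
    intro N a
    rw [tsum_mul_right]
    exact mul_le_mul_of_nonneg_right
      (norm_tsum_le_tsum_norm ((summable_nat_add_iff N).2 (hcoef a))) (hw a).le
  have hsum : ∀ N, Summable fun a => ‖∑' n, v (n + N) a‖ * w a := fun N =>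
    Summable.of_nonneg_of_le (fun a => mul_nonneg (norm_nonneg _) (hw a).le) (hbound N)
      (hprodN N)
  refine ⟨hsum 0, fun N => ?_⟩
  calc _ = ∑' a, ‖∑' n, v (n + N) a‖ * w a := by
        refine tsum_congr fun a => ?_
        rw [← (hcoef a).of_norm.sum_add_tsum_nat_add N]
        rw [add_sub_cancel_left]
    _ ≤ ∑' a, ∑' n, ‖v (n + N) a‖ * w a :=
        (hsum N).tsum_le_tsum (hbound N) (hprodN N)
    _ = ∑' n, ∑' a, ‖v (n + N) a‖ * w a :=
        Summable.tsum_comm (f := fun n a => ‖v (n + N) a‖ * w a)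
          ((Equiv.prodComm ℕ A).summable_iff.2 (hswapN N) :)

/-- Power series with absolutely summable weighted coefficients. -/
noncomputable def weightedAlgebra (e : σ) : Subalgebra ℝ (MvPowerSeries σ ℝ) where
  carrier := {c | Summable fun a => ‖coeff a c‖ * weight e a}
  mul_mem' := by
    classical
    intro c d hc hd
    refine Summable.of_nonneg_of_le
      (fun a => mul_nonneg (norm_nonneg _) (weight_pos e a).le) (fun a => ?_)
      (summable_sum_mul_antidiagonal_of_summable_mul
        (summable_mul_of_summable_norm (R := ℝ) (hc.norm) (hd.norm)))
    rw [coeff_mul]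
    refine (mul_le_mul_of_nonneg_right (norm_sum_le _ _) (weight_pos e a).le).trans ?_
    rw [Finset.sum_mul]
    refine Finset.sum_le_sum fun p hp => ?_
    rw [← Finset.HasAntidiagonal.mem_antidiagonal.1 hp, norm_mul]
    calc _ ≤ ‖coeff p.1 c‖ * ‖coeff p.2 d‖ * (weight e p.1 * weight e p.2) := by
          gcongr; exact weight_add_le e _ _
      _ = _ := by ring
  add_mem' := by
    intro c d hc hd
    refine Summable.of_nonneg_of_le
      (fun a => mul_nonneg (norm_nonneg _) (weight_pos e a).le) (fun a => ?_) (hc.add hd)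
    rw [← add_mul, map_add]
    exact mul_le_mul_of_nonneg_right (norm_add_le _ _) (weight_pos e a).le
  algebraMap_mem' := by
    classical
    intro r
    refine summable_of_ne_finset_zero (s := {0}) fun a ha => ?_
    rw [Finset.mem_singleton] at ha
    simp [MvPowerSeries.algebraMap_apply, coeff_C, ha]

theorem mem_weightedAlgebra {e : σ} {c : MvPowerSeries σ ℝ} :
    c ∈ weightedAlgebra e ↔ Summable fun a => ‖coeff a c‖ * weight e a := Iff.rfl

namespace weightedAlgebra

variable {e : σ}

theorem summable (c : weightedAlgebra e) :
    Summable fun a => ‖coeff a (c : MvPowerSeries σ ℝ)‖ * weight e a := c.2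

theorem sum_mul_le (c d : weightedAlgebra e) :
    ∑' a, ‖coeff a ((c * d : weightedAlgebra e) : MvPowerSeries σ ℝ)‖ * weight e a
      ≤ (∑' a, ‖coeff a (c : MvPowerSeries σ ℝ)‖ * weight e a)
        * ∑' a, ‖coeff a (d : MvPowerSeries σ ℝ)‖ * weight e a := by
  classical
  have hs := summable (c * d)
  have hc := summable c
  have hd := summable d
  rw [Subalgebra.coe_mul] at *
  generalize (c : MvPowerSeries σ ℝ) = c at *
  generalize (d : MvPowerSeries σ ℝ) = d at *
  have h := summable_mul_of_summable_norm (R := ℝ) hc.norm hd.norm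
  have h' := hc.tsum_mul_tsum_eq_tsum_sum_antidiagonal hd h
  rw [h']
  refine hs.tsum_le_tsum (fun a => ?_) (summable_sum_mul_antidiagonal_of_summable_mul
    (f := fun a => ‖coeff a c‖ * weight e a) (g := fun a => ‖coeff a d‖ * weight e a) h)
  rw [coeff_mul]
  refine (mul_le_mul_of_nonneg_right (norm_sum_le _ _) (weight_pos e a).le).trans ?_
  rw [Finset.sum_mul]
  refine Finset.sum_le_sum fun p hp => ?_
  rw [← Finset.HasAntidiagonal.mem_antidiagonal.1 hp, norm_mul]
  calc _ ≤ ‖coeff p.1 c‖ * ‖coeff p.2 d‖ * (weight e p.1 * weight e p.2) := by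
        gcongr; exact weight_add_le e _ _
    _ = _ := by ring

/-- The weighted `ℓ¹` norm. -/
noncomputable def ringNorm (e : σ) : RingNorm (weightedAlgebra e) where
  toFun c := ∑' a, ‖coeff a (c : MvPowerSeries σ ℝ)‖ * weight e a
  map_zero' := by simp
  add_le' c d := by
    rw [← (summable c).tsum_add (summable d)]
    refine (summable (c + d)).tsum_le_tsum (fun a => ?_) ((summable c).add (summable d))
    rw [← add_mul, Subalgebra.coe_add, map_add]
    exact mul_le_mul_of_nonneg_right (norm_add_le _ _) (weight_pos e a).le
  neg' c := by simp
  mul_le' := sum_mul_le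
  eq_zero_of_map_eq_zero' c hc := by
    ext a
    have h := (summable c).le_tsum a
      (fun b _ => mul_nonneg (norm_nonneg _) (weight_pos e b).le)
    rw [hc] at h
    have h2 := le_antisymm h (mul_nonneg (norm_nonneg _) (weight_pos e a).le)
    simpa [(weight_pos e a).ne'] using h2

noncomputable instance : NormedCommRing (weightedAlgebra e) :=
  { (ringNorm e).toNormedRing with mul_comm := mul_comm }

theorem norm_def (c : weightedAlgebra e) :
    ‖c‖ = ∑' a, ‖coeff a (c : MvPowerSeries σ ℝ)‖ * weight e a := rfl

noncomputable instance : NormedAlgebra ℝ (weightedAlgebra e) where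
  norm_smul_le r c := by
    rw [norm_def, norm_def, ← tsum_mul_left]
    refine le_of_eq (tsum_congr fun a => ?_)
    simp [mul_assoc]

theorem absConv (c : weightedAlgebra e) : AbsConv (1 / 2) (c : MvPowerSeries σ ℝ) :=
  Summable.of_nonneg_of_le (fun _ => by positivity)
    (fun a => by gcongr; exact pow_half_le_weight e a) (summable c)

instance : CompleteSpace (weightedAlgebra e) := by
  refine NormedAddCommGroup.completeSpace_of_summable_imp_tendsto fun u hu => ?_
  obtain ⟨hS, htail⟩ := summable_weighted_tsum (fun n a => coeff a (u n : MvPowerSeries σ ℝ))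
    (weight e) (weight_pos e) (fun n => summable (u n)) hu
  let S : MvPowerSeries σ ℝ := fun a => ∑' n, coeff a (u n : MvPowerSeries σ ℝ)
  have hS' : S ∈ weightedAlgebra e := hS
  refine ⟨⟨S, hS'⟩, ?_⟩
  rw [tendsto_iff_norm_sub_tendsto_zero]
  refine squeeze_zero (fun _ => norm_nonneg _) (fun N => ?_) (tendsto_sum_nat_add fun n => ‖u n‖)
  rw [norm_sub_rev]
  refine le_of_eq_of_le ?_ (htail N)
  refine tsum_congr fun a => ?_
  rw [Subalgebra.coe_sub, map_sub, AddSubmonoidClass.coe_finsetSum, map_sum]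
  rfl

end weightedAlgebra

end WeightedAlgebra

end SLag

/-! ### Formal integration and the bounded operators ∂ᵢ∫. -/

namespace SLag

section Integration

open MvPowerSeries Topology

variable {σ : Type*} [Fintype σ]

/-- Formal integration of a power series in the variable `e`. -/
noncomputable def integral (e : σ) : MvPowerSeries σ ℝ →ₗ[ℝ] MvPowerSeries σ ℝ where
  toFun c := fun a => if a e = 0 then 0 else coeff (a - Finsupp.single e 1) c / a e
  map_add' c d := by
    ext a
    change (if a e = 0 then (0 : ℝ) else _) = (if a e = 0 then (0 : ℝ) else _)
      + (if a e = 0 then (0 : ℝ) else _)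
    split_ifs
    · simp
    · rw [map_add, add_div]
  map_smul' r c := by
    ext a
    change (if a e = 0 then (0 : ℝ) else _) = r * (if a e = 0 then (0 : ℝ) else _)
    split_ifs
    · simp
    · simp [mul_div_assoc]

theorem coeff_integral (e : σ) (c : MvPowerSeries σ ℝ) (a : σ →₀ ℕ) :
    coeff a (integral e c) = if a e = 0 then 0 else coeff (a - Finsupp.single e 1) c / a e := rfl

theorem sub_single_add_single {i : σ} {a : σ →₀ ℕ} (h : a i ≠ 0) :
    a - Finsupp.single i 1 + Finsupp.single i 1 = a := by
  classical
  ext j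
  by_cases hj : j = i
  · subst hj; simp; omega
  · simp [Ne.symm hj]

theorem coeff_add_single_integral (e : σ) (c : MvPowerSeries σ ℝ) (a : σ →₀ ℕ) :
    coeff (a + Finsupp.single e 1) (integral e c) = coeff a c / (a e + 1) := by
  rw [coeff_integral]
  simp

theorem pderiv_integral_self (e : σ) (c : MvPowerSeries σ ℝ) :
    pderiv ℝ e (integral e c) = c := by
  ext a
  rw [coeff_pderiv, coeff_add_single_integral]
  have : (a e : ℝ) + 1 ≠ 0 := by positivity
  field_simp

theorem pderiv_integral_of_ne {e i : σ} (h : i ≠ e) (c : MvPowerSeries σ ℝ) :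
    pderiv ℝ i (integral e c) = integral e (pderiv ℝ i c) := by
  classical
  ext a
  rw [coeff_pderiv]
  by_cases ha : a e = 0
  · simp [coeff_integral, ha, h]
  · obtain ⟨b, rfl⟩ : ∃ b, a = b + Finsupp.single e 1 := ⟨_, (sub_single_add_single ha).symm⟩
    rw [add_right_comm, coeff_add_single_integral, coeff_add_single_integral, coeff_pderiv]
    simp [h.symm]
    ring

theorem AbsConv.integral {ρ : ℝ} (hρ : 0 ≤ ρ) {c : MvPowerSeries σ ℝ} (hc : AbsConv ρ c) (e : σ) :
    AbsConv ρ (integral e c) := by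
  classical
  have hinj : Function.Injective fun a : σ →₀ ℕ => a + Finsupp.single e 1 :=
    fun a b hab => by simpa using hab
  unfold AbsConv
  rw [← hinj.summable_iff]
  · refine Summable.of_nonneg_of_le (fun _ => mul_nonneg (norm_nonneg _) (pow_nonneg hρ _))
      (fun a => ?_) (hc.mul_right ρ)
    have h1 : (1 : ℝ) ≤ a e + 1 := by simp
    simp only [Function.comp_apply, coeff_add_single_integral]
    rw [norm_div, Real.norm_of_nonneg (by positivity : (0 : ℝ) ≤ a e + 1), map_add,
      Finsupp.degree_single, pow_succ, ← mul_assoc]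
    gcongr
    exact div_le_self (norm_nonneg _) h1
  · intro a ha
    have : a e = 0 := by
      by_contra h
      exact ha ⟨_, sub_single_add_single h⟩
    simp [coeff_integral, this]

theorem evalSeries_integral_eq_zero (e : σ) (c : MvPowerSeries σ ℝ) {x : σ → ℝ} (hx : x e = 0) :
    evalSeries (integral e c) x = 0 := by
  unfold evalSeries
  rw [← tsum_zero (β := σ →₀ ℕ)]
  refine tsum_congr fun a => ?_
  rw [coeff_integral]
  split_ifs with h
  · simp
  · rw [Finset.prod_eq_zero (Finset.mem_univ e) (by rw [hx, zero_pow h]), mul_zero]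

variable {e : σ}

theorem weight_mul_pderiv_integral_le {i : σ} (h : i ≠ e) (c : MvPowerSeries σ ℝ) (a : σ →₀ ℕ) :
    ‖coeff (a + Finsupp.single e 1) (pderiv ℝ i (integral e c))‖ * weight e (a + Finsupp.single e 1)
      ≤ ‖coeff (a + Finsupp.single i 1) c‖ * weight e (a + Finsupp.single i 1) := by
  classical
  rw [pderiv_integral_of_ne h, coeff_add_single_integral, coeff_pderiv]
  have h1 : ‖coeff (a + Finsupp.single i 1) c * ((a i : ℝ) + 1) / ((a e : ℝ) + 1)‖
      = ‖coeff (a + Finsupp.single i 1) c‖ * (((a i : ℝ) + 1) / ((a e : ℝ) + 1)) := by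
    rw [mul_div_assoc, norm_mul,
      Real.norm_of_nonneg (r := ((a i : ℝ) + 1) / ((a e : ℝ) + 1)) (by positivity)]
  rw [h1, mul_assoc]
  gcongr
  rw [mul_comm]
  exact weight_add_single_mul_le h a

/-- The weight is chosen for this bound: differentiation alone is unbounded, but ∂ᵢ∫de moves the
coefficient at a + eᵢ to a + e and the change of weight compensates the factor (aᵢ + 1)/(aₑ + 1).
Both shifts are injective, so the norm does not grow. -/
theorem pderiv_integral_mem {i : σ} (h : i ≠ e) (c : weightedAlgebra e) :
    pderiv ℝ i (integral e (c : MvPowerSeries σ ℝ)) ∈ weightedAlgebra e ∧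
    ∑' a, ‖coeff a (pderiv ℝ i (integral e (c : MvPowerSeries σ ℝ)))‖ * weight e a ≤ ‖c‖ := by
  classical
  have hinj : ∀ j : σ, Function.Injective fun a : σ →₀ ℕ => a + Finsupp.single j 1 :=
    fun j a b hab => by simpa using hab
  have hc := weightedAlgebra.summable c
  rw [weightedAlgebra.norm_def]
  generalize (c : MvPowerSeries σ ℝ) = c at *
  have h0 : ∀ a ∉ Set.range fun a : σ →₀ ℕ => a + Finsupp.single e 1,
      ‖coeff a (pderiv ℝ i (integral e c))‖ * weight e a = 0 := by
    intro a ha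
    have : a e = 0 := by
      by_contra h
      exact ha ⟨_, sub_single_add_single h⟩
    simp [pderiv_integral_of_ne h, coeff_integral, this]
  have hs1 : Summable fun a : σ →₀ ℕ =>
      ‖coeff (a + Finsupp.single i 1) c‖ * weight e (a + Finsupp.single i 1) :=
    Summable.comp_injective (f := fun a => ‖coeff a c‖ * weight e a) hc (hinj i)
  have hs2 : Summable fun a : σ →₀ ℕ =>
      ‖coeff (a + Finsupp.single e 1) (pderiv ℝ i (integral e c))‖
        * weight e (a + Finsupp.single e 1) :=
    Summable.of_nonneg_of_le (fun a => mul_nonneg (norm_nonneg _) (weight_pos e _).le)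
      (weight_mul_pderiv_integral_le h c) hs1
  refine ⟨((hinj e).summable_iff h0).1 hs2, ?_⟩
  have h1 := (hinj e).tsum_eq
    (f := fun a => ‖coeff a (pderiv ℝ i (integral e c))‖ * weight e a) (fun a ha => by
      by_contra h'
      exact ha (h0 a h'))
  rw [← h1]
  refine (hs2.tsum_le_tsum (weight_mul_pderiv_integral_le h c) hs1).trans ?_
  exact tsum_comp_le_tsum_of_inj hc (fun a => mul_nonneg (norm_nonneg _) (weight_pos e a).le)
    (hinj i)

/-- The operator `∂ᵢ ∫ de` on the weighted algebra, for `i ≠ e`. -/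
noncomputable def derivIntegral (e : σ) (i : {i : σ // i ≠ e}) :
    weightedAlgebra e →L[ℝ] weightedAlgebra e :=
  LinearMap.mkContinuous
    { toFun := fun c => ⟨pderiv ℝ i.1 (integral e (c : MvPowerSeries σ ℝ)),
        (pderiv_integral_mem i.2 c).1⟩
      map_add' := fun c d => by ext1; simp
      map_smul' := fun r c => by ext1; simp } 1 fun c => by
        rw [one_mul]
        exact (pderiv_integral_mem i.2 c).2

theorem coe_derivIntegral (i : {i : σ // i ≠ e}) (c : weightedAlgebra e) :
    (derivIntegral e i c : MvPowerSeries σ ℝ) = pderiv ℝ i.1 (integral e c) := rfl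

end Integration

end SLag

/-! ### The Hermitian determinant, the complex Hessian and anisotropic dilations. -/

namespace SLag

section Solver

open MvPowerSeries Topology

/-- The determinant of the Hermitian matrix `A + iB`, with `A` symmetric and `B` antisymmetric, in
terms of the entries `a₁₁, a₁₂, a₁₃, a₂₂, a₂₃, a₃₃, b₁₂, b₁₃, b₂₃`. -/
def hermDet {R : Type*} [CommRing R] (a : Fin 9 → R) : R :=
  a 0 * a 3 * a 5 + 2 * (a 1 * a 2 * a 4) - a 0 * a 4 ^ 2 - a 3 * a 2 ^ 2 - a 5 * a 1 ^ 2
    - (a 0 * a 8 ^ 2 + a 3 * a 7 ^ 2 + a 5 * a 6 ^ 2 - 2 * (a 1 * a 8 * a 7)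
      + 2 * (a 2 * a 8 * a 6) - 2 * (a 4 * a 7 * a 6))

/-- The upper left `2 × 2` minor of `A + iB`. -/
def hermMinor {R : Type*} [CommRing R] (a : Fin 9 → R) : R := a 0 * a 3 - a 1 ^ 2 - a 6 ^ 2

/-- The entries of the complex Hessian in terms of the real Hessian with respect to
`x₁, x₂, x₃, y₁, y₂, y₃`. -/
noncomputable def hess {M : Type*} [AddCommGroup M] [Module ℝ M] (d : Fin 6 → Fin 6 → M) :
    Fin 9 → M :=
  fun i => (1 / 4 : ℝ) • (![d 0 0 + d 3 3, d 0 1 + d 3 4, d 0 2 + d 3 5, d 1 1 + d 4 4,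
    d 1 2 + d 4 5, d 2 2 + d 5 5, d 3 1 - d 0 4, d 3 2 - d 0 5, d 4 2 - d 1 5] : Fin 9 → M) i

theorem map_hermDet {R S : Type*} [CommRing R] [CommRing S] (f : R →+* S) (a : Fin 9 → R) :
    f (hermDet a) = hermDet fun i => f (a i) := by
  have h2 : f 2 = 2 := map_ofNat f 2
  simp [hermDet, h2]

theorem map_hess {M N : Type*} [AddCommGroup M] [Module ℝ M] [AddCommGroup N] [Module ℝ N]
    (f : M →ₗ[ℝ] N) (d : Fin 6 → Fin 6 → M) (i : Fin 9) :
    f (hess d i) = hess (fun j k => f (d j k)) i := by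
  unfold hess
  rw [map_smul]
  congr 1
  fin_cases i <;> simp

/-- Evaluation at a point as an algebra homomorphism. -/
noncomputable def evalHom {σ : Type*} [Fintype σ] (e : σ) (x : σ → ℝ) (hx : ‖x‖ ≤ 1 / 2) :
    weightedAlgebra e →ₐ[ℝ] ℝ :=
  AlgHom.ofLinearMap
    { toFun := fun c => evalSeries (c : MvPowerSeries σ ℝ) x
      map_add' := fun c d =>
        evalSeries_add (weightedAlgebra.absConv c) (weightedAlgebra.absConv d) hx
      map_smul' := fun r c => evalSeries_smul r _ x }
    (by
      classical
      change evalSeries (1 : MvPowerSeries σ ℝ) x = 1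
      unfold evalSeries
      rw [tsum_eq_single 0]
      · simp
      · intro a ha
        rw [coeff_one, if_neg ha, zero_mul])
    (fun c d => evalSeries_mul (weightedAlgebra.absConv c) (weightedAlgebra.absConv d) hx)

theorem evalHom_apply {σ : Type*} [Fintype σ] (e : σ) (x : σ → ℝ) (hx : ‖x‖ ≤ 1 / 2)
    (c : weightedAlgebra e) : evalHom e x hx c = evalSeries (c : MvPowerSeries σ ℝ) x := rfl

section Scaling

variable {σ : Type*} [Fintype σ] [DecidableEq σ] (e : σ)

/-- The anisotropic dilation with factor `r ^ 2` in the direction `e` and `r` in the others. -/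
def dilate (r : ℝ) (x : σ → ℝ) : σ → ℝ := fun j => (if j = e then r ^ 2 else r) * x j

/-- The power series of `x ↦ c (dilate r x)`. -/
noncomputable def dilateSeries (r : ℝ) (c : MvPowerSeries σ ℝ) : MvPowerSeries σ ℝ :=
  fun a => r ^ (a.degree + a e) * coeff a c

theorem coeff_dilateSeries (r : ℝ) (c : MvPowerSeries σ ℝ) (a : σ →₀ ℕ) :
    coeff a (dilateSeries e r c) = r ^ (a.degree + a e) * coeff a c := rfl

theorem evalSeries_dilateSeries (r : ℝ) (c : MvPowerSeries σ ℝ) (x : σ → ℝ) :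
    evalSeries (dilateSeries e r c) x = evalSeries c (dilate e r x) := by
  unfold evalSeries
  refine tsum_congr fun a => ?_
  rw [coeff_dilateSeries, mul_comm (r ^ _), mul_assoc]
  congr 1
  simp only [dilate, mul_pow, Finset.prod_mul_distrib]
  congr 1
  have h1 : ∀ j, (if j = e then r ^ 2 else r) ^ a j = r ^ a j * (if j = e then r ^ a j else 1) := by
    intro j
    split_ifs
    · ring
    · simp
  simp only [h1, Finset.prod_mul_distrib, Finset.prod_pow_eq_pow_sum, Finset.prod_ite_eq',
    Finset.mem_univ, if_true, Finsupp.degree_eq_sum, pow_add]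

/-- Every nonconstant monomial gains at least one factor r, relative to the fixed majorant of radius
ρ. -/
theorem norm_dilateSeries_le {ρ r : ℝ} (hr0 : 0 < r) (hrρ : r ≤ ρ) (hr1 : r ≤ 1)
    (c : MvPowerSeries σ ℝ) {a : σ →₀ ℕ} (ha : a ≠ 0) :
    ‖coeff a (dilateSeries e r c)‖ * weight e a
      ≤ r / ρ * (‖coeff a c‖ * ρ ^ a.degree) := by
  have hρ : 0 < ρ := hr0.trans_le hrρ
  have h1 : ∃ n, a.degree = n + 1 := Nat.exists_eq_succ_of_ne_zero (by
    rwa [Ne, Finsupp.degree_eq_zero_iff])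
  obtain ⟨n, hn⟩ := h1
  rw [coeff_dilateSeries, norm_mul, Real.norm_of_nonneg (by positivity), hn]
  calc r ^ (n + 1 + a e) * ‖coeff a c‖ * weight e a ≤ r ^ (n + 1) * ‖coeff a c‖ * 1 := by
        have h1 := weight_le_one e a
        have h2 : r ^ (n + 1 + a e) ≤ r ^ (n + 1) :=
          pow_le_pow_of_le_one hr0.le hr1 (Nat.le_add_right _ _)
        have h3 := (weight_pos e a).le
        gcongr
    _ = r * r ^ n * ‖coeff a c‖ := by ring
    _ ≤ r * ρ ^ n * ‖coeff a c‖ := by gcongr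
    _ = _ := by field_simp; ring

theorem dilateSeries_mem {ρ r : ℝ} (hr0 : 0 < r) (hrρ : r ≤ ρ) (hr1 : r ≤ 1)
    {c : MvPowerSeries σ ℝ} (hc : AbsConv ρ c) :
    dilateSeries e r c ∈ weightedAlgebra e := by
  rw [mem_weightedAlgebra]
  refine Summable.of_norm_bounded_eventually (g := fun a => r / ρ * (‖coeff a c‖ * ρ ^ a.degree))
    (Summable.mul_left _ hc) ?_
  refine (Set.finite_singleton (0 : σ →₀ ℕ)).subset fun a ha => ?_
  by_contra h
  refine ha ?_
  change ‖‖coeff a (dilateSeries e r c)‖ * weight e a‖ ≤ r / ρ * (‖coeff a c‖ * ρ ^ a.degree)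
  rw [Real.norm_of_nonneg (mul_nonneg (norm_nonneg _) (weight_pos e a).le)]
  exact norm_dilateSeries_le e hr0 hrρ hr1 c h

/-- Zooming in at the origin, the dilated data converge in the weighted algebra to their constant
term; thus every analytic datum becomes a small perturbation of a constant. -/
theorem exists_dilated {ρ : ℝ} (hρ : 0 < ρ) {c : MvPowerSeries σ ℝ} (hc : AbsConv ρ c) :
    ∃ s : ℝ → weightedAlgebra e,
      Filter.Tendsto s (𝓝[>] 0) (𝓝 (algebraMap ℝ _ (evalSeries c 0))) ∧
      ∀ᶠ r in 𝓝[>] 0, (s r : MvPowerSeries σ ℝ) = dilateSeries e r c := by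
  classical
  -- The default value 0 is harmless: the dilated series belongs to the algebra for all small
  -- positive r.
  let s : ℝ → weightedAlgebra e := fun r =>
    if h : dilateSeries e r c ∈ weightedAlgebra e then ⟨_, h⟩ else 0
  have hs : ∀ᶠ r in 𝓝[>] (0 : ℝ), 0 < r ∧ r ≤ ρ ∧ r ≤ 1 := by
    filter_upwards [self_mem_nhdsWithin, nhdsWithin_le_nhds (eventually_le_nhds hρ),
      nhdsWithin_le_nhds (eventually_le_nhds one_pos)] with r h1 h2 h3 using ⟨h1, h2, h3⟩
  have hs2 : ∀ r, 0 < r ∧ r ≤ ρ ∧ r ≤ 1 →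
      (s r : MvPowerSeries σ ℝ) = dilateSeries e r c := by
    rintro r ⟨h1, h2, h3⟩
    simp only [s]
    rw [dif_pos (dilateSeries_mem e h1 h2 h3 hc)]
  refine ⟨s, ?_, hs.mono hs2⟩
  rw [tendsto_iff_norm_sub_tendsto_zero]
  set C := ∑' a, ‖coeff a c‖ * ρ ^ a.degree with hC
  have hlim : Filter.Tendsto (fun r : ℝ => r / ρ * C) (𝓝[>] 0) (𝓝 0) := by
    have : Filter.Tendsto (fun r : ℝ => r / ρ * C) (𝓝 0) (𝓝 (0 / ρ * C)) :=
      (Filter.tendsto_id.div_const ρ).mul_const C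
    simp only [zero_div, zero_mul] at this
    exact this.mono_left nhdsWithin_le_nhds
  refine squeeze_zero' (Filter.Eventually.of_forall fun _ => norm_nonneg _) ?_ hlim
  filter_upwards [hs] with r hr
  rw [weightedAlgebra.norm_def, hC, ← tsum_mul_left]
  refine Summable.tsum_le_tsum (fun a => ?_) (weightedAlgebra.summable _) (Summable.mul_left _ hc)
  have h1 : coeff a ((s r - algebraMap ℝ (weightedAlgebra e) (evalSeries c 0) :
      weightedAlgebra e) : MvPowerSeries σ ℝ)
      = coeff a (dilateSeries e r c) - if a = 0 then coeff 0 c else 0 := by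
    rw [Subalgebra.coe_sub, map_sub, hs2 r hr, Subalgebra.coe_algebraMap,
      MvPowerSeries.algebraMap_apply, coeff_C, evalSeries_zero_right]
    rfl
  rw [h1]
  by_cases ha : a = 0
  · have : (0 : ℝ) ≤ r / ρ := div_nonneg hr.1.le hρ.le
    subst ha
    simp only [coeff_dilateSeries, if_true]
    simp
    positivity
  · rw [if_neg ha, sub_zero]
    exact norm_dilateSeries_le e hr.1 hr.2.1 hr.2.2 c ha

end Scaling

end Solver

end SLag

/-! ### The Monge-Ampère equation in the weighted algebra. -/

namespace SLag

section MongeAmpere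

open MvPowerSeries Topology

/-- The weighted algebra in the variables `x₁, x₂, x₃, y₁, y₂, y₃` with `y₃` distinguished. -/
abbrev HessAlg : Type := weightedAlgebra (5 : Fin 6)

/-- The scaled second derivatives of `∫∫ u` in the weighted algebra: derivatives in directions
other than `5` cost a factor `r` each. -/
noncomputable def scaledHessian (r : ℝ) (u : HessAlg) :
    Fin 6 → Fin 6 → HessAlg := fun i j =>
  if hi : i = 5 then if hj : j = 5 then u else r • derivIntegral 5 ⟨j, hj⟩ u
  else if hj : j = 5 then r • derivIntegral 5 ⟨i, hi⟩ u
  else (r ^ 2) • derivIntegral 5 ⟨i, hi⟩ (derivIntegral 5 ⟨j, hj⟩ u)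

theorem contDiff_scaledHessian (i j : Fin 6) :
    ContDiff ℝ 1 fun q : ℝ × HessAlg => scaledHessian q.1 q.2 i j := by
  unfold scaledHessian
  split_ifs <;> fun_prop

/-- In the limit r = 0 only the pure second derivative in y₃ survives, so the limiting equation is
algebraic in `u`. -/
theorem scaledHessian_zero (u : HessAlg) (i j : Fin 6) :
    scaledHessian 0 u i j = if i = 5 ∧ j = 5 then u else 0 := by
  unfold scaledHessian
  split_ifs <;> simp_all

theorem contDiff_hermDet {E R : Type*} [NormedAddCommGroup E] [NormedSpace ℝ E] [NormedCommRing R]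
    [NormedAlgebra ℝ R] {f : E → Fin 9 → R} (hf : ∀ i, ContDiff ℝ 1 fun x => f x i) :
    ContDiff ℝ 1 fun x => hermDet (f x) := by
  have h := hf 0; have h1 := hf 1; have h2 := hf 2; have h3 := hf 3; have h4 := hf 4
  have h5 := hf 5; have h6 := hf 6; have h7 := hf 7; have h8 := hf 8
  unfold hermDet
  fun_prop

theorem contDiff_hess {E R : Type*} [NormedAddCommGroup E] [NormedSpace ℝ E]
    [NormedAddCommGroup R] [NormedSpace ℝ R] {f : E → Fin 6 → Fin 6 → R}
    (hf : ∀ i j, ContDiff ℝ 1 fun x => f x i j) (i : Fin 9) :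
    ContDiff ℝ 1 fun x => hess (f x) i := by
  unfold hess
  refine ContDiff.const_smul _ ?_
  fin_cases i <;> simp <;> first | exact (hf _ _).add (hf _ _) | exact (hf _ _).sub (hf _ _)

/-- Solvability of the Monge-Ampère equation in the weighted algebra for data close to constant
ones. -/
theorem exists_formal_solution (α : Fin 9 → ℝ) (hα : hermMinor α ≠ 0)
    (s : Fin 9 → ℝ → HessAlg) (F : ℝ → HessAlg)
    (hs : ∀ i, Filter.Tendsto (s i) (𝓝[>] 0) (𝓝 (algebraMap ℝ _ (α i))))
    (hF : Filter.Tendsto F (𝓝[>] 0) (𝓝 (algebraMap ℝ _ (hermDet α)))) :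
    ∀ᶠ r in 𝓝[>] 0, ∃ u : HessAlg,
      hermDet (fun i => s i r + hess (scaledHessian r u) i) = F r := by
  let Q : (Fin 9 → HessAlg) × ℝ × HessAlg → HessAlg := fun q =>
    hermDet fun i => q.1 i + hess (scaledHessian q.2.1 q.2.2) i
  have hQ : ContDiff ℝ 1 Q := by
    refine contDiff_hermDet fun i => ContDiff.add (by fun_prop) (contDiff_hess (fun j k => ?_) i)
    exact (contDiff_scaledHessian j k).comp contDiff_snd
  -- The data and the dilation factor are carried along as parameters, so that solvability for
  -- nearby data says that `Θ` is onto a neighbourhood.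
  let Θ : (Fin 9 → HessAlg) × ℝ × HessAlg → (Fin 9 → HessAlg) × ℝ × HessAlg := fun q => (q.1, q.2.1, Q q)
  have hΘ : ContDiff ℝ 1 Θ := by fun_prop
  let z : (Fin 9 → HessAlg) × ℝ × HessAlg := (fun i => algebraMap ℝ HessAlg (α i), 0, 0)
  have hQs : HasStrictFDerivAt Q (fderiv ℝ Q z) z :=
    hQ.contDiffAt.hasStrictFDerivAt one_ne_zero
  have hΘs : HasStrictFDerivAt Θ ((ContinuousLinearMap.fst ℝ _ _).prod
      (((ContinuousLinearMap.fst ℝ ℝ HessAlg).comp (ContinuousLinearMap.snd ℝ _ _)).prod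
        (fderiv ℝ Q z))) z := by
    refine HasStrictFDerivAt.prodMk hasStrictFDerivAt_fst
      (HasStrictFDerivAt.prodMk ?_ hQs)
    exact (hasStrictFDerivAt_fst).comp z hasStrictFDerivAt_snd
  -- At r = 0 only the entry a₃₃ is changed, by u/4, and the determinant is affine in it with slope
  -- the complementary minor.
  have hzero : ∀ u : HessAlg, Q (z.1, 0, u)
      = algebraMap ℝ HessAlg (hermDet α) + algebraMap ℝ HessAlg (hermMinor α / 4) * u := by
    intro u
    have h1 : ∀ i, hess (scaledHessian 0 u) i = if i = 5 then (1 / 4 : ℝ) • u else 0 := by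
      intro i
      unfold hess
      simp only [scaledHessian_zero]
      fin_cases i <;> simp
    have h2 : (1 / 4 : ℝ) • u = algebraMap ℝ HessAlg (1 / 4) * u := by rw [Algebra.smul_def]
    simp only [Q, h1, h2, z]
    have h5 : algebraMap ℝ HessAlg (hermMinor α / 4)
        = hermMinor (fun i => algebraMap ℝ HessAlg (α i)) * algebraMap ℝ HessAlg (1 / 4) := by
      rw [div_eq_mul_one_div, map_mul]
      congr 1
      simp only [hermMinor, map_sub, map_mul, map_pow]
    rw [map_hermDet, h5]
    simp only [hermDet, hermMinor]
    simp only [Fin.isValue, Fin.reduceEq, if_true, if_false, add_zero]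
    ring
  have hdir : ∀ v : HessAlg, fderiv ℝ Q z (0, 0, v) = algebraMap ℝ HessAlg (hermMinor α / 4) * v := by
    intro v
    have h1 : HasDerivAt (fun τ : ℝ => Q (z + τ • (0, 0, v))) (fderiv ℝ Q z (0, 0, v)) 0 := by
      have h2 : HasDerivAt (fun τ : ℝ => z + τ • ((0, 0, v) : (Fin 9 → HessAlg) × ℝ × HessAlg))
          ((0, 0, v) : (Fin 9 → HessAlg) × ℝ × HessAlg) 0 := by
        have h2' := (hasDerivAt_id (0 : ℝ)).smul_const ((0, 0, v) : (Fin 9 → HessAlg) × ℝ × HessAlg)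
        rw [one_smul] at h2'
        exact h2'.const_add z
      exact HasFDerivAt.comp_hasDerivAt (0 : ℝ) (by simpa using hQs.hasFDerivAt) h2
    have h3 : (fun τ : ℝ => Q (z + τ • (0, 0, v))) = fun τ : ℝ =>
        algebraMap ℝ HessAlg (hermDet α) + τ • (algebraMap ℝ HessAlg (hermMinor α / 4) * v) := by
      funext τ
      have : z + τ • ((0, 0, v) : (Fin 9 → HessAlg) × ℝ × HessAlg) = (z.1, 0, τ • v) := by
        simp [z]
      rw [this, hzero, mul_smul_comm]
    rw [h3] at h1
    refine h1.unique ?_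
    simpa using ((hasDerivAt_id (0 : ℝ)).smul_const
      (algebraMap ℝ HessAlg (hermMinor α / 4) * v)).const_add (algebraMap ℝ HessAlg (hermDet α))
  -- The derivative is triangular with diagonal block multiplication by the nonzero constant
  -- `hermMinor α / 4`. Only existence is wanted here, so surjectivity suffices.
  have hsurj := hΘs.map_nhds_eq_of_surj (by
    rw [LinearMap.range_eq_top]
    rintro ⟨b, η, w⟩
    refine ⟨(b, η, algebraMap ℝ HessAlg (4 / hermMinor α) * (w - fderiv ℝ Q z (b, η, 0))), ?_⟩
    have h1 : ∀ v : HessAlg, ((b, η, v) : (Fin 9 → HessAlg) × ℝ × HessAlg) = (b, η, 0) + (0, 0, v) := by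
      intro v; simp
    have h2 : ∀ v : HessAlg, fderiv ℝ Q z (b, η, v) = fderiv ℝ Q z (b, η, 0)
        + algebraMap ℝ HessAlg (hermMinor α / 4) * v := by
      intro v
      rw [h1, map_add, hdir]
    have h3 : algebraMap ℝ HessAlg (hermMinor α / 4) * (algebraMap ℝ HessAlg (4 / hermMinor α)
        * (w - fderiv ℝ Q z (b, η, 0))) = w - fderiv ℝ Q z (b, η, 0) := by
      rw [← mul_assoc, ← map_mul]
      have : hermMinor α / 4 * (4 / hermMinor α) = 1 := by field_simp
      rw [this, map_one, one_mul]
    have h4 := h2 (algebraMap ℝ HessAlg (4 / hermMinor α) * (w - fderiv ℝ Q z (b, η, 0)))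
    rw [h3, add_sub_cancel] at h4
    simpa using h4)
  have hΘz : Θ z = (fun i => algebraMap ℝ HessAlg (α i), 0, algebraMap ℝ HessAlg (hermDet α)) := by
    have h1 := hzero 0
    rw [mul_zero, add_zero] at h1
    exact Prod.ext rfl (Prod.ext rfl h1)
  have hlim : Filter.Tendsto (fun r : ℝ => ((fun i => s i r, r, F r) : (Fin 9 → HessAlg) × ℝ × HessAlg))
      (𝓝[>] 0) (𝓝 (Θ z)) := by
    rw [hΘz]
    refine Filter.Tendsto.prodMk_nhds (tendsto_pi_nhds.2 hs) (Filter.Tendsto.prodMk_nhds ?_ hF)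
    exact Filter.tendsto_id.mono_left nhdsWithin_le_nhds
  have hrange : Set.range Θ ∈ 𝓝 (Θ z) := by
    rw [← hsurj]
    exact Filter.range_mem_map
  filter_upwards [hlim.eventually hrange] with r hr
  obtain ⟨⟨a, t, u⟩, hq⟩ := hr
  simp only [Θ, Prod.mk.injEq] at hq
  obtain ⟨rfl, rfl, h3⟩ := hq
  exact ⟨u, h3⟩

end MongeAmpere

end SLag

/-! ### From the weighted algebra back to functions. -/

namespace SLag

section MongeAmpereFunctions

open MvPowerSeries Topology

/-- Componentwise rescaling. -/
noncomputable def rescaleCLM {σ : Type*} [Fintype σ] (μ : σ → ℝ) : (σ → ℝ) →L[ℝ] (σ → ℝ) :=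
  ContinuousLinearMap.pi fun j => μ j • ContinuousLinearMap.proj j

theorem rescaleCLM_apply {σ : Type*} [Fintype σ] (μ x : σ → ℝ) (j : σ) :
    rescaleCLM μ x j = μ j * x j := rfl

theorem differentiableAt_evalSeries {σ : Type*} [Fintype σ] {ρ : ℝ} {c : MvPowerSeries σ ℝ}
    (hc : AbsConv ρ c) {x : σ → ℝ} (hx : ‖x‖ < ρ) : DifferentiableAt ℝ (evalSeries c) x :=
  (analyticOnNhd_evalSeries hc x (by simpa using hx)).differentiableAt

theorem fderiv_evalSeries_rescale {σ : Type*} [Fintype σ] [DecidableEq σ] {ρ : ℝ}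
    {c : MvPowerSeries σ ℝ} (hc : AbsConv ρ c) (κ : ℝ) (μ : σ → ℝ) {x : σ → ℝ}
    (hx : ‖rescaleCLM μ x‖ < ρ) (i : σ) :
    fderiv ℝ (fun x => κ * evalSeries c (rescaleCLM μ x)) x (Pi.single i 1)
      = κ * μ i * evalSeries (pderiv ℝ i c) (rescaleCLM μ x) := by
  have h1 := differentiableAt_evalSeries hc hx
  have h2 : fderiv ℝ (evalSeries c) (rescaleCLM μ x) (Pi.single i 1)
      = evalSeries (pderiv ℝ i c) (rescaleCLM μ x) := by
    have h3 : HasDerivAt (fun s : ℝ => rescaleCLM μ x + s • (Pi.single i 1 : σ → ℝ))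
        (Pi.single i 1) 0 := by
      have h3' := (hasDerivAt_id (0 : ℝ)).smul_const (Pi.single i 1 : σ → ℝ)
      rw [one_smul] at h3'
      exact h3'.const_add _
    have h4 : HasDerivAt (fun s : ℝ => evalSeries c (rescaleCLM μ x + s • Pi.single i 1))
        (fderiv ℝ (evalSeries c) (rescaleCLM μ x) (Pi.single i 1)) 0 :=
      HasFDerivAt.comp_hasDerivAt_of_eq (0 : ℝ) h1.hasFDerivAt h3 (by simp)
    exact h4.unique (hasDerivAt_evalSeries hc hx i)
  have h5 : HasFDerivAt (fun x => evalSeries c (rescaleCLM μ x))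
      ((fderiv ℝ (evalSeries c) (rescaleCLM μ x)).comp (rescaleCLM μ)) x :=
    h1.hasFDerivAt.comp x (rescaleCLM μ).hasFDerivAt
  rw [(h5.const_mul κ).fderiv]
  have h6 : rescaleCLM μ (Pi.single i 1) = μ i • (Pi.single i 1 : σ → ℝ) := by
    ext j
    rw [rescaleCLM_apply]
    by_cases hj : j = i
    · subst hj; simp
    · simp [hj]
  simp only [smul_apply, ContinuousLinearMap.comp_apply, h6, map_smul, h2,
    smul_eq_mul]
  ring

/-- The second partial derivative `∂ᵢ ∂ⱼ` on real coordinate space. -/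
noncomputable def partial₂ {σ : Type*} [Fintype σ] [DecidableEq σ] (f : (σ → ℝ) → ℝ) (x : σ → ℝ)
    (i j : σ) : ℝ := fderiv ℝ (fun y => fderiv ℝ f y (Pi.single j 1)) x (Pi.single i 1)

theorem partial₂_evalSeries_rescale {σ : Type*} [Fintype σ] [DecidableEq σ] {ρ : ℝ}
    {c : MvPowerSeries σ ℝ} (hc : AbsConv ρ c) (κ : ℝ) (μ : σ → ℝ) {x : σ → ℝ}
    (hx : ‖rescaleCLM μ x‖ < ρ) (i j : σ) :
    partial₂ (fun x => κ * evalSeries c (rescaleCLM μ x)) x i j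
      = κ * μ j * μ i * evalSeries (pderiv ℝ i (pderiv ℝ j c)) (rescaleCLM μ x) := by
  obtain ⟨ρ', h1, h2⟩ := exists_between hx
  have h3 : ∀ᶠ y in 𝓝 x, fderiv ℝ (fun x => κ * evalSeries c (rescaleCLM μ x)) y (Pi.single j 1)
      = κ * μ j * evalSeries (pderiv ℝ j c) (rescaleCLM μ y) := by
    have h4 : ContinuousAt (fun y => ‖rescaleCLM μ y‖) x := by fun_prop
    filter_upwards [h4.eventually_lt_const hx] with y hy
    exact fderiv_evalSeries_rescale hc κ μ hy j
  unfold partial₂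
  rw [Filter.EventuallyEq.fderiv_eq h3]
  exact fderiv_evalSeries_rescale (hc.pderiv ((norm_nonneg _).trans h1.le) h2 j) _ μ h1 i

/-- This is the chain rule for ψ(x) = r⁴ d(x₁/r, …, y₂/r, y₃/r²) with d = ∫∫u: the prefactor r⁴
cancels the two factors r⁻² of ∂²/∂y₃², and every tangential derivative leaves one factor r. -/
theorem pderiv_pderiv_integral_integral (u : HessAlg) (r : ℝ) (hr : r ≠ 0) (i j : Fin 6) :
    ((scaledHessian r u i j : HessAlg) : MvPowerSeries (Fin 6) ℝ)
      = (r ^ 4 * (if j = 5 then (r ^ 2)⁻¹ else r⁻¹) * (if i = 5 then (r ^ 2)⁻¹ else r⁻¹)) •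
        pderiv ℝ i (pderiv ℝ j (integral 5 (integral 5 (u : MvPowerSeries (Fin 6) ℝ)))) := by
  unfold scaledHessian
  by_cases hi : i = 5
  · by_cases hj : j = 5
    · subst hi hj
      have h0 : r ^ 4 * (r ^ 2)⁻¹ * (r ^ 2)⁻¹ = 1 := by field_simp
      simp [pderiv_integral_self, h0]
    · have h0 : r ^ 4 * r⁻¹ * (r ^ 2)⁻¹ = r := by field_simp
      subst hi
      simp [hj, h0, coe_derivIntegral, pderiv_integral_of_ne hj, pderiv_integral_self]
  · by_cases hj : j = 5
    · have h0 : r ^ 4 * (r ^ 2)⁻¹ * r⁻¹ = r := by field_simp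
      subst hj
      simp [hi, h0, coe_derivIntegral, pderiv_integral_self]
    · have h0 : r ^ 4 * r⁻¹ * r⁻¹ = r ^ 2 := by field_simp
      simp [hi, hj, h0, coe_derivIntegral, pderiv_integral_of_ne hj]

/-- Local solvability of the Cauchy problem for the complex Monge-Ampère equation with real
analytic data: the solution `ψ` vanishes to second order on `{y₃ = 0}`. -/
theorem exists_mongeAmpere_solution (a : Fin 9 → (Fin 6 → ℝ) → ℝ) (F : (Fin 6 → ℝ) → ℝ)
    (ha : ∀ i, AnalyticAt ℝ (a i) 0) (hF : AnalyticAt ℝ F 0)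
    (hm : hermMinor (fun i => a i 0) ≠ 0) (h0 : hermDet (fun i => a i 0) = F 0) :
    ∃ ρ > 0, ∃ ψ : (Fin 6 → ℝ) → ℝ, AnalyticOnNhd ℝ ψ (Metric.ball 0 ρ) ∧
      (∀ x ∈ Metric.ball (0 : Fin 6 → ℝ) ρ, x 5 = 0 →
        ψ x = 0 ∧ fderiv ℝ ψ x (Pi.single 5 1) = 0) ∧
      ∀ x ∈ Metric.ball (0 : Fin 6 → ℝ) ρ,
        hermDet (fun i => a i x + hess (partial₂ ψ x) i) = F x := by
  choose ρ hρ c hc hac using fun i => exists_evalSeries_of_analyticAt (ha i)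
  obtain ⟨ρF, hρF, cF, hcF, hacF⟩ := exists_evalSeries_of_analyticAt hF
  simp only [zero_add] at hac hacF
  choose s hs hs' using fun i => exists_dilated (5 : Fin 6) (hρ i) (hc i)
  obtain ⟨sF, hsF, hsF'⟩ := exists_dilated (5 : Fin 6) hρF hcF
  have ha0 : ∀ i, evalSeries (c i) 0 = a i 0 := fun i => (hac i 0 (by simpa using hρ i)).symm
  have hF0 : evalSeries cF 0 = hermDet fun i => a i 0 := by
    rw [h0]; exact (hacF 0 (by simpa using hρF)).symm
  simp only [ha0] at hs
  rw [hF0] at hsF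
  have hr0 : ∀ᶠ r in 𝓝[>] (0 : ℝ), 0 < r := self_mem_nhdsWithin
  obtain ⟨r, ⟨⟨⟨u, hu⟩, hsr⟩, hsFr⟩, hr⟩ :=
    ((((exists_formal_solution _ hm s sF hs hsF).and (Filter.eventually_all.2 hs')).and
      hsF').and hr0).exists
  set μ : Fin 6 → ℝ := fun j => if j = 5 then (r ^ 2)⁻¹ else r⁻¹ with hμ
  have hdil : ∀ x, dilate 5 r (rescaleCLM μ x) = x := by
    intro x
    funext j
    simp only [dilate, rescaleCLM_apply, hμ]
    split_ifs <;> field_simp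
  have hev : ∀ᶠ x in 𝓝 (0 : Fin 6 → ℝ), ‖rescaleCLM μ x‖ < 1 / 2 ∧ ‖x‖ < ρF ∧ ∀ i, ‖x‖ < ρ i := by
    refine Filter.Eventually.and ?_ (Filter.Eventually.and ?_ (Filter.eventually_all.2 fun i => ?_))
    · have h4 : ContinuousAt (fun y => ‖rescaleCLM μ y‖) 0 := by fun_prop
      exact h4.eventually_lt_const (by simp)
    · exact (continuous_norm.continuousAt (x := (0 : Fin 6 → ℝ))).eventually_lt_const
        (by simpa using hρF)
    · exact (continuous_norm.continuousAt (x := (0 : Fin 6 → ℝ))).eventually_lt_const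
        (by simpa using hρ i)
  obtain ⟨δ, hδ, hball⟩ := Metric.eventually_nhds_iff_ball.1 hev
  -- Integrating twice from y₃ = 0 builds in the zero Cauchy data.
  set d := integral 5 (integral 5 (u : MvPowerSeries (Fin 6) ℝ)) with hd
  have hd2 : AbsConv (1 / 2) d := by
    have h := weightedAlgebra.absConv u
    exact (h.integral (by norm_num) 5).integral (by norm_num) 5
  refine ⟨δ, hδ, fun x => r ^ 4 * evalSeries d (rescaleCLM μ x), ?_, ?_, ?_⟩
  · intro x hx
    have h1 : AnalyticAt ℝ (evalSeries d) (rescaleCLM μ x) :=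
      analyticOnNhd_evalSeries hd2 _ (by simpa using (hball x hx).1)
    exact analyticAt_const.mul (h1.comp ((rescaleCLM μ).analyticAt x))
  · intro x hx hx5
    have h5 : rescaleCLM μ x 5 = 0 := by rw [rescaleCLM_apply, hx5, mul_zero]
    refine ⟨by simp only [hd, evalSeries_integral_eq_zero 5 _ h5, mul_zero], ?_⟩
    rw [fderiv_evalSeries_rescale hd2 _ μ (hball x hx).1, hd, pderiv_integral_self,
      evalSeries_integral_eq_zero 5 _ h5, mul_zero]
  · intro x hx
    obtain ⟨h1, h2, h3⟩ := hball x hx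
    -- Evaluation at the rescaled point is a ring homomorphism, so it turns the identity in the
    -- algebra into the pointwise equation; rescaling undoes the dilation of the data.
    have h4 := congrArg (evalHom 5 (rescaleCLM μ x) h1.le) hu
    rw [evalHom_apply _ _ _ (sF r), hsFr, evalSeries_dilateSeries, hdil, ← hacF x h2] at h4
    rw [← h4]
    refine Eq.trans ?_ (map_hermDet (evalHom 5 (rescaleCLM μ x) h1.le : HessAlg →+* ℝ) _).symm
    congr 1
    funext i
    simp only [RingHom.coe_coe, map_add]
    rw [evalHom_apply, hsr i, evalSeries_dilateSeries, hdil, ← hac i x (h3 i)]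
    congr 1
    have h5 := map_hess (evalHom 5 (rescaleCLM μ x) h1.le).toLinearMap (scaledHessian r u) i
    refine Eq.trans ?_ h5.symm
    congr 1
    funext j k
    rw [partial₂_evalSeries_rescale hd2 _ μ h1]
    change _ = evalSeries ((scaledHessian r u j k : HessAlg) : MvPowerSeries (Fin 6) ℝ) _
    rw [pderiv_pderiv_integral_integral u r hr.ne', evalSeries_smul]

end MongeAmpereFunctions

end SLag

/-! ### Orders of vanishing along a hyperplane and uniqueness for evolution equations. -/

namespace SLag

section Vanishing

open Topology

variable {E : Type*} [NormedAddCommGroup E] [NormedSpace ℝ E]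

/-- Analytic functions on `W` vanishing to order `k` along `S` in the direction `e`. -/
def Vanishing (W S : Set E) (e : E) : ℕ → (E → ℝ) → Prop
  | 0, w => AnalyticOnNhd ℝ w W
  | k + 1, w => AnalyticOnNhd ℝ w W ∧ (∀ z ∈ W, z ∈ S → w z = 0) ∧
      Vanishing W S e k (fun z => fderiv ℝ w z e)

variable {W S : Set E} {e : E}

theorem AnalyticOnNhd.fderiv_apply_const {w : E → ℝ} (h : AnalyticOnNhd ℝ w W) (m : E) :
    AnalyticOnNhd ℝ (fun z => fderiv ℝ w z m) W :=
  (ContinuousLinearMap.apply ℝ ℝ m).comp_analyticOnNhd h.fderiv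

theorem Vanishing.of_succ {k : ℕ} {w : E → ℝ} (h : Vanishing W S e (k + 1) w) :
    Vanishing W S e k w := by
  induction k generalizing w with
  | zero => exact h.1
  | succ k ih => exact ⟨h.1, h.2.1, ih h.2.2⟩

theorem Vanishing.congr (hW : IsOpen W) {k : ℕ} {w w' : E → ℝ} (h : Vanishing W S e k w)
    (hw : Set.EqOn w w' W) : Vanishing W S e k w' := by
  induction k generalizing w w' with
  | zero => exact AnalyticOnNhd.congr hW h hw
  | succ k ih =>
    refine ⟨AnalyticOnNhd.congr hW h.1 hw, fun z hz hS => (hw hz) ▸ h.2.1 z hz hS,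
      ih h.2.2 fun z hz => ?_⟩
    rw [(hw.eventuallyEq_of_mem (hW.mem_nhds hz)).fderiv_eq]

theorem Vanishing.add (hW : IsOpen W) {k : ℕ} {w w' : E → ℝ} (h : Vanishing W S e k w)
    (h' : Vanishing W S e k w') : Vanishing W S e k (fun z => w z + w' z) := by
  induction k generalizing w w' with
  | zero => exact AnalyticOnNhd.add h h'
  | succ k ih =>
    refine ⟨AnalyticOnNhd.add h.1 h'.1, fun z hz hS => by simp [h.2.1 z hz hS, h'.2.1 z hz hS],
      (ih h.2.2 h'.2.2).congr hW fun z hz => ?_⟩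
    rw [fderiv_fun_add (h.1 z hz).differentiableAt (h'.1 z hz).differentiableAt]
    rfl

theorem Vanishing.mul (hW : IsOpen W) {k : ℕ} {a w : E → ℝ} (ha : AnalyticOnNhd ℝ a W)
    (h : Vanishing W S e k w) : Vanishing W S e k (fun z => a z * w z) := by
  induction k generalizing a w with
  | zero => exact AnalyticOnNhd.mul ha h
  | succ k ih =>
    refine ⟨AnalyticOnNhd.mul ha h.1, fun z hz hS => by simp [h.2.1 z hz hS],
      ((ih ha h.2.2).add hW (ih (AnalyticOnNhd.fderiv_apply_const ha e) h.of_succ)).congr hW fun z hz => ?_⟩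
    rw [fderiv_fun_mul (ha z hz).differentiableAt (h.1 z hz).differentiableAt]
    simp [mul_comm]

theorem Vanishing.neg (hW : IsOpen W) {k : ℕ} {w : E → ℝ} (h : Vanishing W S e k w) :
    Vanishing W S e k (fun z => -w z) :=
  (Vanishing.mul hW (analyticOnNhd_const (v := (-1 : ℝ))) h).congr hW fun z _ => by simp

theorem Vanishing.sub (hW : IsOpen W) {k : ℕ} {w w' : E → ℝ} (h : Vanishing W S e k w)
    (h' : Vanishing W S e k w') : Vanishing W S e k (fun z => w z - w' z) :=
  (h.add hW (h'.neg hW)).congr hW fun z _ => by simp [sub_eq_add_neg]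

/-- Along `S` a function that vanishes there has zero tangential derivative; the normal derivatives
follow by induction, since second derivatives commute. -/
theorem Vanishing.fderiv_tangent (hW : IsOpen W) {m : E}
    (hm : ∀ z ∈ S, ∀ s : ℝ, z + s • m ∈ S) {k : ℕ} {w : E → ℝ} (h : Vanishing W S e k w) :
    Vanishing W S e k (fun z => fderiv ℝ w z m) := by
  induction k generalizing w with
  | zero => exact AnalyticOnNhd.fderiv_apply_const h m
  | succ k ih =>
    refine ⟨AnalyticOnNhd.fderiv_apply_const h.1 m, fun z hz hS => ?_,
      (ih h.2.2).congr hW fun z hz => ?_⟩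
    · have h1 : HasDerivAt (fun s : ℝ => z + s • m) m 0 := by
        have h1' := (hasDerivAt_id (0 : ℝ)).smul_const m
        rw [one_smul] at h1'
        exact h1'.const_add z
      have h2 : HasDerivAt (fun s : ℝ => w (z + s • m)) (fderiv ℝ w z m) 0 :=
        HasFDerivAt.comp_hasDerivAt_of_eq (0 : ℝ) (h.1 z hz).differentiableAt.hasFDerivAt h1
          (by simp)
      refine h2.unique ((hasDerivAt_const (0 : ℝ) (0 : ℝ)).congr_of_eventuallyEq ?_)
      have h3 : ContinuousAt (fun s : ℝ => z + s • m) 0 := by fun_prop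
      have h4 : ∀ᶠ s in 𝓝 (0 : ℝ), z + s • m ∈ W :=
        h3.preimage_mem_nhds (by simpa using hW.mem_nhds hz)
      filter_upwards [h4] with s hs using h.2.1 _ hs (hm z hS s)
    · have h1 := (h.1 z hz).fderiv.differentiableAt
      have h2 : ∀ a b : E, fderiv ℝ (fun y => fderiv ℝ w y a) z b
          = fderiv ℝ (fderiv ℝ w) z b a := by
        intro a b
        have h3 : HasFDerivAt (fun y => fderiv ℝ w y a)
            ((ContinuousLinearMap.apply ℝ ℝ a).comp (fderiv ℝ (fderiv ℝ w) z)) z :=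
          (ContinuousLinearMap.apply ℝ ℝ a).hasFDerivAt.comp z h1.hasFDerivAt
        rw [h3.fderiv]
        rfl
      simp only [h2]
      exact ((h.1 z hz).contDiffAt (n := 2)).isSymmSndFDerivAt (by simp) m e

/-- Uses f'g' - fg = f'(g' - g) + g(f' - f); it makes congruence modulo functions vanishing to order
k compatible with products. -/
theorem Vanishing.mul_sub_mul (hW : IsOpen W) {k : ℕ} {f f' g g' : E → ℝ}
    (hf' : AnalyticOnNhd ℝ f' W) (hg : AnalyticOnNhd ℝ g W)
    (h1 : Vanishing W S e k (fun z => f' z - f z))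
    (h2 : Vanishing W S e k (fun z => g' z - g z)) :
    Vanishing W S e k (fun z => f' z * g' z - f z * g z) :=
  ((Vanishing.mul hW hf' h2).add hW (Vanishing.mul hW hg h1)).congr hW fun z _ => by
    simp only; ring

theorem iteratedDeriv_line_eq_zero (hW : IsOpen W) {b : E} (hb : b ∈ W) (hbS : b ∈ S) (k : ℕ)
    {w : E → ℝ} (h : Vanishing W S e (k + 1) w) :
    iteratedDeriv k (fun s : ℝ => w (b + s • e)) 0 = 0 := by
  induction k generalizing w with
  | zero =>
    have := h.2.1 b hb hbS
    simpa using this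
  | succ k ih =>
    rw [iteratedDeriv_succ']
    refine Eq.trans ?_ (ih h.2.2)
    suffices key : deriv (fun s : ℝ => w (b + s • e)) =ᶠ[𝓝 0] fun s => fderiv ℝ w (b + s • e) e from
      key.iteratedDeriv_eq k
    have h3 : ContinuousAt (fun s : ℝ => b + s • e) 0 := by fun_prop
    have h4 : ∀ᶠ s in 𝓝 (0 : ℝ), b + s • e ∈ W :=
      h3.preimage_mem_nhds (by simpa using hW.mem_nhds hb)
    filter_upwards [h4] with s hs
    have h1 : HasDerivAt (fun s : ℝ => b + s • e) e s := by
      have h1' := (hasDerivAt_id s).smul_const e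
      rw [one_smul] at h1'
      exact h1'.const_add b
    exact (HasFDerivAt.comp_hasDerivAt s (h.1 _ hs).differentiableAt.hasFDerivAt h1).deriv

/-- Here `l z` is the height of z above `S` in the direction `e`. Convexity makes the line through z
and its foot meet `W` in an interval, on which the restricted function is analytic with zero Taylor
series at the foot. -/
theorem eqOn_zero_of_vanishing (hW : IsOpen W) (hWc : Convex ℝ W) {w : E → ℝ}
    (h : ∀ k, Vanishing W S e k w) (l : E → ℝ) (hl : ∀ z ∈ W, z - l z • e ∈ W)
    (hlS : ∀ z ∈ W, z - l z • e ∈ S) : ∀ z ∈ W, w z = 0 := by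
  intro z hz
  set b := z - l z • e with hb
  set g : ℝ → ℝ := fun s => w (b + s • e) with hg
  set I : Set ℝ := {s | b + s • e ∈ W} with hI
  have hbW : b ∈ W := hl z hz
  have hgI : AnalyticOnNhd ℝ g I := by
    intro s hs
    refine AnalyticAt.comp (g := w) (f := fun s : ℝ => b + s • e) (h 0 _ hs) ?_
    fun_prop
  have hIc : Convex ℝ I := by
    intro s hs t ht a c ha hc hac
    change b + (a • s + c • t) • e ∈ W
    have : b + (a • s + c • t) • e = a • (b + s • e) + c • (b + t • e) := by
      have : b = (a + c) • b := by rw [hac, one_smul]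
      conv_lhs => rw [this]
      simp only [smul_add, add_smul, smul_eq_mul, mul_smul]
      abel
    rw [this]
    exact hWc hs ht ha hc hac
  have h0 : (0 : ℝ) ∈ I := by simpa [hI] using hbW
  have hg0 : g =ᶠ[𝓝 0] 0 := by
    have h1 := (hgI 0 h0).hasFPowerSeriesAt
    have h2 : ∀ n, iteratedDeriv n g 0 = 0 := fun n =>
      iteratedDeriv_line_eq_zero hW hbW (hlS z hz) n (h (n + 1))
    have h6 : (FormalMultilinearSeries.ofScalars ℝ fun n => iteratedDeriv n g 0 / n.factorial)
        = 0 := by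
      ext n
      simp [FormalMultilinearSeries.ofScalars, h2]
    rw [h6] at h1
    exact h1.eventually_eq_zero
  have h3 := hgI.eqOn_zero_of_preconnected_of_eventuallyEq_zero hIc.isPreconnected h0 hg0
  have h4 : l z ∈ I := by simpa [hI, hb] using hz
  have h5 := h3 h4
  simpa [hg, hb] using h5

/-- Uniqueness for evolution equations in the direction `e` with analytic coefficients. -/
theorem eqOn_zero_of_evolution (hW : IsOpen W) (hWc : Convex ℝ W) {ι : Type*} {w : ι → E → ℝ}
    (ha : ∀ i, AnalyticOnNhd ℝ (w i) W) (h0 : ∀ i, ∀ z ∈ W, z ∈ S → w i z = 0)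
    (hev : ∀ k, (∀ i, Vanishing W S e k (w i)) →
      ∀ i, Vanishing W S e k (fun z => fderiv ℝ (w i) z e))
    (l : E → ℝ) (hl : ∀ z ∈ W, z - l z • e ∈ W)
    (hlS : ∀ z ∈ W, z - l z • e ∈ S) : ∀ i, ∀ z ∈ W, w i z = 0 := by
  have h : ∀ k, ∀ i, Vanishing W S e k (w i) := by
    intro k
    induction k with
    | zero => exact ha
    | succ k ih => exact fun i => ⟨ha i, h0 i, hev k ih i⟩
  exact fun i => eqOn_zero_of_vanishing hW hWc (fun k => h k i) l hl hlS

end Vanishing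

end SLag

/-! ### Real two-forms of type (1,1) on complex three-space. -/

namespace SLag

section TwoForms

open Topology

/-- The real coordinate directions `∂/∂xⱼ`. -/
def eR (j : Fin 3) : C3 := Pi.single j 1

/-- The imaginary coordinate directions `∂/∂yⱼ`. -/
noncomputable def eI (j : Fin 3) : C3 := Pi.single j Complex.I

theorem I_smul_eR (j : Fin 3) : Complex.I • eR j = eI j := by
  unfold eR eI
  rw [← Pi.single_smul, smul_eq_mul, mul_one]

theorem I_smul_eI (j : Fin 3) : Complex.I • eI j = -eR j := by
  rw [← I_smul_eR, smul_smul, Complex.I_mul_I, neg_one_smul]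

/-- Forms of type `(1, 1)`. -/
def IsType11 (η : C3 [⋀^Fin 2]→L[ℝ] ℝ) : Prop :=
  ∀ u v : C3, η ![Complex.I • u, Complex.I • v] = η ![u, v]

/-- The components `a₁₁, a₁₂, a₁₃, a₂₂, a₂₃, a₃₃, b₁₂, b₁₃, b₂₃` of a two-form, where
`aⱼₖ = η(∂/∂xⱼ, ∂/∂yₖ)` and `bⱼₖ = η(∂/∂xⱼ, ∂/∂xₖ)`. -/
noncomputable def comp (η : C3 [⋀^Fin 2]→L[ℝ] ℝ) : Fin 9 → ℝ :=
  ![η ![eR 0, eI 0], η ![eR 0, eI 1], η ![eR 0, eI 2], η ![eR 1, eI 1], η ![eR 1, eI 2],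
    η ![eR 2, eI 2], η ![eR 0, eR 1], η ![eR 0, eR 2], η ![eR 1, eR 2]]

theorem twoForm_swap (η : C3 [⋀^Fin 2]→L[ℝ] ℝ) (u v : C3) : η ![u, v] = -η ![v, u] := by
  have h := η.map_swap ![v, u] (i := 0) (j := 1) (by simp)
  have h2 : (![v, u] ∘ Equiv.swap 0 1 : Fin 2 → C3) = ![u, v] := by
    ext i : 1
    fin_cases i <;> simp
  rw [h2] at h
  exact h

theorem update_pair_zero (u v w : C3) : Function.update ![u, v] 0 w = ![w, v] := by
  ext i : 1
  fin_cases i <;> simp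

theorem twoForm_self (η : C3 [⋀^Fin 2]→L[ℝ] ℝ) (u : C3) : η ![u, u] = 0 := by
  have := twoForm_swap η u u
  linarith

theorem twoForm_neg_left (η : C3 [⋀^Fin 2]→L[ℝ] ℝ) (u v : C3) : η ![-u, v] = -η ![u, v] := by
  have h := η.map_update_smul ![u, v] 0 (-1) u
  simp only [update_pair_zero, neg_one_smul] at h
  exact h

theorem twoForm_neg_right (η : C3 [⋀^Fin 2]→L[ℝ] ℝ) (u v : C3) : η ![u, -v] = -η ![u, v] := by
  rw [twoForm_swap, twoForm_neg_left, twoForm_swap η u v]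

namespace IsType11

variable {η : C3 [⋀^Fin 2]→L[ℝ] ℝ}

theorem eI_eI (h : IsType11 η) (j k : Fin 3) : η ![eI j, eI k] = η ![eR j, eR k] := by
  rw [← I_smul_eR, ← I_smul_eR, h]

theorem eI_eR (h : IsType11 η) (j k : Fin 3) : η ![eI j, eR k] = -η ![eR j, eI k] := by
  rw [← h (eI j) (eR k), I_smul_eI, I_smul_eR, twoForm_neg_left]

theorem symm (h : IsType11 η) (j k : Fin 3) : η ![eR j, eI k] = η ![eR k, eI j] := by
  have h1 := h.eI_eR k j
  rw [twoForm_swap] at h1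
  linarith

end IsType11

theorem eq_sum_eR_eI (u : C3) :
    u = ∑ j, ((u j).re • eR j + (u j).im • eI j) := by
  ext k
  simp only [eR, eI, Finset.sum_apply, Pi.add_apply, Pi.smul_apply, Pi.single_apply]
  rw [Finset.sum_eq_single k (by intro b _ hb; simp [hb.symm]) (by simp)]
  simp

theorem twoForm_add_left (η : C3 [⋀^Fin 2]→L[ℝ] ℝ) (u u' v : C3) :
    η ![u + u', v] = η ![u, v] + η ![u', v] := by
  have h := η.map_update_add ![u, v] 0 u u'
  simp only [update_pair_zero] at h
  exact h

theorem twoForm_smul_left (η : C3 [⋀^Fin 2]→L[ℝ] ℝ) (c : ℝ) (u v : C3) :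
    η ![c • u, v] = c * η ![u, v] := by
  have h := η.map_update_smul ![u, v] 0 c u
  simp only [update_pair_zero] at h
  exact h

theorem twoForm_add_right (η : C3 [⋀^Fin 2]→L[ℝ] ℝ) (u v v' : C3) :
    η ![u, v + v'] = η ![u, v] + η ![u, v'] := by
  rw [twoForm_swap, twoForm_add_left, twoForm_swap η u v, twoForm_swap η u v']
  ring

theorem twoForm_smul_right (η : C3 [⋀^Fin 2]→L[ℝ] ℝ) (c : ℝ) (u v : C3) :
    η ![u, c • v] = c * η ![u, v] := by
  rw [twoForm_swap, twoForm_smul_left, twoForm_swap η u v]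
  ring

/-- A form of type `(1, 1)` is determined by its components. -/
theorem IsType11.ext {η η' : C3 [⋀^Fin 2]→L[ℝ] ℝ} (h : IsType11 η) (h' : IsType11 η')
    (hc : comp η = comp η') : η = η' := by
  have hc' : ∀ i, comp η i = comp η' i := fun i => by rw [hc]
  have h0 := hc' 0; have h1 := hc' 1; have h2 := hc' 2; have h3 := hc' 3; have h4 := hc' 4
  have h5 := hc' 5; have h6 := hc' 6; have h7 := hc' 7; have h8 := hc' 8
  simp only [comp, Fin.isValue, Matrix.cons_val] at h0 h1 h2 h3 h4 h5 h6 h7 h8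
  have hRI : ∀ j k, η ![eR j, eI k] = η' ![eR j, eI k] := by
    intro j k
    fin_cases j <;> fin_cases k <;> simp only [Fin.zero_eta, Fin.mk_one, Fin.reduceFinMk] <;>
      first
      | assumption
      | (rw [h.symm, h'.symm]; assumption)
  have hRR : ∀ j k, η ![eR j, eR k] = η' ![eR j, eR k] := by
    intro j k
    fin_cases j <;> fin_cases k <;> simp only [Fin.zero_eta, Fin.mk_one, Fin.reduceFinMk] <;>
      first
      | assumption
      | (rw [twoForm_self, twoForm_self])
      | (rw [twoForm_swap, twoForm_swap η']; congr 1)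
  have hall : ∀ u v, η ![u, v] = η' ![u, v] := by
    have hl : ∀ (θ : C3 [⋀^Fin 2]→L[ℝ] ℝ) (u v : C3), θ ![u, v]
        = ∑ j, ((u j).re * θ ![eR j, v] + (u j).im * θ ![eI j, v]) := by
      intro θ u v
      conv_lhs => rw [eq_sum_eR_eI u]
      simp only [Fin.sum_univ_three, twoForm_add_left, twoForm_smul_left]
    have hr : ∀ (θ : C3 [⋀^Fin 2]→L[ℝ] ℝ) (u v : C3), θ ![u, v]
        = ∑ j, ((v j).re * θ ![u, eR j] + (v j).im * θ ![u, eI j]) := by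
      intro θ u v
      conv_lhs => rw [eq_sum_eR_eI v]
      simp only [Fin.sum_univ_three, twoForm_add_right, twoForm_smul_right]
    intro u v
    rw [hl η, hl η']
    refine Finset.sum_congr rfl fun j _ => ?_
    rw [hr η (eR j), hr η' (eR j), hr η (eI j), hr η' (eI j)]
    simp only [h.eI_eI, h'.eI_eI, h.eI_eR, h'.eI_eR, hRI, hRR]
  ext v
  have hv : v = ![v 0, v 1] := by
    ext i : 1
    fin_cases i <;> rfl
  rw [hv]
  exact hall _ _

theorem extDeriv_two_apply {D : C3 → C3 [⋀^Fin 2]→L[ℝ] ℝ} {z : C3} (hD : DifferentiableAt ℝ D z)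
    (m u v : C3) : extDeriv D z ![m, u, v]
      = fderiv ℝ D z m ![u, v] - fderiv ℝ D z u ![m, v] + fderiv ℝ D z v ![m, u] := by
  rw [extDeriv_apply hD, Fin.sum_univ_three]
  have h0 : (0 : Fin 3).removeNth ![m, u, v] = ![u, v] := by
    ext i : 1; fin_cases i <;> rfl
  have h1 : (1 : Fin 3).removeNth ![m, u, v] = ![m, v] := by
    ext i : 1; fin_cases i <;> rfl
  have h2 : (2 : Fin 3).removeNth ![m, u, v] = ![m, u] := by
    ext i : 1; fin_cases i <;> rfl
  have h3 : ∀ (a : Fin 2 → C3) (b : C3), fderiv ℝ (fun x => D x a) z b = fderiv ℝ D z b a := by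
    intro a b
    have h4 : HasFDerivAt (fun z => D z a)
        ((ContinuousAlternatingMap.apply ℝ C3 ℝ a).comp (fderiv ℝ D z)) z :=
      (ContinuousAlternatingMap.apply ℝ C3 ℝ a).hasFDerivAt.comp z hD.hasFDerivAt
    rw [h4.fderiv]
    rfl
  simp only [h0, h1, h2, h3]
  simp
  ring

/-- Being of type (1,1) is a linear condition with constant coefficients, hence is inherited by
directional derivatives. -/
theorem fderiv_isType11 {D : C3 → C3 [⋀^Fin 2]→L[ℝ] ℝ} {W : Set C3} (hW : IsOpen W)
    (hD : DifferentiableOn ℝ D W) (h : ∀ z ∈ W, IsType11 (D z)) {z : C3} (hz : z ∈ W) (m : C3) :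
    IsType11 (fderiv ℝ D z m) := by
  intro u v
  have hd := (hD.differentiableAt (hW.mem_nhds hz)).hasFDerivAt
  have h1 : ∀ a b : C3, HasFDerivAt (fun z => D z ![a, b])
      ((ContinuousAlternatingMap.apply ℝ C3 ℝ ![a, b]).comp (fderiv ℝ D z)) z := fun a b =>
    (ContinuousAlternatingMap.apply ℝ C3 ℝ ![a, b]).hasFDerivAt.comp z hd
  have h2 := (h1 (Complex.I • u) (Complex.I • v)).congr_of_eventuallyEq
    (f₁ := fun z => D z ![u, v]) (by
      filter_upwards [hW.mem_nhds hz] with y hy using (h y hy u v).symm)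
  exact congrArg (fun L => L m) (h2.unique (h1 u v))

end TwoForms

end SLag

/-! ### Closed (1,1)-forms as solutions of evolution equations. -/

namespace SLag

section ClosedForms

open Topology

/-- The equations `dη = 0` for `(1, 1)`-forms, solved for the derivatives along `∂/∂y₂` (for five
components) and along `∂/∂y₃`; here `η m` stands for the derivative in the direction `m`. -/
theorem comp_evolution {η : C3 → C3 [⋀^Fin 2]→L[ℝ] ℝ} (h : ∀ m, IsType11 (η m))
    (hc : ∀ m u v, η m ![u, v] = η u ![m, v] - η v ![m, u]) :
    (comp (η (eI 1)) 0 = -comp (η (eR 0)) 6 + comp (η (eI 0)) 1 ∧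
      comp (η (eI 1)) 1 = -comp (η (eR 1)) 6 + comp (η (eI 0)) 3 ∧
      comp (η (eI 1)) 2 = -comp (η (eR 2)) 6 + comp (η (eI 0)) 4 ∧
      comp (η (eI 1)) 6 = -comp (η (eR 0)) 3 + comp (η (eR 1)) 1 ∧
      comp (η (eI 1)) 7 = -comp (η (eR 0)) 4 + comp (η (eR 2)) 1) ∧
    comp (η (eI 2)) 0 = -comp (η (eR 0)) 7 + comp (η (eI 0)) 2 ∧
      comp (η (eI 2)) 1 = -comp (η (eR 0)) 8 + comp (η (eI 1)) 2 ∧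
      comp (η (eI 2)) 2 = -comp (η (eR 2)) 7 + comp (η (eI 0)) 5 ∧
      comp (η (eI 2)) 3 = -comp (η (eR 1)) 8 + comp (η (eI 1)) 4 ∧
      comp (η (eI 2)) 4 = -comp (η (eR 2)) 8 + comp (η (eI 1)) 5 ∧
      comp (η (eI 2)) 6 = -comp (η (eR 0)) 4 + comp (η (eR 1)) 2 ∧
      comp (η (eI 2)) 7 = -comp (η (eR 0)) 5 + comp (η (eR 2)) 2 ∧
      comp (η (eI 2)) 8 = -comp (η (eR 1)) 5 + comp (η (eR 2)) 4 := by
  have h1 : ∀ m, η m ![eR 1, eR 0] = -η m ![eR 0, eR 1] := fun m => twoForm_swap _ _ _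
  have h2 : ∀ m, η m ![eR 2, eR 0] = -η m ![eR 0, eR 2] := fun m => twoForm_swap _ _ _
  have h3 : ∀ m, η m ![eR 2, eR 1] = -η m ![eR 1, eR 2] := fun m => twoForm_swap _ _ _
  have h4 : ∀ m, η m ![eR 1, eI 0] = η m ![eR 0, eI 1] := fun m => (h m).symm _ _
  have h5 : ∀ m, η m ![eR 2, eI 0] = η m ![eR 0, eI 2] := fun m => (h m).symm _ _
  have h6 : ∀ m, η m ![eR 2, eI 1] = η m ![eR 1, eI 2] := fun m => (h m).symm _ _
  have h7 : ∀ m j k, η m ![eI j, eR k] = -η m ![eR j, eI k] := fun m j k => (h m).eI_eR j k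
  have h8 : ∀ m j k, η m ![eI j, eI k] = η m ![eR j, eR k] := fun m j k => (h m).eI_eI j k
  have k1 := hc (eI 1) (eR 0) (eI 0)
  have k2 := hc (eI 1) (eR 1) (eI 0)
  have k3 := hc (eI 1) (eR 2) (eI 0)
  have k4 := hc (eI 1) (eR 0) (eR 1)
  have k5 := hc (eI 1) (eR 0) (eR 2)
  have l1 := hc (eI 2) (eR 0) (eI 0)
  have l2 := hc (eI 2) (eR 0) (eI 1)
  have l3 := hc (eI 2) (eR 2) (eI 0)
  have l4 := hc (eI 2) (eR 1) (eI 1)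
  have l5 := hc (eI 2) (eR 2) (eI 1)
  have l6 := hc (eI 2) (eR 0) (eR 1)
  have l7 := hc (eI 2) (eR 0) (eR 2)
  have l8 := hc (eI 2) (eR 1) (eR 2)
  simp only [h8, h7] at k1 k2 k3 k4 k5 l1 l2 l3 l4 l5 l6 l7 l8
  simp only [h1, h2, h3, h4, h5, h6] at k1 k2 k3 k4 k5 l1 l2 l3 l4 l5 l6 l7 l8
  simp only [comp, Fin.isValue, Matrix.cons_val]
  refine ⟨⟨?_, ?_, ?_, ?_, ?_⟩, ?_, ?_, ?_, ?_, ?_, ?_, ?_, ?_⟩ <;> linarith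

theorem comp_eq_pair (i : Fin 9) : ∃ v : Fin 2 → C3, ∀ η : C3 [⋀^Fin 2]→L[ℝ] ℝ, comp η i = η v := by
  fin_cases i
  exacts [⟨_, fun _ => rfl⟩, ⟨_, fun _ => rfl⟩, ⟨_, fun _ => rfl⟩, ⟨_, fun _ => rfl⟩,
    ⟨_, fun _ => rfl⟩, ⟨_, fun _ => rfl⟩, ⟨_, fun _ => rfl⟩, ⟨_, fun _ => rfl⟩, ⟨_, fun _ => rfl⟩]

/-- A component as a continuous linear functional. -/
theorem exists_comp_clm (i : Fin 9) : ∃ L : (C3 [⋀^Fin 2]→L[ℝ] ℝ) →L[ℝ] ℝ, ∀ η, L η = comp η i := by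
  obtain ⟨v, hv⟩ := comp_eq_pair i
  exact ⟨ContinuousAlternatingMap.apply ℝ C3 ℝ v, fun η => (hv η).symm⟩

theorem comp_zero (i : Fin 9) : comp 0 i = 0 := by
  obtain ⟨L, hL⟩ := exists_comp_clm i
  rw [← hL, map_zero]

theorem comp_sub (η η' : C3 [⋀^Fin 2]→L[ℝ] ℝ) (i : Fin 9) :
    comp (η - η') i = comp η i - comp η' i := by
  obtain ⟨L, hL⟩ := exists_comp_clm i
  simp only [← hL, map_sub]

theorem comp_add (η η' : C3 [⋀^Fin 2]→L[ℝ] ℝ) (i : Fin 9) :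
    comp (η + η') i = comp η i + comp η' i := by
  obtain ⟨L, hL⟩ := exists_comp_clm i
  simp only [← hL, map_add]

theorem analyticOnNhd_comp {D : C3 → C3 [⋀^Fin 2]→L[ℝ] ℝ} {W : Set C3} (hD : AnalyticOnNhd ℝ D W)
    (i : Fin 9) : AnalyticOnNhd ℝ (fun z => comp (D z) i) W := by
  obtain ⟨L, hL⟩ := exists_comp_clm i
  simp only [← hL]
  exact L.comp_analyticOnNhd hD

theorem fderiv_comp_comp {D : C3 → C3 [⋀^Fin 2]→L[ℝ] ℝ} (π : C3 →L[ℝ] C3) {z : C3}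
    (hD : DifferentiableAt ℝ D (π z)) (i : Fin 9) (m : C3) :
    fderiv ℝ (fun z => comp (D (π z)) i) z m = comp (fderiv ℝ D (π z) (π m)) i := by
  obtain ⟨L, hL⟩ := exists_comp_clm i
  simp only [← hL]
  have h1 : HasFDerivAt (fun z => L (D (π z))) (L.comp ((fderiv ℝ D (π z)).comp π)) z :=
    L.hasFDerivAt.comp z (hD.hasFDerivAt.comp z π.hasFDerivAt)
  rw [h1.fderiv]
  rfl

/-- The projection killing `yⱼ`. -/
noncomputable def killIm (j : Fin 3) : C3 →L[ℝ] C3 :=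
  ContinuousLinearMap.id ℝ C3
    - (Complex.imCLM.comp (ContinuousLinearMap.proj (R := ℝ) (φ := fun _ : Fin 3 => ℂ) j)).smulRight
      (eI j)

theorem killIm_apply (j : Fin 3) (z : C3) : killIm j z = z - (z j).im • eI j := rfl

theorem killIm_eR (j k : Fin 3) : killIm j (eR k) = eR k := by
  rw [killIm_apply]
  by_cases h : j = k
  · subst h; simp [eR]
  · simp [eR, h]

theorem killIm_eI {j k : Fin 3} (h : j ≠ k) : killIm j (eI k) = eI k := by
  rw [killIm_apply]
  simp [eI, h]

theorem killIm_im_same (j : Fin 3) (z : C3) : (killIm j z j).im = 0 := by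
  rw [killIm_apply]
  simp [eI]

theorem killIm_im_of_ne {j k : Fin 3} (h : k ≠ j) (z : C3) : (killIm j z k) = z k := by
  rw [killIm_apply]
  simp [eI, h]

theorem closed_relation {D : C3 → C3 [⋀^Fin 2]→L[ℝ] ℝ} {z : C3} (hD : DifferentiableAt ℝ D z)
    (h : extDeriv D z = 0) (m u v : C3) :
    fderiv ℝ D z m ![u, v] = fderiv ℝ D z u ![m, v] - fderiv ℝ D z v ![m, u] := by
  have h1 := extDeriv_two_apply hD m u v
  rw [h] at h1
  have h2 : (0 : C3 [⋀^Fin 3]→L[ℝ] ℝ) ![m, u, v] = 0 := rfl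
  rw [h2] at h1
  linarith

/-- The horizontal hyperplane `{yⱼ = 0}`. -/
def imZero (j : Fin 3) : Set C3 := {z | (z j).im = 0}

theorem add_smul_eR_mem_imZero (j k : Fin 3) : ∀ z ∈ imZero j, ∀ s : ℝ, z + s • eR k ∈ imZero j := by
  intro z hz s
  have hz' : (z j).im = 0 := hz
  by_cases h : j = k
  · subst h; simp [imZero, eR, hz']
  · simp [imZero, eR, hz', h]

theorem add_smul_eI_mem_imZero {j k : Fin 3} (h : j ≠ k) :
    ∀ z ∈ imZero j, ∀ s : ℝ, z + s • eI k ∈ imZero j := by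
  intro z hz s
  have hz' : (z j).im = 0 := hz
  simp [imZero, eI, hz', h]

/-- Uniqueness for closed analytic `(1, 1)`-forms: the form vanishes if it does so along
`{y₂ = y₃ = 0}`, three of its components vanish on `{y₃ = 0}`, and the component `a₃₃` is controlled
by the others. -/
theorem eq_zero_of_closed_type11 {W : Set C3} (hW : IsOpen W) (hWc : Convex ℝ W)
    (hW2 : ∀ z ∈ W, killIm 2 z ∈ W) (hW1 : ∀ z ∈ W, killIm 1 z ∈ W)
    {D : C3 → C3 [⋀^Fin 2]→L[ℝ] ℝ} (hD : AnalyticOnNhd ℝ D W)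
    (hcl : ∀ z ∈ W, extDeriv D z = 0) (h11 : ∀ z ∈ W, IsType11 (D z))
    (h0 : ∀ z ∈ W, z ∈ imZero 1 → z ∈ imZero 2 → D z = 0)
    (hN : ∀ z ∈ W, z ∈ imZero 2 → comp (D z) 3 = 0 ∧ comp (D z) 4 = 0 ∧ comp (D z) 8 = 0)
    (h5 : ∀ k, (∀ i ≠ 5, Vanishing W (imZero 2) (eI 2) k fun z => comp (D z) i) →
      Vanishing W (imZero 2) (eI 2) k fun z => comp (D z) 5) :
    ∀ z ∈ W, D z = 0 := by
  have hDd : ∀ z ∈ W, DifferentiableAt ℝ D z := fun z hz => (hD z hz).differentiableAt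
  have hev := fun z (hz : z ∈ W) => comp_evolution
    (fun m => fderiv_isType11 hW (fun y hy => (hDd y hy).differentiableWithinAt) h11 hz m)
    (closed_relation (hDd z hz) (hcl z hz))
  -- the hyperplane `y₃ = 0`
  have stage1 : ∀ i : Fin 9, i ≠ 5 → ∀ z ∈ W, comp (D (killIm 2 z)) i = 0 := by
    set b : Fin 9 → C3 → ℝ := fun i z => if i = 5 then 0 else comp (D (killIm 2 z)) i with hb
    have hb5 : ∀ i, i ≠ 5 → b i = fun z => comp (D (killIm 2 z)) i := fun i hi => by
      funext z; simp [hb, hi]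
    have hb3 : ∀ z ∈ W, b 3 z = 0 ∧ b 4 z = 0 ∧ b 8 z = 0 := fun z hz => by
      have := hN _ (hW2 z hz) (killIm_im_same 2 z)
      simpa [hb] using this
    have hban : ∀ i, AnalyticOnNhd ℝ (b i) W := by
      intro i
      by_cases hi : i = 5
      · simp only [hb, hi, if_true]; exact analyticOnNhd_const
      · rw [hb5 i hi]
        exact fun z hz => ((analyticOnNhd_comp hD i) _ (hW2 z hz)).comp ((killIm 2).analyticAt z)
    have hbd : ∀ i, i ≠ 5 → ∀ z ∈ W, ∀ m, fderiv ℝ (b i) z m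
        = comp (fderiv ℝ D (killIm 2 z) (killIm 2 m)) i := fun i hi z hz m => by
      rw [hb5 i hi]
      exact fderiv_comp_comp _ (hDd _ (hW2 z hz)) i m
    have hz0 : ∀ k, Vanishing W (imZero 1) (eI 1) k fun _ => (0 : ℝ) := by
      intro k
      induction k with
      | zero => exact analyticOnNhd_const
      | succ k ih => exact ⟨analyticOnNhd_const, fun _ _ _ => rfl, ih.congr hW fun z _ => by simp⟩
    have hvan : ∀ i, ∀ z ∈ W, b i z = 0 := by
      refine eqOn_zero_of_evolution (S := imZero 1) (e := eI 1) hW hWc hban (fun i z hz hS => ?_)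
        (fun k hk i => ?_) (fun z => (z 1).im) hW1 (fun z _ => killIm_im_same 1 z)
      · by_cases hi : i = 5
        · simp [hb, hi]
        · simp only [hb, if_neg hi]
          rw [h0 _ (hW2 z hz) ?_ (killIm_im_same 2 z), comp_zero]
          change (killIm 2 z 1).im = 0
          rw [killIm_im_of_ne (by decide)]
          exact hS
      · have hR : ∀ i j, Vanishing W (imZero 1) (eI 1) k fun z => fderiv ℝ (b i) z (eR j) :=
          fun i j => (hk i).fderiv_tangent hW (add_smul_eR_mem_imZero 1 j)
        have hI : ∀ i, Vanishing W (imZero 1) (eI 1) k fun z => fderiv ℝ (b i) z (eI 0) :=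
          fun i => (hk i).fderiv_tangent hW (add_smul_eI_mem_imZero (by decide))
        have key : ∀ i, i ≠ 5 → ∀ (j l : Fin 9) (u v : C3), j ≠ 5 → l ≠ 5 →
            killIm 2 u = u → killIm 2 v = v →
            Vanishing W (imZero 1) (eI 1) k (fun z => fderiv ℝ (b j) z u) →
            Vanishing W (imZero 1) (eI 1) k (fun z => fderiv ℝ (b l) z v) →
            (∀ z ∈ W, comp (fderiv ℝ D z (eI 1)) i
              = -comp (fderiv ℝ D z u) j + comp (fderiv ℝ D z v) l) →
            Vanishing W (imZero 1) (eI 1) k fun z => fderiv ℝ (b i) z (eI 1) := by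
          intro i hi j l u v hj hl hu hv h1 h2 h3
          refine ((h1.neg hW).add hW h2).congr hW fun z hz => ?_
          simp only
          rw [hbd i hi z hz, hbd j hj z hz, hbd l hl z hz, killIm_eI (by decide), hu, hv,
            h3 _ (hW2 z hz)]
        have kR := killIm_eR 2
        have kI : killIm 2 (eI 0) = eI 0 := killIm_eI (by decide)
        have hzero : ∀ i : Fin 9, (∀ z ∈ W, b i z = 0) →
            Vanishing W (imZero 1) (eI 1) k fun z => fderiv ℝ (b i) z (eI 1) := by
          intro i hi
          refine (hz0 k).congr hW fun z hz => ?_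
          have : b i =ᶠ[𝓝 z] fun _ => (0 : ℝ) := by
            filter_upwards [hW.mem_nhds hz] with y hy using hi y hy
          rw [this.fderiv_eq]
          simp
        fin_cases i
        · exact key 0 (by decide) 6 1 _ _ (by decide) (by decide) (kR 0) kI (hR 6 0) (hI 1)
            fun z hz => (hev z hz).1.1
        · exact key 1 (by decide) 6 3 _ _ (by decide) (by decide) (kR 1) kI (hR 6 1) (hI 3)
            fun z hz => (hev z hz).1.2.1
        · exact key 2 (by decide) 6 4 _ _ (by decide) (by decide) (kR 2) kI (hR 6 2) (hI 4)
            fun z hz => (hev z hz).1.2.2.1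
        · exact hzero 3 fun z hz => (hb3 z hz).1
        · exact hzero 4 fun z hz => (hb3 z hz).2.1
        · exact hzero 5 fun z _ => by simp [hb]
        · exact key 6 (by decide) 3 1 _ _ (by decide) (by decide) (kR 0) (kR 1) (hR 3 0) (hR 1 1)
            fun z hz => (hev z hz).1.2.2.2.1
        · exact key 7 (by decide) 4 1 _ _ (by decide) (by decide) (kR 0) (kR 2) (hR 4 0) (hR 1 2)
            fun z hz => (hev z hz).1.2.2.2.2
        · exact hzero 8 fun z hz => (hb3 z hz).2.2
    intro i hi z hz
    have := hvan i z hz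
    rwa [hb5 i hi] at this
  -- evolution off the hyperplane
  set a : Fin 9 → C3 → ℝ := fun i z => comp (D z) i with ha
  have haan : ∀ i, AnalyticOnNhd ℝ (a i) W := fun i => analyticOnNhd_comp hD i
  have had : ∀ i, ∀ z ∈ W, ∀ m, fderiv ℝ (a i) z m = comp (fderiv ℝ D z m) i := fun i z hz m =>
    fderiv_comp_comp (ContinuousLinearMap.id ℝ C3) (hDd z hz) i m
  have hl : ∀ z ∈ W, z - (z 2).im • eI 2 ∈ W := hW2
  have hlS : ∀ z ∈ W, z - (z 2).im • eI 2 ∈ imZero 2 := fun z _ => killIm_im_same 2 z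
  -- The orders of vanishing rise together: at order k the other components control a₃₃, and then
  -- all nine feed the y₃-derivatives of the eight, giving order k + 1.
  have hall : ∀ k, ∀ i ≠ 5, Vanishing W (imZero 2) (eI 2) k (a i) := by
    intro k
    induction k with
    | zero => exact fun i _ => haan i
    | succ k hk =>
      have hk' : ∀ i, Vanishing W (imZero 2) (eI 2) k (a i) := by
        intro i
        by_cases hi : i = 5
        · rw [hi]; exact h5 k hk
        · exact hk i hi
      have hR : ∀ i j, Vanishing W (imZero 2) (eI 2) k fun z => fderiv ℝ (a i) z (eR j) :=
        fun i j => (hk' i).fderiv_tangent hW (add_smul_eR_mem_imZero 2 j)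
      have hI : ∀ i j, j ≠ 2 → Vanishing W (imZero 2) (eI 2) k fun z => fderiv ℝ (a i) z (eI j) :=
        fun i j hj => (hk' i).fderiv_tangent hW (add_smul_eI_mem_imZero hj.symm)
      have key : ∀ (i j l : Fin 9) (u v : C3),
          Vanishing W (imZero 2) (eI 2) k (fun z => fderiv ℝ (a j) z u) →
          Vanishing W (imZero 2) (eI 2) k (fun z => fderiv ℝ (a l) z v) →
          (∀ z ∈ W, comp (fderiv ℝ D z (eI 2)) i
            = -comp (fderiv ℝ D z u) j + comp (fderiv ℝ D z v) l) →
          Vanishing W (imZero 2) (eI 2) k fun z => fderiv ℝ (a i) z (eI 2) := by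
        intro i j l u v h1 h2 h3
        refine ((h1.neg hW).add hW h2).congr hW fun z hz => ?_
        simp only
        rw [had i z hz, had j z hz, had l z hz, h3 _ hz]
      intro i hi
      refine ⟨haan i, fun z hz hS => ?_, ?_⟩
      · have h1 := stage1 i hi z hz
        rwa [killIm_apply, show (z 2).im = 0 from hS, zero_smul, sub_zero] at h1
      · have e := fun z hz => (hev z hz).2
        fin_cases i
        · exact key 0 7 2 _ _ (hR 7 0) (hI 2 0 (by decide)) fun z hz => (e z hz).1
        · exact key 1 8 2 _ _ (hR 8 0) (hI 2 1 (by decide)) fun z hz => (e z hz).2.1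
        · exact key 2 7 5 _ _ (hR 7 2) (hI 5 0 (by decide)) fun z hz => (e z hz).2.2.1
        · exact key 3 8 4 _ _ (hR 8 1) (hI 4 1 (by decide)) fun z hz => (e z hz).2.2.2.1
        · exact key 4 8 5 _ _ (hR 8 2) (hI 5 1 (by decide)) fun z hz => (e z hz).2.2.2.2.1
        · exact absurd rfl hi
        · exact key 6 4 2 _ _ (hR 4 0) (hR 2 1) fun z hz => (e z hz).2.2.2.2.2.1
        · exact key 7 5 2 _ _ (hR 5 0) (hR 2 2) fun z hz => (e z hz).2.2.2.2.2.2.1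
        · exact key 8 5 4 _ _ (hR 5 1) (hR 4 2) fun z hz => (e z hz).2.2.2.2.2.2.2
  have hfin : ∀ i, ∀ z ∈ W, a i z = 0 := by
    intro i
    refine eqOn_zero_of_vanishing hW hWc (fun k => ?_) (fun z => (z 2).im) hl hlS
    by_cases hi : i = 5
    · rw [hi]; exact h5 k (hall k)
    · exact hall k i hi
  intro z hz
  refine (h11 z hz).ext (fun u v => rfl) ?_
  funext i
  rw [comp_zero]
  exact hfin i z hz

end ClosedForms

end SLag

/-! ### Uniqueness for the Calabi-Yau equations. -/

open Topology

namespace SLag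

section Uniqueness

variable {W : Set C3}

/-- The Cauchy-Riemann equation in zⱼ is an evolution equation in yⱼ for the pair (Re g, Im g). The
map `π` allows the argument to be run first on the hyperplane {y₃ = 0} and then on the whole domain.
-/
theorem eq_zero_of_holomorphic_step (hW : IsOpen W) (hWc : Convex ℝ W) {g : C3 → ℂ}
    (hg : AnalyticOnNhd ℂ g W) (j : Fin 3) (π : C3 →L[ℝ] C3) (hR : π (eR j) = eR j)
    (hI : π (eI j) = eI j) (hπ : ∀ z ∈ W, π z ∈ W) (hj : ∀ z ∈ W, killIm j z ∈ W)
    (h0 : ∀ z ∈ W, z ∈ imZero j → g (π z) = 0) : ∀ z ∈ W, g (π z) = 0 := by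
  have hgR : AnalyticOnNhd ℝ (fun z => g (π z)) W := fun z hz =>
    ((hg _ (hπ z hz)).restrictScalars (𝕜 := ℝ)).comp (π.analyticAt z)
  have hd : ∀ z ∈ W, ∀ m, fderiv ℝ (fun z => g (π z)) z m = fderiv ℂ g (π z) (π m) := by
    intro z hz m
    have h1 := ((hg _ (hπ z hz)).differentiableAt.hasFDerivAt.restrictScalars ℝ).comp z
      π.hasFDerivAt
    exact congrArg (· m) h1.fderiv
  have hdre : ∀ z ∈ W, ∀ m, fderiv ℝ (fun z => (g (π z)).re) z m
      = (fderiv ℂ g (π z) (π m)).re := by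
    intro z hz m
    have h1 := Complex.reCLM.hasFDerivAt.comp z (hgR z hz).differentiableAt.hasFDerivAt
    rw [← hd z hz]
    exact congrArg (· m) h1.fderiv
  have hdim : ∀ z ∈ W, ∀ m, fderiv ℝ (fun z => (g (π z)).im) z m
      = (fderiv ℂ g (π z) (π m)).im := by
    intro z hz m
    have h1 := Complex.imCLM.hasFDerivAt.comp z (hgR z hz).differentiableAt.hasFDerivAt
    rw [← hd z hz]
    exact congrArg (· m) h1.fderiv
  have hCR : ∀ z, fderiv ℂ g (π z) (π (eI j)) = Complex.I * fderiv ℂ g (π z) (π (eR j)) := by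
    intro z
    rw [hI, hR, ← I_smul_eR, map_smul, smul_eq_mul]
  set w : Fin 2 → C3 → ℝ := ![fun z => (g (π z)).re, fun z => (g (π z)).im] with hw
  have key := eqOn_zero_of_evolution (S := imZero j) (e := eI j) hW hWc (w := w) (fun i => ?_)
    (fun i z hz hS => ?_) (fun k hk i => ?_) (fun z => (z j).im) hj (fun z _ => killIm_im_same j z)
  · intro z hz
    exact Complex.ext (key 0 z hz) (key 1 z hz)
  · fin_cases i
    · exact Complex.reCLM.comp_analyticOnNhd hgR
    · exact Complex.imCLM.comp_analyticOnNhd hgR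
  · fin_cases i <;> simp [hw, h0 z hz hS]
  · have ht : ∀ i, Vanishing W (imZero j) (eI j) k fun z => fderiv ℝ (w i) z (eR j) :=
      fun i => (hk i).fderiv_tangent hW (add_smul_eR_mem_imZero j j)
    fin_cases i
    · refine ((ht 1).neg hW).congr hW fun z hz => ?_
      change -fderiv ℝ (fun z => (g (π z)).im) z (eR j) = fderiv ℝ (fun z => (g (π z)).re) z (eI j)
      rw [hdim z hz, hdre z hz, hCR]
      simp
    · refine (ht 0).congr hW fun z hz => ?_
      change fderiv ℝ (fun z => (g (π z)).re) z (eR j) = fderiv ℝ (fun z => (g (π z)).im) z (eI j)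
      rw [hdim z hz, hdre z hz, hCR]
      simp

/-- A holomorphic function vanishing on `{y₂ = y₃ = 0}` vanishes. -/
theorem eq_zero_of_holomorphic (hW : IsOpen W) (hWc : Convex ℝ W)
    (hW2 : ∀ z ∈ W, killIm 2 z ∈ W) (hW1 : ∀ z ∈ W, killIm 1 z ∈ W) {g : C3 → ℂ}
    (hg : AnalyticOnNhd ℂ g W) (h0 : ∀ z ∈ W, z ∈ imZero 1 → z ∈ imZero 2 → g z = 0) :
    ∀ z ∈ W, g z = 0 := by
  have h1 := eq_zero_of_holomorphic_step hW hWc hg 1 (killIm 2) (killIm_eR 2 1)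
    (killIm_eI (by decide)) hW2 hW1 fun z hz hz1 => h0 _ (hW2 z hz) (by
      change (killIm 2 z 1).im = 0
      rw [killIm_im_of_ne (by decide)]
      exact hz1) (killIm_im_same 2 z)
  refine eq_zero_of_holomorphic_step hW hWc hg 2 (ContinuousLinearMap.id ℝ C3) rfl rfl
    (fun z hz => hz) hW2 fun z hz hz2 => ?_
  have h2 := h1 z hz
  rwa [killIm_apply, show (z 2).im = 0 from hz2, zero_smul, sub_zero] at h2

/-- Solutions on `W` of the Calabi-Yau equations with prescribed components along
`{y₂ = y₃ = 0}` and prescribed gauge along `{y₃ = 0}`. -/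
structure IsSolution (W : Set C3) (a N : C3 → Fin 9 → ℝ) (v : C3 → ℝ)
    (ω : C3 → C3 [⋀^Fin 2]→L[ℝ] ℝ) (f : C3 → ℂ) : Prop where
  analytic : AnalyticOnNhd ℝ ω W
  closed : ∀ z ∈ W, extDeriv ω z = 0
  type11 : ∀ z ∈ W, IsType11 (ω z)
  pos : ∀ z ∈ W, ∀ u : C3, u ≠ 0 → 0 < ω z ![u, Complex.I • u]
  holomorphic : AnalyticOnNhd ℂ f W
  ne_zero : ∀ z ∈ W, f z ≠ 0
  det_eq : ∀ z ∈ W, hermDet (comp (ω z)) = ‖f z‖ ^ 2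
  eq_slice : ∀ z ∈ W, z ∈ imZero 1 → z ∈ imZero 2 → comp (ω z) = a z
  eq_slice_holomorphic : ∀ z ∈ W, z ∈ imZero 1 → z ∈ imZero 2 → f z = v z
  gauge : ∀ z ∈ W, z ∈ imZero 2 →
    comp (ω z) 3 = N z 3 ∧ comp (ω z) 4 = N z 4 ∧ comp (ω z) 8 = N z 8

theorem IsSolution.mono {W' : Set C3} {a N : C3 → Fin 9 → ℝ} {v : C3 → ℝ}
    {ω : C3 → C3 [⋀^Fin 2]→L[ℝ] ℝ} {f : C3 → ℂ} (h : IsSolution W a N v ω f) (hW : W' ⊆ W) :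
    IsSolution W' a N v ω f where
  analytic := h.analytic.mono hW
  closed z hz := h.closed z (hW hz)
  type11 z hz := h.type11 z (hW hz)
  pos z hz := h.pos z (hW hz)
  holomorphic := h.holomorphic.mono hW
  ne_zero z hz := h.ne_zero z (hW hz)
  det_eq z hz := h.det_eq z (hW hz)
  eq_slice z hz := h.eq_slice z (hW hz)
  eq_slice_holomorphic z hz := h.eq_slice_holomorphic z (hW hz)
  gauge z hz := h.gauge z (hW hz)

theorem hermMinor_pos {η : C3 [⋀^Fin 2]→L[ℝ] ℝ} (h : IsType11 η)
    (hp : ∀ u : C3, u ≠ 0 → 0 < η ![u, Complex.I • u]) : 0 < hermMinor (comp η) := by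
  have hI : ∀ u v w : C3, Complex.I • (u + v + w)
      = Complex.I • u + Complex.I • v + Complex.I • w := fun u v w => by
    rw [smul_add, smul_add]
  have hs : ∀ (c : ℝ) (u : C3), Complex.I • (c • u) = c • (Complex.I • u) := fun c u =>
    smul_comm _ _ _
  have h0 : 0 < comp η 0 := by
    have := hp (eR 0) (by
      intro h
      have := congrFun h 0
      simp [eR] at this)
    rwa [I_smul_eR] at this
  set A := comp η 0 with hA
  set B := comp η 1 with hB
  set C := comp η 6 with hC
  -- This vector is A e₂ minus the component that makes it Hermitian-orthogonal to e₁; the form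
  -- takes the value A times the minor on it.
  have h1 := hp (A • eR 1 + (-B) • eR 0 + (-C) • eI 0) (by
      intro h
      have := congrFun h 1
      simp [eR, eI] at this
      exact h0.ne' this)
  simp only [hI, hs, I_smul_eR, I_smul_eI, twoForm_add_left, twoForm_add_right, twoForm_smul_left,
    twoForm_smul_right, twoForm_neg_right, h.eI_eI, h.eI_eR, twoForm_self, h.symm 1 0,
    twoForm_swap η (eR 1) (eR 0)] at h1
  have e0 : η ![eR 0, eI 0] = A := rfl
  have e1 : η ![eR 0, eI 1] = B := rfl
  have e2 : η ![eR 0, eR 1] = C := rfl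
  have e3 : η ![eR 1, eI 1] = comp η 3 := rfl
  rw [e0, e1, e2, e3] at h1
  unfold hermMinor
  rw [← hA, ← hB, ← hC]
  by_contra hneg
  nlinarith

/-- The densities agree because they agree on {y₂ = y₃ = 0}. The difference of the forms then
satisfies the uniqueness result for closed (1,1)-forms: equality of the determinants, which are
affine in a₃₃ with nonvanishing slope, expresses the difference of the a₃₃ through the other
differences. -/
theorem IsSolution.unique (hW : IsOpen W) (hWc : Convex ℝ W)
    (hW2 : ∀ z ∈ W, killIm 2 z ∈ W) (hW1 : ∀ z ∈ W, killIm 1 z ∈ W)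
    {a N : C3 → Fin 9 → ℝ} {v : C3 → ℝ} {ω ω' : C3 → C3 [⋀^Fin 2]→L[ℝ] ℝ} {f f' : C3 → ℂ}
    (h : IsSolution W a N v ω f) (h' : IsSolution W a N v ω' f') :
    ∀ z ∈ W, ω' z = ω z ∧ f' z = f z := by
  have hf : ∀ z ∈ W, f' z = f z := fun z hz => sub_eq_zero.1 <|
    eq_zero_of_holomorphic hW hWc hW2 hW1 (h'.holomorphic.sub h.holomorphic)
      (fun z hz h1 h2 => by
        simp [h.eq_slice_holomorphic z hz h1 h2, h'.eq_slice_holomorphic z hz h1 h2]) z hz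
  have hω : ∀ z ∈ W, ω' z - ω z = 0 := by
    refine eq_zero_of_closed_type11 hW hWc hW2 hW1 (h'.analytic.sub h.analytic)
      (fun z hz => ?_) (fun z hz u v => ?_) (fun z hz h1 h2 => ?_) (fun z hz h2 => ?_)
      (fun k hk => ?_)
    · have e1 : (fun z => ω' z - ω z) = ω' + (-1 : ℝ) • ω := by
        funext y
        ext v
        change ω' y v - ω y v = ω' y v + (-1 : ℝ) • ω y v
        rw [neg_one_smul, sub_eq_add_neg]
      change extDeriv (fun z => ω' z - ω z) z = 0
      rw [e1, extDeriv_add (h'.analytic z hz).differentiableAt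
        ((h.analytic z hz).differentiableAt.const_smul (-1 : ℝ)), extDeriv_smul,
        h.closed z hz, h'.closed z hz, smul_zero, add_zero]
    · have e1 := h.type11 z hz u v
      have e2 := h'.type11 z hz u v
      change ω' z _ - ω z _ = ω' z _ - ω z _
      rw [e1, e2]
    · rw [sub_eq_zero]
      exact (h'.type11 z hz).ext (h.type11 z hz)
        ((h'.eq_slice z hz h1 h2).trans (h.eq_slice z hz h1 h2).symm)
    · obtain ⟨e1, e2, e3⟩ := h.gauge z hz h2
      obtain ⟨e1', e2', e3'⟩ := h'.gauge z hz h2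
      simp only [comp_sub, e1, e2, e3, e1', e2', e3', sub_self, and_self]
    · set c : Fin 9 → C3 → ℝ := fun i z => comp (ω z) i with hc
      set c' : Fin 9 → C3 → ℝ := fun i z => comp (ω' z) i with hc'
      have han : ∀ i, AnalyticOnNhd ℝ (c i) W := fun i => analyticOnNhd_comp h.analytic i
      have han' : ∀ i, AnalyticOnNhd ℝ (c' i) W := fun i => analyticOnNhd_comp h'.analytic i
      have hV : ∀ i ≠ 5, Vanishing W (imZero 2) (eI 2) k fun z => c' i z - c i z :=
        fun i hi => (hk i hi).congr hW fun z _ => comp_sub _ _ _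
      have h0 : Vanishing W (imZero 2) (eI 2) k fun z => c' 5 z - c' 5 z := by
        refine (hV 0 (by decide)).neg hW |>.add hW (hV 0 (by decide)) |>.congr hW fun z _ => ?_
        simp
      -- the determinants with the same component `5`
      have hU : ∀ i, Vanishing W (imZero 2) (eI 2) k fun z =>
          c' i z - (if i = 5 then c' 5 z else c i z) := by
        intro i
        by_cases hi : i = 5
        · subst hi; simpa using h0
        · simpa [hi] using hV i hi
      -- The intermediate tuple has the eight entries of `c` and the entry 5 of `c'`: its
      -- determinant differs from that of `c'` by terms in the eight known differences, and from
      -- that of `c` by the minor times c'₅ - c₅.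
      set d : Fin 9 → C3 → ℝ := fun i z => if i = 5 then c' 5 z else c i z with hd
      have hdan : ∀ i, AnalyticOnNhd ℝ (d i) W := fun i => by
        by_cases hi : i = 5
        · simpa [hd, hi] using han' 5
        · simpa [hd, hi] using han i
      have m2 : ∀ i j, Vanishing W (imZero 2) (eI 2) k fun z => c' i z * c' j z - d i z * d j z :=
        fun i j => Vanishing.mul_sub_mul hW (han' i) (hdan j) (hU i) (hU j)
      have m3 : ∀ i j l, Vanishing W (imZero 2) (eI 2) k fun z =>
          c' i z * c' j z * c' l z - d i z * d j z * d l z :=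
        fun i j l => Vanishing.mul_sub_mul hW ((han' i).mul (han' j)) (hdan l) (m2 i j) (hU l)
      have hm : ∀ z ∈ W, hermMinor (comp (ω z)) ≠ 0 := fun z hz =>
        (hermMinor_pos (h.type11 z hz) (h.pos z hz)).ne'
      have hman : AnalyticOnNhd ℝ (fun z => -2 / hermMinor (comp (ω z))) W := by
        refine analyticOnNhd_const.div ?_ hm
        unfold hermMinor
        exact (((han 0).mul (han 3)).sub ((han 1).pow 2)).sub ((han 6).pow 2)
      have hman1 : AnalyticOnNhd ℝ (fun z => -1 / hermMinor (comp (ω z))) W := by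
        refine analyticOnNhd_const.div ?_ hm
        unfold hermMinor
        exact (((han 0).mul (han 3)).sub ((han 1).pow 2)).sub ((han 6).pow 2)
      have s1 := (m3 0 3 5).sub hW (m3 0 4 4) |>.sub hW (m3 3 2 2) |>.sub hW (m3 5 1 1)
        |>.sub hW (m3 0 8 8) |>.sub hW (m3 3 7 7) |>.sub hW (m3 5 6 6)
      have s2 := (m3 1 2 4).add hW (m3 1 8 7) |>.sub hW (m3 2 8 6) |>.add hW (m3 4 7 6)
      refine ((Vanishing.mul hW hman1 s1).add hW (Vanishing.mul hW hman s2)).congr hW fun z hz => ?_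
      have e : hermDet (comp (ω' z)) = hermDet (comp (ω z)) := by
        rw [h.det_eq z hz, h'.det_eq z hz, hf z hz]
      have hm' := hm z hz
      have ec : ∀ i, comp (ω z) i = c i z := fun i => rfl
      have ec' : ∀ i, comp (ω' z) i = c' i z := fun i => rfl
      simp only [comp_sub]
      unfold hermDet at e
      unfold hermMinor at hm' ⊢
      simp only [ec, ec'] at e hm' ⊢
      simp only [hd, Fin.reduceEq, if_true, if_false]
      field_simp
      linear_combination (-1 : ℝ) * e
  exact fun z hz => ⟨sub_eq_zero.1 (hω z hz), hf z hz⟩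

end Uniqueness

end SLag

/-! ### Exact two-forms and the operator dd^c. -/

open Topology

namespace SLag

section ExactForms

/-- The differential form with values `θ z`. -/
noncomputable def oneForm (θ : C3 → C3 →L[ℝ] ℝ) (z : C3) : C3 [⋀^Fin 1]→L[ℝ] ℝ :=
  ContinuousAlternatingMap.ofSubsingleton ℝ C3 ℝ (0 : Fin 1) (θ z)

variable {W : Set C3}

theorem analyticAt_oneForm {θ : C3 → C3 →L[ℝ] ℝ} {z : C3} (h : AnalyticAt ℝ θ z) :
    AnalyticAt ℝ (oneForm θ) z :=
  (ContinuousLinearMap.analyticAt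
    ((ContinuousAlternatingMap.ofSubsingletonLIE (𝕜 := ℝ) (E := C3) (F := ℝ)
      (0 : Fin 1)).toContinuousLinearEquiv : (C3 →L[ℝ] ℝ) →L[ℝ] (C3 [⋀^Fin 1]→L[ℝ] ℝ)) _).comp h

theorem extDeriv_oneForm_apply {θ : C3 → C3 →L[ℝ] ℝ} {z : C3} (h : AnalyticAt ℝ θ z) (u v : C3) :
    extDeriv (oneForm θ) z ![u, v] = fderiv ℝ θ z u v - fderiv ℝ θ z v u := by
  rw [extDeriv_apply (analyticAt_oneForm h).differentiableAt, Fin.sum_univ_two]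
  have h0 : ∀ w : Fin 1 → C3, fderiv ℝ (fun x => oneForm θ x w) z
      = (ContinuousLinearMap.apply ℝ ℝ (w 0)).comp (fderiv ℝ θ z) := fun w =>
    ((ContinuousLinearMap.apply ℝ ℝ (w 0)).hasFDerivAt.comp z
      h.differentiableAt.hasFDerivAt).fderiv
  have e0 : (0 : Fin 2).removeNth ![u, v] 0 = v := rfl
  have e1 : (1 : Fin 2).removeNth ![u, v] 0 = u := rfl
  rw [h0, h0]
  simp only [ContinuousLinearMap.comp_apply, ContinuousLinearMap.apply_apply, e0, e1]
  simp [sub_eq_add_neg]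

theorem analyticAt_extDeriv {n : ℕ} {η : C3 → C3 [⋀^Fin n]→L[ℝ] ℝ} {z : C3}
    (h : AnalyticAt ℝ η z) : AnalyticAt ℝ (extDeriv η) z :=
  AnalyticAt.comp (g := ContinuousAlternatingMap.alternatizeUncurryFinCLM ℝ C3 ℝ)
    (ContinuousLinearMap.analyticAt _ _) h.fderiv

theorem extDeriv_extDeriv_of_analyticAt {n : ℕ} {η : C3 → C3 [⋀^Fin n]→L[ℝ] ℝ} {z : C3}
    (h : AnalyticAt ℝ η z) : extDeriv (extDeriv η) z = 0 :=
  extDeriv_extDeriv_apply (r := 2) h.contDiffAt (by simp)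

/-- Multiplication by `i`. -/
noncomputable def mulI : C3 →L[ℝ] C3 :=
  (Complex.I • ContinuousLinearMap.id ℂ C3).restrictScalars ℝ

theorem mulI_apply (u : C3) : mulI u = Complex.I • u := rfl

/-- The second derivative as a bilinear form. -/
noncomputable def hessian (φ : C3 → ℝ) (z u v : C3) : ℝ := fderiv ℝ (fderiv ℝ φ) z u v

theorem hessian_symm {φ : C3 → ℝ} {z : C3} (h : AnalyticAt ℝ φ z) (u v : C3) :
    hessian φ z u v = hessian φ z v u := by
  have h1 : IsSymmSndFDerivAt ℝ φ z := by
    apply ContDiffAt.isSymmSndFDerivAt (n := 2) h.contDiffAt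
    simp
  exact h1 u v

/-- The form `dd^cφ`, normalized to have the components `¼(φ_{xⱼxₖ} + φ_{yⱼyₖ})`. -/
noncomputable def ddc (φ : C3 → ℝ) : C3 → C3 [⋀^Fin 2]→L[ℝ] ℝ :=
  extDeriv (oneForm fun z => (-(1 / 4) : ℝ) • (fderiv ℝ φ z).comp mulI)

theorem analyticAt_dc {φ : C3 → ℝ} {z : C3} (h : AnalyticAt ℝ φ z) :
    AnalyticAt ℝ (fun z => (-(1 / 4) : ℝ) • (fderiv ℝ φ z).comp mulI) z :=
  (ContinuousLinearMap.analyticAt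
    ((-(1 / 4) : ℝ) • (ContinuousLinearMap.compL ℝ C3 C3 ℝ).flip mulI) _).comp h.fderiv

theorem analyticAt_ddc {φ : C3 → ℝ} {z : C3} (h : AnalyticAt ℝ φ z) : AnalyticAt ℝ (ddc φ) z :=
  analyticAt_extDeriv (analyticAt_oneForm (analyticAt_dc h))

theorem extDeriv_ddc {φ : C3 → ℝ} {z : C3} (h : AnalyticAt ℝ φ z) : extDeriv (ddc φ) z = 0 :=
  extDeriv_extDeriv_of_analyticAt (analyticAt_oneForm (analyticAt_dc h))

theorem ddc_apply {φ : C3 → ℝ} {z : C3} (h : AnalyticAt ℝ φ z) (u v : C3) :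
    ddc φ z ![u, v] = 1 / 4 * (hessian φ z v (Complex.I • u) - hessian φ z u (Complex.I • v)) := by
  have h1 : fderiv ℝ (fun z => (-(1 / 4) : ℝ) • (fderiv ℝ φ z).comp mulI) z
      = ((-(1 / 4) : ℝ) • (ContinuousLinearMap.compL ℝ C3 C3 ℝ).flip mulI).comp
        (fderiv ℝ (fderiv ℝ φ) z) :=
    (((-(1 / 4) : ℝ) • (ContinuousLinearMap.compL ℝ C3 C3 ℝ).flip mulI).hasFDerivAt.comp z
      h.fderiv.differentiableAt.hasFDerivAt).fderiv
  rw [ddc, extDeriv_oneForm_apply (analyticAt_dc h), h1]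
  change -(1 / 4) * hessian φ z u (mulI v) - -(1 / 4) * hessian φ z v (mulI u) = _
  rw [mulI_apply, mulI_apply]
  ring

theorem isType11_ddc {φ : C3 → ℝ} {z : C3} (h : AnalyticAt ℝ φ z) : IsType11 (ddc φ z) := by
  intro u v
  have hneg : ∀ a b, hessian φ z a (-b) = -hessian φ z a b := fun a b => map_neg _ _
  rw [ddc_apply h, ddc_apply h, smul_smul, smul_smul, Complex.I_mul_I, neg_one_smul, neg_one_smul,
    hneg, hneg, hessian_symm h _ u, hessian_symm h _ v]
  ring

/-- The standard real basis `∂/∂x₁, ∂/∂x₂, ∂/∂x₃, ∂/∂y₁, ∂/∂y₂, ∂/∂y₃`. -/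
noncomputable def realBasis : Fin 6 → C3 := ![eR 0, eR 1, eR 2, eI 0, eI 1, eI 2]

theorem comp_ddc {φ : C3 → ℝ} {z : C3} (h : AnalyticAt ℝ φ z) :
    comp (ddc φ z) = hess fun i j => hessian φ z (realBasis i) (realBasis j) := by
  have hneg : ∀ a b, hessian φ z a (-b) = -hessian φ z a b := fun a b => map_neg _ _
  have hs := hessian_symm h
  funext i
  unfold comp hess
  fin_cases i <;>
  · simp only [Fin.isValue, Fin.zero_eta, Fin.mk_one, Fin.reduceFinMk, Matrix.cons_val, smul_eq_mul,
      ddc_apply h, I_smul_eR, I_smul_eI, hneg, realBasis]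
    linarith [hs (eI 1) (eI 0), hs (eI 2) (eI 0), hs (eI 2) (eI 1), hs (eR 1) (eI 0),
      hs (eR 2) (eI 0), hs (eR 2) (eI 1)]

end ExactForms

end SLag

/-! ### Holomorphic extensions and holomorphic potentials. -/

open Topology Filter MvPowerSeries

namespace SLag

section Potential

variable {σ : Type*} [Fintype σ]

theorem map_pderiv_ofReal (c : MvPowerSeries σ ℝ) (i : σ) :
    pderiv ℂ i (map (algebraMap ℝ ℂ) c) = map (algebraMap ℝ ℂ) (pderiv ℝ i c) := by
  ext a
  simp [coeff_pderiv]

theorem fderiv_evalSeries_single {𝕜 : Type*} [RCLike 𝕜] [DecidableEq σ] {ρ : ℝ}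
    {c : MvPowerSeries σ 𝕜} (h : AbsConv ρ c) {x : σ → 𝕜} (hx : ‖x‖ < ρ) (i : σ) :
    fderiv 𝕜 (evalSeries c) x (Pi.single i 1) = evalSeries (pderiv 𝕜 i c) x := by
  have h1 : HasFDerivAt (evalSeries c) (fderiv 𝕜 (evalSeries c) x) x :=
    (analyticOnNhd_evalSeries h x (by simpa using hx)).differentiableAt.hasFDerivAt
  have h2 : HasDerivAt (fun s : 𝕜 => x + s • Pi.single i (1 : 𝕜)) (Pi.single i 1) 0 := by
    simpa using ((hasDerivAt_id (0 : 𝕜)).smul_const (Pi.single i (1 : 𝕜))).const_add x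
  exact (h1.comp_hasDerivAt_of_eq (0 : 𝕜) h2 (by simp)).unique (hasDerivAt_evalSeries h hx i)

/-- A real-analytic function extends holomorphically. -/
theorem exists_holomorphic_extension {g : (σ → ℝ) → ℝ} {q : σ → ℝ} (hg : AnalyticAt ℝ g q) :
    ∃ ρ > 0, ∃ G : (σ → ℂ) → ℂ, AnalyticOnNhd ℂ G (Metric.ball 0 ρ) ∧
      ∀ w : σ → ℝ, ‖w‖ < ρ → G (fun i => (w i : ℂ)) = g (q + w) := by
  obtain ⟨ρ, hρ, c, hc, h⟩ := exists_evalSeries_of_analyticAt hg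
  refine ⟨ρ, hρ, _, analyticOnNhd_evalSeries (absConv_map_ofReal (𝕜 := ℂ) hc), fun w hw => ?_⟩
  rw [h w hw]
  exact evalSeries_map_ofReal c w

/-- These are the terms of the majorant of xₖ · c. -/
theorem summable_shift {ρ : ℝ} {c : MvPowerSeries σ ℝ} (h : AbsConv ρ c) (k : σ) :
    Summable fun α : σ →₀ ℕ =>
      if α k = 0 then 0 else ‖coeff (α - Finsupp.single k 1) c‖ * ρ ^ α.degree := by
  classical
  have hinj : Function.Injective fun β : σ →₀ ℕ => β + Finsupp.single k 1 :=
    add_left_injective _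
  refine (hinj.summable_iff fun α hα => ?_).1 ?_
  · by_cases h0 : α k = 0
    · simp [h0]
    · refine absurd ⟨α - Finsupp.single k 1, ?_⟩ hα
      exact sub_single_add_single h0
  · refine (h.mul_right ρ).congr fun β => ?_
    simp [pow_succ, mul_assoc]

/-- A primitive of a closed one-form in three of the four variables. -/
noncomputable def eulerPrimitive (c : Fin 3 → MvPowerSeries (Fin 4) ℝ) : MvPowerSeries (Fin 4) ℝ :=
  fun α => (∑ k : Fin 3, if α k.castSucc = 0 then 0 else
    coeff (α - Finsupp.single k.castSucc 1) (c k)) / ∑ k : Fin 3, (α k.castSucc : ℝ)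

/-- Dividing by a natural number does not increase the norm; for exponents of degree zero in the
three space variables, division by zero gives the value 0. -/
theorem absConv_eulerPrimitive {ρ : ℝ} (hρ : 0 < ρ) {c : Fin 3 → MvPowerSeries (Fin 4) ℝ}
    (hc : ∀ k, AbsConv ρ (c k)) : AbsConv ρ (eulerPrimitive c) := by
  refine Summable.of_nonneg_of_le (fun _ => by positivity) (fun α => ?_)
    (summable_sum (s := Finset.univ) fun k _ => summable_shift (hc k) k.castSucc)
  have e : coeff α (eulerPrimitive c) = (∑ k : Fin 3, if α k.castSucc = 0 then 0 else
    coeff (α - Finsupp.single k.castSucc 1) (c k)) / ∑ k : Fin 3, (α k.castSucc : ℝ) := rfl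
  rw [e]
  have h1 : ∀ s : ℝ, ∀ n : ℕ, ‖s / (n : ℝ)‖ ≤ ‖s‖ := by
    intro s n
    rw [norm_div]
    rcases Nat.eq_zero_or_pos n with h | h
    · simp [h]
    · refine div_le_self (norm_nonneg _) ?_
      exact_mod_cast h
  have h2 : ∑ k : Fin 3, (α k.castSucc : ℝ) = ((∑ k : Fin 3, α k.castSucc : ℕ) : ℝ) := by
    push_cast; rfl
  rw [h2]
  calc _ ≤ ‖∑ k : Fin 3, if α k.castSucc = 0 then 0 else
        coeff (α - Finsupp.single k.castSucc 1) (c k)‖ * ρ ^ α.degree := by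
        gcongr
        exact h1 _ _
    _ ≤ (∑ k : Fin 3, ‖if α k.castSucc = 0 then 0 else
        coeff (α - Finsupp.single k.castSucc 1) (c k)‖) * ρ ^ α.degree := by
        gcongr
        exact norm_sum_le _ _
    _ = _ := by
        rw [Finset.sum_mul]
        refine Finset.sum_congr rfl fun k _ => ?_
        split_ifs <;> simp

/-- The Poincaré lemma by Euler's formula: contracting a closed form with the radial field and
dividing by the degree in the three space variables inverts d. -/
theorem pderiv_eulerPrimitive {c : Fin 3 → MvPowerSeries (Fin 4) ℝ}
    (hc : ∀ j k : Fin 3, pderiv ℝ j.castSucc (c k) = pderiv ℝ k.castSucc (c j)) (k : Fin 3) :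
    pderiv ℝ k.castSucc (eulerPrimitive c) = c k := by
  ext α
  rw [coeff_pderiv]
  set β := α + Finsupp.single k.castSucc 1 with hβ
  have e : coeff β (eulerPrimitive c) = (∑ l : Fin 3, if β l.castSucc = 0 then 0 else
    coeff (β - Finsupp.single l.castSucc 1) (c l)) / ∑ l : Fin 3, (β l.castSucc : ℝ) := rfl
  have hβk : (β k.castSucc : ℝ) = α k.castSucc + 1 := by simp [hβ]
  -- Closedness trades the coefficient of c_l for that of c_k, so each summand is the wanted
  -- coefficient times an exponent; the exponents add up to the denominator.
  have key : ∀ l : Fin 3, (if β l.castSucc = 0 then 0 else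
      coeff (β - Finsupp.single l.castSucc 1) (c l)) * (α k.castSucc + 1 : ℝ)
      = coeff α (c k) * β l.castSucc := by
    intro l
    by_cases hl : l = k
    · subst hl
      have h1 : β l.castSucc ≠ 0 := by simp [hβ]
      rw [if_neg h1, hβk, hβ, add_tsub_cancel_right]
    · have h2 : β l.castSucc = α l.castSucc := by
        have : k.castSucc ≠ l.castSucc := fun h => hl (Fin.castSucc_injective _ h).symm
        simp [hβ, this]
      by_cases h0 : α l.castSucc = 0
      · simp [h2, h0]
      · obtain ⟨γ, rfl⟩ : ∃ γ, α = γ + Finsupp.single l.castSucc 1 :=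
          ⟨_, (sub_single_add_single h0).symm⟩
        have h3 : β - Finsupp.single l.castSucc 1 = γ + Finsupp.single k.castSucc 1 := by
          rw [hβ, add_right_comm, add_tsub_cancel_right]
        have h4 := congrArg (coeff γ) (hc k l)
        rw [coeff_pderiv, coeff_pderiv] at h4
        have h5 : (γ + Finsupp.single l.castSucc 1 : Fin 4 →₀ ℕ) k.castSucc = γ k.castSucc := by
          have : l.castSucc ≠ k.castSucc := fun h => hl (Fin.castSucc_injective _ h)
          simp [this]
        rw [if_neg (by rw [h2]; exact h0), h3, h2, h5, h4]
        simp
  have hpos : (0 : ℝ) < ∑ l : Fin 3, (β l.castSucc : ℝ) := by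
    refine Finset.sum_pos' (fun _ _ => by positivity) ⟨k, Finset.mem_univ _, ?_⟩
    rw [hβk]; positivity
  rw [e, div_mul_eq_mul_div, Finset.sum_mul, Finset.sum_congr rfl fun l _ => key l,
    ← Finset.mul_sum, mul_div_assoc, div_self hpos.ne', mul_one]

/-- The fourth variable, time, is a parameter: closedness is needed in the three space variables
only. The primitive has real coefficients, so at real points its time derivative is real, which the
form built from it will require. -/
theorem exists_holomorphic_potential {a : Fin 3 → (Fin 4 → ℝ) → ℝ} {q : Fin 4 → ℝ}
    (ha : ∀ k, AnalyticAt ℝ (a k) q)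
    (hcl : ∀ j k : Fin 3, ∀ᶠ w in 𝓝 q, fderiv ℝ (a k) w (Pi.single j.castSucc 1)
      = fderiv ℝ (a j) w (Pi.single k.castSucc 1)) :
    ∃ ρ > 0, ∃ H : (Fin 4 → ℂ) → ℂ, AnalyticOnNhd ℂ H (Metric.ball 0 ρ) ∧
      ∀ w : Fin 4 → ℝ, ‖w‖ < ρ →
        (∀ k : Fin 3, fderiv ℂ H (fun i => (w i : ℂ)) (Pi.single k.castSucc 1) = a k (q + w)) ∧
        (fderiv ℂ H (fun i => (w i : ℂ)) (Pi.single (Fin.last 3) 1)).im = 0 := by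
  choose ρ hρ c hc h using fun k => exists_evalSeries_of_analyticAt (ha k)
  obtain ⟨r, hr0, hr⟩ : ∃ r > 0, ∀ k, r ≤ ρ k :=
    ⟨min (ρ 0) (min (ρ 1) (ρ 2)), by simp [hρ], fun k => by fin_cases k <;> simp⟩
  have hcr : ∀ k, AbsConv r (c k) := fun k => (hc k).mono hr0.le (hr k)
  have hfd : ∀ k j : Fin 3, ∀ w : Fin 4 → ℝ, ‖w‖ < r →
      fderiv ℝ (a k) (q + w) (Pi.single j.castSucc 1)
        = evalSeries (pderiv ℝ j.castSucc (c k)) w := by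
    intro k j w hw
    rw [← fderiv_evalSeries_single (hcr k) hw]
    have h1 : (fun y => a k (q + y)) =ᶠ[𝓝 w] evalSeries (c k) := by
      filter_upwards [(continuous_norm.tendsto w).eventually_lt_const hw] with y hy
      exact h k y (hy.trans_le (hr k))
    rw [← h1.fderiv_eq, fderiv_comp_add_left]
  have hclosed : ∀ j k : Fin 3, pderiv ℝ j.castSucc (c k) = pderiv ℝ k.castSucc (c j) := by
    intro j k
    obtain ⟨ε, hε, hε'⟩ := Metric.eventually_nhds_iff.1 (hcl j k)
    have hs0 : 0 < min ε (r / 2) := by positivity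
    have habs : ∀ i j : Fin 3, AbsConv (min ε (r / 2)) (pderiv ℝ i.castSucc (c j)) := fun i j =>
      (hcr j).pderiv hs0.le ((min_le_right _ _).trans_lt (half_lt_self hr0)) _
    have h2 : AbsConv (min ε (r / 2)) ((-1 : ℝ) • pderiv ℝ k.castSucc (c j)) := (habs k j).smul _
    -- Closedness near the point is transferred to coefficients by uniqueness of power series, on a
    -- radius small enough for the hypothesis and both derivatives.
    have := eq_zero_of_evalSeries_eq_zero hs0 (AbsConv.add hs0.le (habs j k) h2) fun w hw => by
      have hw1 : ‖w‖ < r := hw.trans ((min_le_right _ _).trans_lt (half_lt_self hr0))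
      rw [evalSeries_add (habs j k) h2 hw.le, evalSeries_smul, ← hfd k j w hw1, ← hfd j k w hw1,
        hε' (by simpa using hw.trans_le (min_le_left _ _))]
      simp
    rw [neg_one_smul, ← sub_eq_add_neg] at this
    exact sub_eq_zero.1 this
  have hE := absConv_eulerPrimitive hr0 hcr
  refine ⟨r, hr0, _, analyticOnNhd_evalSeries (absConv_map_ofReal (𝕜 := ℂ) hE), fun w hw => ?_⟩
  have hw' : ‖(fun i => (w i : ℂ) : Fin 4 → ℂ)‖ < r := by
    rw [pi_norm_lt_iff hr0] at hw ⊢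
    simpa using hw
  have e : ∀ i, fderiv ℂ (evalSeries (map (algebraMap ℝ ℂ) (eulerPrimitive c)))
      (fun i => (w i : ℂ)) (Pi.single i 1)
      = ((evalSeries (pderiv ℝ i (eulerPrimitive c)) w : ℝ) : ℂ) := by
    intro i
    rw [fderiv_evalSeries_single (absConv_map_ofReal (𝕜 := ℂ) hE) hw', map_pderiv_ofReal]
    exact evalSeries_map_ofReal _ _
  refine ⟨fun k => ?_, ?_⟩
  · rw [e, pderiv_eulerPrimitive hclosed, h k w (hw.trans_le (hr k))]
  · rw [e, Complex.ofReal_im]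

end Potential

end SLag

/-! ### Explicit closed (1,1)-forms with prescribed components on {y₂ = y₃ = 0}. -/

open Topology Filter ComplexConjugate

namespace SLag

section LocalForms

noncomputable def reL (j : Fin 3) : C3 →L[ℝ] ℝ :=
  Complex.reCLM.comp (ContinuousLinearMap.proj (R := ℝ) (φ := fun _ : Fin 3 => ℂ) j)

noncomputable def imL (j : Fin 3) : C3 →L[ℝ] ℝ :=
  Complex.imCLM.comp (ContinuousLinearMap.proj (R := ℝ) (φ := fun _ : Fin 3 => ℂ) j)

theorem reL_apply (j : Fin 3) (z : C3) : reL j z = (z j).re := rfl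

theorem imL_apply (j : Fin 3) (z : C3) : imL j z = (z j).im := rfl

theorem reL_eR (j k : Fin 3) : reL j (eR k) = if j = k then 1 else 0 := by
  by_cases h : j = k <;> simp [reL_apply, eR, h]

theorem reL_eI (j k : Fin 3) : reL j (eI k) = 0 := by
  by_cases h : j = k
  · subst h; simp [reL_apply, eI]
  · simp [reL_apply, eI, h]

theorem imL_eR (j k : Fin 3) : imL j (eR k) = 0 := by
  by_cases h : j = k
  · subst h; simp [imL_apply, eR]
  · simp [imL_apply, eR, h]

theorem imL_eI (j k : Fin 3) : imL j (eI k) = if j = k then 1 else 0 := by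
  by_cases h : j = k
  · subst h; simp [imL_apply, eI]
  · simp [imL_apply, eI, h]

/-! ### The form prescribing the first row -/

/-- The form `-Im(dk ∧ dz̄₁)`. -/
noncomputable def rowForm (k : C3 → ℂ) : C3 → C3 [⋀^Fin 2]→L[ℝ] ℝ :=
  extDeriv (oneForm fun z => (k z).re • imL 0 - (k z).im • reL 0)

variable {k : C3 → ℂ} {z : C3}

theorem analyticAt_rowForm_primitive (h : AnalyticAt ℝ k z) :
    AnalyticAt ℝ (fun z => (k z).re • imL 0 - (k z).im • reL 0) z :=
  (((Complex.reCLM.analyticAt _).comp h).smul analyticAt_const).sub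
    (((Complex.imCLM.analyticAt _).comp h).smul analyticAt_const)

theorem analyticAt_rowForm (h : AnalyticAt ℝ k z) : AnalyticAt ℝ (rowForm k) z :=
  analyticAt_extDeriv (analyticAt_oneForm (analyticAt_rowForm_primitive h))

theorem extDeriv_rowForm (h : AnalyticAt ℝ k z) : extDeriv (rowForm k) z = 0 :=
  extDeriv_extDeriv_of_analyticAt (analyticAt_oneForm (analyticAt_rowForm_primitive h))

theorem rowForm_apply (h : AnalyticAt ℝ k z) (u v : C3) :
    rowForm k z ![u, v]
      = -(fderiv ℝ k z u * conj (v 0) - fderiv ℝ k z v * conj (u 0)).im := by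
  have h1 : HasFDerivAt k (fderiv ℝ k z) z := h.differentiableAt.hasFDerivAt
  have h2 := ((Complex.reCLM.hasFDerivAt.comp z h1).smul_const (imL 0)).sub
    ((Complex.imCLM.hasFDerivAt.comp z h1).smul_const (reL 0))
  rw [rowForm, extDeriv_oneForm_apply (analyticAt_rowForm_primitive h)]
  have h3 : fderiv ℝ (fun z => (k z).re • imL 0 - (k z).im • reL 0) z = _ := h2.fderiv
  rw [h3]
  change ((fderiv ℝ k z u).re * (v 0).im - (fderiv ℝ k z u).im * (v 0).re)
    - ((fderiv ℝ k z v).re * (u 0).im - (fderiv ℝ k z v).im * (u 0).re) = _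
  simp
  ring

/-- The coordinates `(x₁, z₂, z₃, y₁)`. -/
noncomputable def mixedCoord : C3 →L[ℝ] (Fin 4 → ℂ) :=
  ContinuousLinearMap.pi ![Complex.ofRealCLM.comp (reL 0),
    ContinuousLinearMap.proj (R := ℝ) (φ := fun _ : Fin 3 => ℂ) 1,
    ContinuousLinearMap.proj (R := ℝ) (φ := fun _ : Fin 3 => ℂ) 2,
    Complex.ofRealCLM.comp (imL 0)]

theorem mixedCoord_apply (z : C3) :
    mixedCoord z = ![((z 0).re : ℂ), z 1, z 2, ((z 0).im : ℂ)] := by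
  funext i
  fin_cases i <;> rfl

theorem clm_mixedCoord (G : (Fin 4 → ℂ) →L[ℂ] ℂ) (u : C3) :
    G (mixedCoord u) = (u 0).re * G (Pi.single 0 1) + u 1 * G (Pi.single 1 1)
      + u 2 * G (Pi.single 2 1) + (u 0).im * G (Pi.single 3 1) := by
  have h : mixedCoord u = ((u 0).re : ℂ) • Pi.single 0 (1 : ℂ) + u 1 • Pi.single 1 (1 : ℂ)
      + u 2 • Pi.single 2 (1 : ℂ) + ((u 0).im : ℂ) • Pi.single 3 (1 : ℂ) := by
    rw [mixedCoord_apply]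
    funext i
    fin_cases i <;> simp
  rw [h]
  simp only [map_add, map_smul, smul_eq_mul]

/-- Since k is holomorphic in z₂ and z₃, the only dz̄ in dk is dz̄₁, which is killed by the wedge
with dz̄₁. -/
theorem isType11_rowForm (h : AnalyticAt ℝ k z) {G : (Fin 4 → ℂ) →L[ℂ] ℂ}
    (hG : ∀ u, fderiv ℝ k z u = G (mixedCoord u)) : IsType11 (rowForm k z) := by
  intro u v
  rw [rowForm_apply h, rowForm_apply h]
  simp only [hG, clm_mixedCoord]
  simp
  ring

theorem comp_rowForm_gauge (h : AnalyticAt ℝ k z) :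
    comp (rowForm k z) 3 = 0 ∧ comp (rowForm k z) 4 = 0 ∧ comp (rowForm k z) 8 = 0 := by
  simp only [comp, Fin.isValue, Matrix.cons_val, rowForm_apply h]
  simp [eR, eI]

/-- The component a₁₁ equals r₀ + Im ∂k/∂y₁, whence the reality condition on the time derivative. -/
theorem comp_rowForm (h : AnalyticAt ℝ k z) {G : (Fin 4 → ℂ) →L[ℂ] ℂ}
    (hG : ∀ u, fderiv ℝ k z u = G (mixedCoord u)) {r : Fin 3 → ℝ}
    (hr : ∀ j, G (Pi.single j.castSucc 1) = r j) (h3 : (G (Pi.single 3 1)).im = 0) :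
    comp (rowForm k z) = ![r 0, r 1, r 2, 0, 0, 0, 0, 0, 0] := by
  have h0 : G (Pi.single 0 1) = r 0 := hr 0
  have h1 : G (Pi.single 1 1) = r 1 := hr 1
  have h2 : G (Pi.single 2 1) = r 2 := hr 2
  simp only [comp, rowForm_apply h, hG, clm_mixedCoord, h0, h1, h2]
  simp [eR, eI, h3]

/-! ### Second derivatives -/

theorem hessian_eq {φ : C3 → ℝ} (h : AnalyticAt ℝ φ z) (u v : C3) :
    hessian φ z u v = fderiv ℝ (fun y => fderiv ℝ φ y v) z u :=
  (congrArg (· u) ((ContinuousLinearMap.apply ℝ ℝ v).hasFDerivAt.comp z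
    h.fderiv.differentiableAt.hasFDerivAt).fderiv).symm

theorem fderiv_mul_linear {B : C3 → ℝ} (hB : DifferentiableAt ℝ B z) (l m : C3 →L[ℝ] ℝ) (v : C3) :
    fderiv ℝ (fun y => B y * (l y * m y)) z v
      = B z * (l z * m v + m z * l v) + (l z * m z) * fderiv ℝ B z v :=
  congrArg (· v) (hB.hasFDerivAt.mul (l.hasFDerivAt.mul m.hasFDerivAt)).fderiv

theorem analyticAt_mul_linear {B : C3 → ℝ} (hB : AnalyticAt ℝ B z) (l m : C3 →L[ℝ] ℝ) :
    AnalyticAt ℝ (fun y => B y * (l y * m y)) z :=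
  hB.mul ((l.analyticAt z).mul (m.analyticAt z))

/-- Where both linear factors vanish, only the terms that differentiate each of them once survive.
-/
theorem hessian_mul_linear {B : C3 → ℝ} (hB : AnalyticAt ℝ B z) {l m : C3 →L[ℝ] ℝ}
    (hl : l z = 0) (hm : m z = 0) (u v : C3) :
    hessian (fun y => B y * (l y * m y)) z u v = B z * (l u * m v + m u * l v) := by
  rw [hessian_eq (analyticAt_mul_linear hB l m)]
  have h1 : (fun y => fderiv ℝ (fun y => B y * (l y * m y)) y v) =ᶠ[𝓝 z]
      fun y => B y * (l y * m v + m y * l v) + (l y * m y) * fderiv ℝ B y v := by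
    filter_upwards [hB.eventually_analyticAt] with y hy
    exact fderiv_mul_linear hy.differentiableAt l m v
  have hC : HasFDerivAt (fun y => fderiv ℝ B y v) (fderiv ℝ (fun y => fderiv ℝ B y v) z) z :=
    ((ContinuousLinearMap.apply ℝ ℝ v).differentiableAt.comp z
      hB.fderiv.differentiableAt).hasFDerivAt
  have h2 := (hB.differentiableAt.hasFDerivAt.mul
    ((l.hasFDerivAt.mul_const (m v)).add (m.hasFDerivAt.mul_const (l v)))).add
    ((l.hasFDerivAt.mul m.hasFDerivAt).mul hC)
  rw [h1.fderiv_eq]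
  have h3 : fderiv ℝ (fun y => B y * (l y * m v + m y * l v) + (l y * m y) * fderiv ℝ B y v) z
    = _ := h2.fderiv
  rw [h3]
  simp [hl, hm]
  ring

theorem hessian_add {φ ψ : C3 → ℝ} (h : AnalyticAt ℝ φ z) (h' : AnalyticAt ℝ ψ z) (u v : C3) :
    hessian (fun y => φ y + ψ y) z u v = hessian φ z u v + hessian ψ z u v := by
  unfold hessian
  have h1 : fderiv ℝ (fun y => φ y + ψ y) =ᶠ[𝓝 z] fun y => fderiv ℝ φ y + fderiv ℝ ψ y := by
    filter_upwards [h.eventually_analyticAt, h'.eventually_analyticAt] with y hy hy'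
    exact fderiv_add hy.differentiableAt hy'.differentiableAt
  rw [h1.fderiv_eq]
  have h2 := fderiv_add h.fderiv.differentiableAt h'.fderiv.differentiableAt
  exact congrArg (fun L => L u v) h2

/-- The potential `2 (B₂₂ y₂² + 2 B₂₃ y₂ y₃ + B₃₃ y₃²)`. -/
noncomputable def gaugePotential (B : Fin 3 → Fin 3 → C3 → ℝ) (z : C3) : ℝ :=
  2 * B 1 1 z * (imL 1 z * imL 1 z) + 4 * B 1 2 z * (imL 1 z * imL 2 z)
    + 2 * B 2 2 z * (imL 2 z * imL 2 z)

theorem analyticAt_gaugePotential {B : Fin 3 → Fin 3 → C3 → ℝ}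
    (hB : ∀ i j, AnalyticAt ℝ (B i j) z) : AnalyticAt ℝ (gaugePotential B) z :=
  ((analyticAt_mul_linear (analyticAt_const.mul (hB 1 1)) _ _).add
    (analyticAt_mul_linear (analyticAt_const.mul (hB 1 2)) _ _)).add
    (analyticAt_mul_linear (analyticAt_const.mul (hB 2 2)) _ _)

theorem comp_ddc_gaugePotential {B : Fin 3 → Fin 3 → C3 → ℝ} (hB : ∀ i j, AnalyticAt ℝ (B i j) z)
    (h1 : z ∈ imZero 1) (h2 : z ∈ imZero 2) :
    comp (ddc (gaugePotential B) z) = ![0, 0, 0, B 1 1 z, B 1 2 z, B 2 2 z, 0, 0, 0] := by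
  have l1 : imL 1 z = 0 := h1
  have l2 : imL 2 z = 0 := h2
  have a1 := analyticAt_mul_linear ((analyticAt_const (v := (2 : ℝ))).mul (hB 1 1)) (imL 1) (imL 1)
  have a2 := analyticAt_mul_linear ((analyticAt_const (v := (4 : ℝ))).mul (hB 1 2)) (imL 1) (imL 2)
  have a3 := analyticAt_mul_linear ((analyticAt_const (v := (2 : ℝ))).mul (hB 2 2)) (imL 2) (imL 2)
  have e : ∀ u v, hessian (gaugePotential B) z u v
      = 2 * B 1 1 z * (imL 1 u * imL 1 v + imL 1 u * imL 1 v)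
        + 4 * B 1 2 z * (imL 1 u * imL 2 v + imL 2 u * imL 1 v)
        + 2 * B 2 2 z * (imL 2 u * imL 2 v + imL 2 u * imL 2 v) := by
    intro u v
    have e1 := hessian_mul_linear ((analyticAt_const (v := (2 : ℝ))).mul (hB 1 1)) l1 l1 u v
    have e2 := hessian_mul_linear ((analyticAt_const (v := (4 : ℝ))).mul (hB 1 2)) l1 l2 u v
    have e3 := hessian_mul_linear ((analyticAt_const (v := (2 : ℝ))).mul (hB 2 2)) l2 l2 u v
    have e4 := hessian_add a1 a2 u v
    have e5 := hessian_add (a1.add a2) a3 u v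
    rw [e1, e2] at e4
    refine e5.trans ?_
    rw [e3]
    exact congrArg (· + _) e4
  rw [comp_ddc (analyticAt_gaugePotential hB)]
  simp only [e]
  funext i
  fin_cases i <;> simp [hess, realBasis, imL_eR, imL_eI] <;> ring

/-! ### Real coordinates -/

/-- The real coordinates `(x₁, x₂, x₃, y₁, y₂, y₃)`. -/
noncomputable def realCoord : C3 →L[ℝ] (Fin 6 → ℝ) :=
  ContinuousLinearMap.pi ![reL 0, reL 1, reL 2, imL 0, imL 1, imL 2]

/-- The inverse of `realCoord`. -/
noncomputable def ofRealCoord : (Fin 6 → ℝ) →L[ℝ] C3 :=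
  ∑ i, (ContinuousLinearMap.proj (R := ℝ) (φ := fun _ : Fin 6 => ℝ) i).smulRight (realBasis i)

theorem realCoord_realBasis (i : Fin 6) : realCoord (realBasis i) = Pi.single i 1 := by
  funext j
  fin_cases i <;> fin_cases j <;>
    simp [realCoord, realBasis, reL_eR, reL_eI, imL_eR, imL_eI]

theorem ofRealCoord_realCoord (z : C3) : ofRealCoord (realCoord z) = z := by
  have h := eq_sum_eR_eI z
  rw [Fin.sum_univ_three] at h
  conv_rhs => rw [h]
  simp [ofRealCoord, Fin.sum_univ_six, realCoord, realBasis, reL_apply, imL_apply]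
  abel

theorem norm_realCoord_le (z : C3) : ‖realCoord z‖ ≤ ‖z‖ := by
  rw [pi_norm_le_iff_of_nonneg (norm_nonneg z)]
  intro i
  have h := norm_le_pi_norm z
  have hre : ∀ j, ‖(z j).re‖ ≤ ‖z‖ := fun j => (Complex.abs_re_le_norm _).trans (h j)
  have him : ∀ j, ‖(z j).im‖ ≤ ‖z‖ := fun j => (Complex.abs_im_le_norm _).trans (h j)
  fin_cases i
  exacts [hre 0, hre 1, hre 2, him 0, him 1, him 2]

theorem hessian_comp_realCoord {ψ : (Fin 6 → ℝ) → ℝ} {p z : C3}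
    (h : AnalyticAt ℝ ψ (realCoord (z - p))) (i j : Fin 6) :
    hessian (fun y => ψ (realCoord (y - p))) z (realBasis i) (realBasis j)
      = partial₂ ψ (realCoord (z - p)) i j := by
  have hL : ∀ y, HasFDerivAt (fun y => realCoord (y - p)) realCoord y := fun y =>
    realCoord.hasFDerivAt.comp y ((hasFDerivAt_id y).sub_const p)
  have ha : AnalyticAt ℝ (fun y => ψ (realCoord (y - p))) z :=
    AnalyticAt.comp (f := fun y => realCoord (y - p)) h
      (AnalyticAt.comp (f := fun y => y - p) (realCoord.analyticAt _)
        (analyticAt_id.sub analyticAt_const))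
  rw [hessian_eq ha]
  have h1 : (fun y => fderiv ℝ (fun y => ψ (realCoord (y - p))) y (realBasis j)) =ᶠ[𝓝 z]
      fun y => (fun x => fderiv ℝ ψ x (Pi.single j 1)) (realCoord (y - p)) := by
    filter_upwards [(hL z).continuousAt.eventually h.eventually_analyticAt] with y hy
    rw [← realCoord_realBasis j]
    exact congrArg (· (realBasis j)) (hy.differentiableAt.hasFDerivAt.comp y (hL y)).fderiv
  rw [h1.fderiv_eq]
  have h2 : DifferentiableAt ℝ (fun x => fderiv ℝ ψ x (Pi.single j 1)) (realCoord (z - p)) :=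
    DifferentiableAt.comp (g := ContinuousLinearMap.apply ℝ ℝ (Pi.single j (1 : ℝ) : Fin 6 → ℝ)) _
      (ContinuousLinearMap.differentiableAt _) h.fderiv.differentiableAt
  unfold partial₂
  rw [← realCoord_realBasis i]
  exact congrArg (· (realBasis i)) (h2.hasFDerivAt.comp z (hL z)).fderiv

end LocalForms

end SLag

/-! ### Linear algebra of metric components, positivity and Cauchy data. -/

open Topology Filter

namespace SLag

section LocalData

/-- The components of a Kähler form inducing the metric `G` on a Lagrangian slice. -/
def metricComp (G : Matrix (Fin 3) (Fin 3) ℝ) : Fin 9 → ℝ :=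
  ![G 0 0, G 0 1, G 0 2, G 1 1, G 1 2, G 2 2, 0, 0, 0]

theorem hermDet_metricComp {G : Matrix (Fin 3) (Fin 3) ℝ} (h : G.IsSymm) :
    hermDet (metricComp G) = G.det := by
  have h1 := h.apply 0 1
  have h2 := h.apply 0 2
  have h3 := h.apply 1 2
  rw [Matrix.det_fin_three, h1, h2, h3]
  simp [hermDet, metricComp]
  ring

theorem posDef_isSymm {G : Matrix (Fin 3) (Fin 3) ℝ} (h : G.PosDef) : G.IsSymm := by
  have := h.isHermitian
  rwa [Matrix.IsHermitian, Matrix.conjTranspose_eq_transpose_of_trivial] at this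

theorem posDef_sum_pos {G : Matrix (Fin 3) (Fin 3) ℝ} (h : G.PosDef) {x : R3} (hx : x ≠ 0) :
    0 < ∑ i, ∑ j, G i j * (x i * x j) := by
  have h1 := h.dotProduct_mulVec_pos hx
  simp only [dotProduct, Matrix.mulVec, star_trivial, Finset.mul_sum] at h1
  refine h1.trans_eq (Finset.sum_congr rfl fun i _ => Finset.sum_congr rfl fun j _ => ?_)
  ring

theorem hermMinor_metricComp_pos {G : Matrix (Fin 3) (Fin 3) ℝ} (h : G.PosDef) :
    0 < hermMinor (metricComp G) := by
  have h0 := posDef_sum_pos h (x := ![1, 0, 0]) (fun h => by simpa using congrFun h 0)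
  simp [Fin.sum_univ_three] at h0
  have h1 := posDef_sum_pos h (x := ![-G 0 1, G 0 0, 0])
    (fun h => h0.ne' (by simpa using congrFun h 1))
  have hs := (posDef_isSymm h).apply 0 1
  simp [Fin.sum_univ_three, hs] at h1
  simp only [hermMinor, metricComp, Matrix.cons_val]
  by_contra hneg
  nlinarith

theorem rePart_ne_zero_or {u : C3} (hu : u ≠ 0) :
    (fun j => (u j).re : R3) ≠ 0 ∨ (fun j => (u j).im : R3) ≠ 0 := by
  by_contra! h
  exact hu (funext fun j => Complex.ext (congrFun h.1 j) (congrFun h.2 j))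

/-- The Hermitian form in terms of components. -/
theorem hermForm_eq {η : C3 [⋀^Fin 2]→L[ℝ] ℝ} (h : IsType11 η) (u : C3) :
    η ![u, Complex.I • u] = ∑ j, ∑ k, (η ![eR j, eI k] * ((u j).re * (u k).re)
      + η ![eR j, eI k] * ((u j).im * (u k).im) - 2 * (η ![eR j, eR k] * ((u j).re * (u k).im))) := by
  have hu := eq_sum_eR_eI u
  rw [Fin.sum_univ_three] at hu
  have hs : ∀ (c : ℝ) (u : C3), Complex.I • (c • u) = c • (Complex.I • u) := fun c u =>
    smul_comm _ _ _
  conv_lhs => rw [hu]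
  simp only [smul_add, hs, I_smul_eR, I_smul_eI, twoForm_add_left, twoForm_add_right,
    twoForm_smul_left, twoForm_smul_right, twoForm_neg_right, h.eI_eI, h.eI_eR, twoForm_self,
    Fin.sum_univ_three]
  rw [twoForm_swap η (eR 1) (eR 0), twoForm_swap η (eR 2) (eR 0), twoForm_swap η (eR 2) (eR 1)]
  ring

/-- With no bⱼₖ part, the Hermitian form is the sum of the values of G on the real and on the
imaginary part of u. -/
theorem pos_of_comp_eq_metricComp {η : C3 [⋀^Fin 2]→L[ℝ] ℝ} (h : IsType11 η)
    {G : Matrix (Fin 3) (Fin 3) ℝ} (hG : G.PosDef) (hc : comp η = metricComp G) (u : C3)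
    (hu : u ≠ 0) : 0 < η ![u, Complex.I • u] := by
  have hc' := fun i => congrFun hc i
  have c0 := hc' 0; have c1 := hc' 1; have c2 := hc' 2; have c3 := hc' 3; have c4 := hc' 4
  have c5 := hc' 5; have c6 := hc' 6; have c7 := hc' 7; have c8 := hc' 8
  simp only [comp, metricComp, Fin.isValue, Matrix.cons_val] at c0 c1 c2 c3 c4 c5 c6 c7 c8
  have hs := posDef_isSymm hG
  have e : η ![u, Complex.I • u] = (∑ i, ∑ j, G i j * ((u i).re * (u j).re))
      + ∑ i, ∑ j, G i j * ((u i).im * (u j).im) := by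
    rw [hermForm_eq h]
    simp only [Fin.sum_univ_three, twoForm_self]
    rw [twoForm_swap η (eR 1) (eR 0), twoForm_swap η (eR 2) (eR 0), twoForm_swap η (eR 2) (eR 1),
      h.symm 1 0, h.symm 2 0, h.symm 2 1, c0, c1, c2, c3, c4, c5, c6, c7, c8, hs.apply 0 1,
      hs.apply 0 2, hs.apply 1 2]
    ring
  have hnn : ∀ x : R3, 0 ≤ ∑ i, ∑ j, G i j * (x i * x j) := fun x => by
    by_cases hx : x = 0
    · simp [hx]
    · exact (posDef_sum_pos hG hx).le
  rw [e]
  rcases rePart_ne_zero_or hu with h1 | h1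
  · exact add_pos_of_pos_of_nonneg (posDef_sum_pos hG h1) (hnn _)
  · exact add_pos_of_nonneg_of_pos (hnn _) (posDef_sum_pos hG h1)

/-- Positivity is an open condition. -/
theorem eventually_pos {η : C3 [⋀^Fin 2]→L[ℝ] ℝ}
    (h : ∀ u : C3, u ≠ 0 → 0 < η ![u, Complex.I • u]) :
    ∀ᶠ η' in 𝓝 η, ∀ u : C3, u ≠ 0 → 0 < η' ![u, Complex.I • u] := by
  have hcont : Continuous fun u : C3 => (![u, Complex.I • u] : Fin 2 → C3) :=
    continuous_pi fun i => by fin_cases i <;> simp <;> fun_prop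
  -- The minimum m over the unit sphere is positive, and perturbing the form by less than m changes
  -- its values on unit vectors by less than m.
  obtain ⟨u₀, hu₀, hmin⟩ := (isCompact_sphere (0 : C3) 1).exists_isMinOn
    (NormedSpace.sphere_nonempty.2 zero_le_one) (η.cont.comp hcont).continuousOn
  have hu0 : u₀ ≠ 0 := fun h => by simp [h] at hu₀
  set m := η ![u₀, Complex.I • u₀] with hm
  have hm0 : 0 < m := h u₀ hu0
  filter_upwards [Metric.ball_mem_nhds η hm0] with η' hη' u hu
  have hun : 0 < ‖u‖ := norm_pos_iff.2 hu
  set w := (‖u‖⁻¹ : ℝ) • u with hw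
  have hwn : ‖w‖ = 1 := by rw [hw, norm_smul, norm_inv, norm_norm, inv_mul_cancel₀ hun.ne']
  have h1 : m ≤ η ![w, Complex.I • w] := hmin (by simpa using hwn)
  have h2 : ‖(η' - η) ![w, Complex.I • w]‖ ≤ ‖η' - η‖ := by
    refine ((η' - η).le_opNorm _).trans ?_
    rw [Fin.prod_univ_two]
    simp [norm_smul, hwn]
  have h3 : ‖η' - η‖ < m := by rwa [mem_ball_iff_norm] at hη'
  have h4 : (η' - η) ![w, Complex.I • w] = η' ![w, Complex.I • w] - η ![w, Complex.I • w] := rfl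
  rw [h4, Real.norm_eq_abs] at h2
  have h5 : 0 < η' ![w, Complex.I • w] := by
    have := (abs_le.1 h2).1
    linarith
  have h6 : Complex.I • w = (‖u‖⁻¹ : ℝ) • (Complex.I • u) := smul_comm _ _ _
  rw [h6, hw, twoForm_smul_left, twoForm_smul_right, ← mul_assoc] at h5
  exact pos_of_mul_pos_right h5 (by positivity)

/-- Zero Cauchy data make the whole gradient vanish on the hyperplane; differentiating it
tangentially leaves only the pure normal second derivative free. -/
theorem partial₂_eq_zero_of_hyperplane {ψ : (Fin 6 → ℝ) → ℝ} {ρ : ℝ}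
    (hψ : AnalyticOnNhd ℝ ψ (Metric.ball 0 ρ))
    (h0 : ∀ x ∈ Metric.ball (0 : Fin 6 → ℝ) ρ, x 5 = 0 →
      ψ x = 0 ∧ fderiv ℝ ψ x (Pi.single 5 1) = 0)
    {x : Fin 6 → ℝ} (hx : x ∈ Metric.ball 0 ρ) (hx5 : x 5 = 0) (i j : Fin 6)
    (hij : ¬(i = 5 ∧ j = 5)) : partial₂ ψ x i j = 0 := by
  have tangent : ∀ g : (Fin 6 → ℝ) → ℝ, (∀ x ∈ Metric.ball (0 : Fin 6 → ℝ) ρ, x 5 = 0 → g x = 0) →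
      ∀ i ≠ 5, ∀ x ∈ Metric.ball (0 : Fin 6 → ℝ) ρ, x 5 = 0 → DifferentiableAt ℝ g x →
      fderiv ℝ g x (Pi.single i 1) = 0 := by
    intro g hg i hi x hx hx5 hd
    have h2 : HasDerivAt (fun s : ℝ => x + s • Pi.single i (1 : ℝ)) (Pi.single i 1) 0 := by
      simpa using ((hasDerivAt_id (0 : ℝ)).smul_const (Pi.single i (1 : ℝ))).const_add x
    have h3 := hd.hasFDerivAt.comp_hasDerivAt_of_eq (0 : ℝ) h2 (by simp)
    have h4 : g ∘ (fun s : ℝ => x + s • Pi.single i (1 : ℝ)) =ᶠ[𝓝 0] fun _ => 0 := by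
      have h5 : ∀ᶠ s : ℝ in 𝓝 0, x + s • Pi.single i (1 : ℝ) ∈ Metric.ball (0 : Fin 6 → ℝ) ρ :=
        h2.continuousAt.eventually (by
          simp only [zero_smul, add_zero]; exact Metric.isOpen_ball.mem_nhds hx)
      filter_upwards [h5] with s hs
      exact hg _ hs (by simp [hx5, hi])
    exact h3.unique ((hasDerivAt_const (0 : ℝ) (0 : ℝ)).congr_of_eventuallyEq h4)
  have hd1 : ∀ j, DifferentiableAt ℝ (fun y => fderiv ℝ ψ y (Pi.single j 1)) x := fun j =>
    DifferentiableAt.comp (g := ContinuousLinearMap.apply ℝ ℝ (Pi.single j (1 : ℝ) : Fin 6 → ℝ)) _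
      (ContinuousLinearMap.differentiableAt _) (hψ x hx).fderiv.differentiableAt
  have hall : ∀ j, ∀ x ∈ Metric.ball (0 : Fin 6 → ℝ) ρ, x 5 = 0 →
      fderiv ℝ ψ x (Pi.single j 1) = 0 := by
    intro j x hx hx5
    by_cases hj : j = 5
    · rw [hj]; exact (h0 x hx hx5).2
    · exact tangent ψ (fun x hx h => (h0 x hx h).1) j hj x hx hx5 (hψ x hx).differentiableAt
  have hi : ∀ i j, i ≠ 5 → partial₂ ψ x i j = 0 := fun i j hi =>
    tangent _ (hall j) i hi x hx hx5 (hd1 j)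
  by_cases h : i = 5
  · have hj : j ≠ 5 := fun hj => hij ⟨h, hj⟩
    have hsymm : partial₂ ψ x i j = partial₂ ψ x j i := by
      have h1 : IsSymmSndFDerivAt ℝ ψ x := by
        apply ContDiffAt.isSymmSndFDerivAt (n := 2) (hψ x hx).contDiffAt
        simp
      have h2 : ∀ i j, partial₂ ψ x i j
          = fderiv ℝ (fderiv ℝ ψ) x (Pi.single i 1) (Pi.single j 1) := fun i j =>
        congrArg (· (Pi.single i 1)) ((ContinuousLinearMap.apply ℝ ℝ
          (Pi.single j (1 : ℝ) : Fin 6 → ℝ)).hasFDerivAt.comp x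
          (hψ x hx).fderiv.differentiableAt.hasFDerivAt).fderiv
      rw [h2, h2]
      exact h1 _ _
    rw [hsymm]
    exact hi j i hj
  · exact hi i j h

theorem hess_partial₂_eq_zero {ψ : (Fin 6 → ℝ) → ℝ} {ρ : ℝ}
    (hψ : AnalyticOnNhd ℝ ψ (Metric.ball 0 ρ))
    (h0 : ∀ x ∈ Metric.ball (0 : Fin 6 → ℝ) ρ, x 5 = 0 →
      ψ x = 0 ∧ fderiv ℝ ψ x (Pi.single 5 1) = 0)
    {x : Fin 6 → ℝ} (hx : x ∈ Metric.ball 0 ρ) (hx5 : x 5 = 0) (i : Fin 9) (hi : i ≠ 5) :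
    hess (partial₂ ψ x) i = 0 := by
  have h := partial₂_eq_zero_of_hyperplane hψ h0 hx hx5
  unfold hess
  fin_cases i <;> simp [h] at hi ⊢

/-- A function is constant along segments in a direction in which its derivative vanishes. -/
theorem eq_of_fderiv_eq_zero {E : Type*} [NormedAddCommGroup E] [NormedSpace ℝ E] {S : Set E}
    (hS : IsOpen S) (hSc : Convex ℝ S) {g : E → ℝ} {e : E} (hd : ∀ x ∈ S, DifferentiableAt ℝ g x)
    (h0 : ∀ x ∈ S, fderiv ℝ g x e = 0) {x : E} {s : ℝ} (hx : x ∈ S) (hs : x + s • e ∈ S) :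
    g (x + s • e) = g x := by
  set J : Set ℝ := {s | x + s • e ∈ S} with hJ
  have hline : ∀ s : ℝ, HasDerivAt (fun s : ℝ => x + s • e) e s := fun s => by
    simpa using ((hasDerivAt_id s).smul_const e).const_add x
  have hcont : Continuous fun s : ℝ => x + s • e := by fun_prop
  have hJo : IsOpen J := hS.preimage hcont
  have hJc : Convex ℝ J := by
    intro a ha b hb α β hα hβ hαβ
    have := hSc ha hb hα hβ hαβ
    change x + (α • a + β • b) • e ∈ S
    convert this using 1
    have hx : x = α • x + β • x := by rw [← add_smul, hαβ, one_smul]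
    conv_lhs => rw [hx]
    simp only [smul_add, add_smul, smul_assoc]
    abel
  have hder : ∀ s ∈ J, HasDerivAt (fun s : ℝ => g (x + s • e)) 0 s := fun s hs => by
    have := (hd _ hs).hasFDerivAt.comp_hasDerivAt s (hline s)
    rwa [h0 _ hs] at this
  have := hJo.is_const_of_deriv_eq_zero hJc.isPreconnected
    (fun s hs => (hder s hs).differentiableAt.differentiableWithinAt)
    (fun s hs => (hder s hs).deriv) (x := s) (y := 0) hs (by simpa [hJ] using hx)
  simpa using this

end LocalData

end SLag

/-! ### Local data: the row potential and the holomorphic density. -/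

open Topology Filter

namespace SLag

section LocalExistence

/-- The real part of a point. -/
noncomputable def rePart : C3 →L[ℝ] R3 := ContinuousLinearMap.pi fun j => reL j

theorem rePart_apply (z : C3) (j : Fin 3) : rePart z j = (z j).re := rfl

/-- The points with real part in `U` and `y₁ ∈ T`. -/
def tube (U : Set R3) (T : Set ℝ) : Set C3 := {z | rePart z ∈ U ∧ imL 0 z ∈ T}

theorem isOpen_tube {U : Set R3} (hU : IsOpen U) {T : Set ℝ} (hT : IsOpen T) :
    IsOpen (tube U T) :=
  (hU.preimage rePart.continuous).inter (hT.preimage (imL 0).continuous)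

variable (A : ℝ → R3 → Matrix (Fin 3) (Fin 3) ℝ)

/-- The entries of the family of metrics, extended to be independent of `y₂, y₃`. -/
noncomputable def entry (i j : Fin 3) (z : C3) : ℝ := A (imL 0 z) (rePart z) i j

/-- The components along the slices. -/
noncomputable def sliceComp (z : C3) : Fin 9 → ℝ := metricComp (A (imL 0 z) (rePart z))

/-- The volume density along the slices. -/
noncomputable def sliceVol (z : C3) : ℝ := √(A (imL 0 z) (rePart z)).det

/-- The components of the gauge form. -/
noncomputable def gaugeComp (z : C3) : Fin 9 → ℝ := comp (ddc (gaugePotential (entry A)) z)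

variable {A} {U : Set R3} {T : Set ℝ}

theorem analyticAt_entry (hA : ∀ i j, AnalyticOnNhd ℝ (fun p : R3 × ℝ => A p.2 p.1 i j) (U ×ˢ T))
    {z : C3} (hz : z ∈ tube U T) (i j : Fin 3) : AnalyticAt ℝ (entry A i j) z :=
  AnalyticAt.comp (f := rePart.prod (imL 0)) (hA i j _ ⟨hz.1, hz.2⟩)
    (ContinuousLinearMap.analyticAt _ _)

/-- The square root of the positive analytic determinant is written as exp(½ log det). -/
theorem analyticAt_sqrt_det
    (hA : ∀ i j, AnalyticOnNhd ℝ (fun p : R3 × ℝ => A p.2 p.1 i j) (U ×ˢ T))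
    (hpos : ∀ t ∈ T, ∀ x ∈ U, (A t x).PosDef) {x : R3} {t : ℝ} (hx : x ∈ U) (ht : t ∈ T) :
    AnalyticAt ℝ (fun x => √(A t x).det) x := by
  have h1 : ∀ i j, AnalyticAt ℝ (fun x => A t x i j) x := fun i j =>
    AnalyticAt.comp (f := fun x : R3 => (x, t)) (hA i j _ ⟨hx, ht⟩)
      (analyticAt_id.prod analyticAt_const)
  have h2 : AnalyticAt ℝ (fun x => (A t x).det) x := by
    simp only [Matrix.det_fin_three]
    exact ((((((h1 0 0).mul (h1 1 1)).mul (h1 2 2)).sub (((h1 0 0).mul (h1 1 2)).mul (h1 2 1))).sub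
      (((h1 0 1).mul (h1 1 0)).mul (h1 2 2))).add (((h1 0 1).mul (h1 1 2)).mul (h1 2 0))).add
      (((h1 0 2).mul (h1 1 0)).mul (h1 2 1)) |>.sub (((h1 0 2).mul (h1 1 1)).mul (h1 2 0))
  have h3 : (A t x).det ≠ 0 := (hpos t ht x hx).det_pos.ne'
  have h4 := (AnalyticAt.comp (f := fun x => (A t x).det)
    (analyticAt_log (hpos t ht x hx).det_pos) h2).mul (analyticAt_const (v := (1 / 2 : ℝ))) |>.rexp
  refine h4.congr ?_
  filter_upwards [h2.continuousAt.eventually (isOpen_Ioi.mem_nhds (hpos t ht x hx).det_pos)] with y hy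
  have hy' : 0 < (A t y).det := hy
  rw [Real.sqrt_eq_rpow, Real.rpow_def_of_pos hy']
  rfl

/-- The real coordinates `(x₁, x₂, x₃, t)`. -/
noncomputable def spaceTime : C3 →L[ℝ] (Fin 4 → ℝ) :=
  ContinuousLinearMap.pi ![reL 0, reL 1, reL 2, imL 0]

theorem norm_spaceTime_le (z : C3) : ‖spaceTime z‖ ≤ ‖z‖ := by
  rw [pi_norm_le_iff_of_nonneg (norm_nonneg z)]
  intro i
  have h := norm_le_pi_norm z
  have hre : ∀ j, ‖(z j).re‖ ≤ ‖z‖ := fun j => (Complex.abs_re_le_norm _).trans (h j)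
  have him : ∀ j, ‖(z j).im‖ ≤ ‖z‖ := fun j => (Complex.abs_im_le_norm _).trans (h j)
  fin_cases i
  exacts [hre 0, hre 1, hre 2, him 0]

theorem norm_mixedCoord_le (z : C3) : ‖mixedCoord z‖ ≤ ‖z‖ := by
  rw [pi_norm_le_iff_of_nonneg (norm_nonneg z)]
  intro i
  have h := norm_le_pi_norm z
  rw [mixedCoord_apply]
  fin_cases i
  · simpa using (Complex.abs_re_le_norm _).trans (h 0)
  · exact h 1
  · exact h 2
  · simpa using (Complex.abs_im_le_norm _).trans (h 0)

theorem mixedCoord_of_mem {z : C3} (h1 : z ∈ imZero 1) (h2 : z ∈ imZero 2) :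
    mixedCoord z = fun i => (spaceTime z i : ℂ) := by
  have e1 : (z 1).im = 0 := h1
  have e2 : (z 2).im = 0 := h2
  rw [mixedCoord_apply]
  funext i
  fin_cases i
  · rfl
  · exact Complex.ext rfl (by simpa using e1)
  · exact Complex.ext rfl (by simpa using e2)
  · rfl

theorem sub_mem_imZero {j : Fin 3} {z p : C3} (hz : z ∈ imZero j) (hp : p ∈ imZero j) :
    z - p ∈ imZero j := by
  have e1 : (z j).im = 0 := hz
  have e2 : (p j).im = 0 := hp
  simp [imZero, e1, e2]

/-- The space part of a point of space-time. -/
noncomputable def spacePart : (Fin 4 → ℝ) →L[ℝ] R3 :=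
  ContinuousLinearMap.pi fun j => ContinuousLinearMap.proj (R := ℝ) (φ := fun _ : Fin 4 => ℝ)
    j.castSucc

theorem spacePart_spaceTime (z : C3) : spacePart (spaceTime z) = rePart z := by
  funext j
  fin_cases j <;> rfl

/-- The holomorphic potential of the first row of the metric. -/
theorem exists_row_potential (hU : IsOpen U) (hT : IsOpen T)
    (hA : ∀ i j, AnalyticOnNhd ℝ (fun p : R3 × ℝ => A p.2 p.1 i j) (U ×ˢ T))
    (hcl : ∀ t ∈ T, ∀ x ∈ U, ∀ j k : Fin 3, fderiv ℝ (fun x => A t x 0 k) x (Pi.single j 1)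
      = fderiv ℝ (fun x => A t x 0 j) x (Pi.single k 1))
    {p : C3} (hp : p ∈ tube U T) (hp1 : p ∈ imZero 1) (hp2 : p ∈ imZero 2) :
    ∃ ρ > 0, ∃ k : C3 → ℂ, ∀ z, ‖z - p‖ < ρ → AnalyticAt ℝ k z ∧
      ∃ G : (Fin 4 → ℂ) →L[ℂ] ℂ, (∀ u, fderiv ℝ k z u = G (mixedCoord u)) ∧
        (z ∈ imZero 1 → z ∈ imZero 2 →
          (∀ j : Fin 3, G (Pi.single j.castSucc 1) = entry A 0 j z) ∧
          (G (Pi.single 3 1)).im = 0) := by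
  set a : Fin 3 → (Fin 4 → ℝ) → ℝ := fun k w => A (w 3) (spacePart w) 0 k with ha
  set q := spaceTime p with hq
  have hqU : spacePart q ∈ U := by rw [hq, spacePart_spaceTime]; exact hp.1
  have hqT : q 3 ∈ T := hp.2
  have han : ∀ w : Fin 4 → ℝ, spacePart w ∈ U → w 3 ∈ T → ∀ k, AnalyticAt ℝ (a k) w := by
    intro w hw1 hw2 k
    exact AnalyticAt.comp (f := spacePart.prod
      (ContinuousLinearMap.proj (R := ℝ) (φ := fun _ : Fin 4 => ℝ) 3)) (hA 0 k _ ⟨hw1, hw2⟩)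
      (ContinuousLinearMap.analyticAt _ _)
  have hev : ∀ᶠ w in 𝓝 q, spacePart w ∈ U ∧ w 3 ∈ T :=
    (spacePart.continuous.continuousAt.eventually (hU.mem_nhds hqU)).and
      ((continuous_apply (3 : Fin 4)).continuousAt.eventually (hT.mem_nhds hqT))
  obtain ⟨ρ, hρ, H, hH, hHw⟩ := exists_holomorphic_potential (han q hqU hqT) fun j k => by
    filter_upwards [hev] with w hw
    set ι : R3 →L[ℝ] (Fin 4 → ℝ) := ContinuousLinearMap.pi
      ![ContinuousLinearMap.proj (R := ℝ) (φ := fun _ : Fin 3 => ℝ) 0,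
        ContinuousLinearMap.proj (R := ℝ) (φ := fun _ : Fin 3 => ℝ) 1,
        ContinuousLinearMap.proj (R := ℝ) (φ := fun _ : Fin 3 => ℝ) 2, 0] with hι
    have hιs : ∀ j : Fin 3, ι (Pi.single j 1) = Pi.single j.castSucc 1 := by
      intro j
      funext i
      fin_cases j <;> fin_cases i <;> simp [hι]
    have hιw : ι (spacePart w) + Pi.single 3 (w 3) = w := by
      funext i
      fin_cases i <;> simp [hι, spacePart]
    have hsp : ∀ x, spacePart (ι x + Pi.single 3 (w 3)) = x := by
      intro x
      funext i
      fin_cases i <;> simp [hι, spacePart]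
    have h3 : ∀ x, (ι x + Pi.single 3 (w 3) : Fin 4 → ℝ) 3 = w 3 := by
      intro x
      simp [hι]
    have e : ∀ j k : Fin 3, fderiv ℝ (a k) w (Pi.single j.castSucc 1)
        = fderiv ℝ (fun x => A (w 3) x 0 k) (spacePart w) (Pi.single j 1) := by
      intro j k
      have h4 : (fun x => A (w 3) x 0 k) = fun x => a k (ι x + Pi.single 3 (w 3)) := by
        funext x
        simp only [ha, hsp, h3]
      have h5 : HasFDerivAt (a k) (fderiv ℝ (a k) w) (ι (spacePart w) + Pi.single 3 (w 3)) := by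
        rw [hιw]
        exact (han w hw.1 hw.2 k).differentiableAt.hasFDerivAt
      have h6 := h5.comp (spacePart w) (ι.hasFDerivAt.add_const (Pi.single 3 (w 3)))
      rw [h4, ← hιs j]
      exact (congrArg (· (Pi.single j 1)) h6.fderiv).symm
    rw [e, e]
    exact hcl _ hw.2 _ hw.1 j k
  refine ⟨ρ, hρ, fun z => H (mixedCoord (z - p)), fun z hz => ?_⟩
  have hm : HasFDerivAt (fun z => mixedCoord (z - p)) mixedCoord z :=
    mixedCoord.hasFDerivAt.comp z ((hasFDerivAt_id z).sub_const p)
  have hHz : AnalyticAt ℂ H (mixedCoord (z - p)) :=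
    hH _ (by simpa using (norm_mixedCoord_le _).trans_lt hz)
  refine ⟨AnalyticAt.comp (g := H) (f := fun z => mixedCoord (z - p)) hHz.restrictScalars
    (AnalyticAt.comp (f := fun z => z - p) (mixedCoord.analyticAt _)
      (analyticAt_id.sub analyticAt_const)), fderiv ℂ H (mixedCoord (z - p)), fun u => ?_,
    fun h1 h2 => ?_⟩
  · exact congrArg (· u)
      ((hHz.differentiableAt.hasFDerivAt.restrictScalars ℝ).comp z hm).fderiv
  · rw [mixedCoord_of_mem (sub_mem_imZero h1 hp1) (sub_mem_imZero h2 hp2)]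
    obtain ⟨e1, e2⟩ := hHw _ ((norm_spaceTime_le _).trans_lt hz)
    refine ⟨fun j => ?_, e2⟩
    rw [e1 j]
    have hqz : q + spaceTime (z - p) = spaceTime z := by rw [hq, map_sub]; abel
    rw [hqz, ha]
    simp only [spacePart_spaceTime]
    rfl

/-- The holomorphic volume density. -/
theorem exists_holomorphic_density (hU : IsOpen U) (hT : IsOpen T)
    (hA : ∀ i j, AnalyticOnNhd ℝ (fun p : R3 × ℝ => A p.2 p.1 i j) (U ×ˢ T))
    (hpos : ∀ t ∈ T, ∀ x ∈ U, (A t x).PosDef)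
    (hdet : ∀ x ∈ U, ∀ s ∈ T, ∀ t ∈ T, (A s x).det = (A t x).det)
    (hdet' : ∀ t ∈ T, ∀ x ∈ U, fderiv ℝ (fun x => √(A t x).det) x (Pi.single 0 1) = 0)
    {p : C3} (hp : p ∈ tube U T) :
    ∃ ρ > 0, ∃ f : C3 → ℂ, ∀ z, ‖z - p‖ < ρ → AnalyticAt ℂ f z ∧ (z ∈ imZero 1 → z ∈ imZero 2 →
      p ∈ imZero 1 → p ∈ imZero 2 → f z = sliceVol A z) := by
  set t₀ := imL 0 p with ht₀
  obtain ⟨ρ, hρ, G, hG, hGw⟩ :=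
    exists_holomorphic_extension (analyticAt_sqrt_det hA hpos hp.1 hp.2)
  obtain ⟨r, hr, hrU⟩ := Metric.isOpen_iff.1 (isOpen_tube hU hT) p hp
  -- The density depends neither on x₁ nor on t, so the extension is taken with z₁ frozen at its
  -- value at p.
  set L : C3 →L[ℂ] C3 := ContinuousLinearMap.pi ![0,
    ContinuousLinearMap.proj (R := ℂ) (φ := fun _ : Fin 3 => ℂ) 1,
    ContinuousLinearMap.proj (R := ℂ) (φ := fun _ : Fin 3 => ℂ) 2] with hL
  have hLn : ∀ z, ‖L z‖ ≤ ‖z‖ := by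
    intro z
    rw [pi_norm_le_iff_of_nonneg (norm_nonneg z)]
    intro i
    fin_cases i
    · simp [hL]
    · exact norm_le_pi_norm z 1
    · exact norm_le_pi_norm z 2
  refine ⟨min ρ r, lt_min hρ hr, fun z => G (L (z - p)), fun z hz => ⟨?_, fun h1 h2 p1 p2 => ?_⟩⟩
  · exact AnalyticAt.comp (g := G) (f := fun z => L (z - p))
      (hG _ (by simpa using (hLn _).trans_lt (hz.trans_le (min_le_left _ _))))
      (AnalyticAt.comp (f := fun z => z - p) (L.analyticAt _)
        (analyticAt_id.sub analyticAt_const))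
  · have hzr : z ∈ Metric.ball p r := mem_ball_iff_norm.2 (hz.trans_le (min_le_right _ _))
    -- Translation by s along x₁ moves the real part onto that of p; the density does not change
    -- along it, and the endpoint stays in the sup-norm ball.
    set s : ℝ := (p 0).re - (z 0).re with hs
    have e1 : (z 1).im = 0 := h1
    have e2 : (z 2).im = 0 := h2
    have e1' : (p 1).im = 0 := p1
    have e2' : (p 2).im = 0 := p2
    have hw : L (z - p) = fun i => (((rePart (z - p) + s • Pi.single 0 1 : R3) i : ℝ) : ℂ) := by
      funext i
      fin_cases i
      · simp [hL, hs, rePart_apply]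
      · exact Complex.ext (by simp [hL, rePart_apply]) (by simp [hL, e1, e1'])
      · exact Complex.ext (by simp [hL, rePart_apply]) (by simp [hL, e2, e2'])
    have hwn : ‖rePart (z - p) + s • Pi.single 0 1‖ < ρ := by
      have h3 : ‖L (z - p)‖ < ρ := (hLn _).trans_lt (hz.trans_le (min_le_left _ _))
      rw [hw] at h3
      rw [pi_norm_lt_iff hρ] at h3 ⊢
      intro i
      exact (Complex.norm_real _).symm.trans_lt (h3 i)
    simp only
    rw [hw, hGw _ hwn]
    congr 1
    have h4 : rePart p + (rePart (z - p) + s • Pi.single 0 1)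
        = rePart (z + s • eR 0) := by
      funext i
      fin_cases i <;> (simp [rePart_apply, eR]; try ring)
    have hzs : z + s • eR 0 ∈ Metric.ball p r := by
      rw [mem_ball_iff_norm, pi_norm_lt_iff hr]
      rw [mem_ball_iff_norm, pi_norm_lt_iff hr] at hzr
      intro i
      fin_cases i
      · have h5 : (z + s • eR 0 - p) 0 = (((z - p) 0).im : ℂ) * Complex.I := by
          apply Complex.ext <;> simp [eR, hs]
        change ‖(z + s • eR 0 - p) 0‖ < r
        rw [h5]
        refine lt_of_le_of_lt ?_ (hzr 0)
        rw [norm_mul, Complex.norm_I, mul_one, Complex.norm_real]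
        exact Complex.abs_im_le_norm ((z - p) 0)
      · simpa [eR] using hzr 1
      · simpa [eR] using hzr 2
    have h6 := eq_of_fderiv_eq_zero (g := fun z => √(A t₀ (rePart z)).det) (e := eR 0)
      (Metric.isOpen_ball (x := p) (ε := r)) (convex_ball p r) (fun y hy => ?_) (fun y hy => ?_) hzr hzs
    · rw [h4]
      refine h6.trans ?_
      rw [sliceVol, hdet _ (hrU hzr).1 _ hp.2 _ (hrU hzr).2]
    · exact ((analyticAt_sqrt_det hA hpos (hrU hy).1 hp.2).differentiableAt).comp y
        rePart.differentiableAt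
    · have h7 := ((analyticAt_sqrt_det hA hpos (hrU hy).1
        hp.2).differentiableAt.hasFDerivAt).comp y rePart.hasFDerivAt
      refine (congrArg (· (eR 0)) h7.fderiv).trans ?_
      have h8 : rePart (eR 0) = Pi.single 0 1 := by
        funext i
        fin_cases i <;> simp [rePart_apply, eR]
      change fderiv ℝ _ _ (rePart (eR 0)) = 0
      rw [h8]
      exact hdet' _ hp.2 _ (hrU hy).1

end LocalExistence

end SLag

/-! ### Local existence. -/

open Topology Filter

namespace SLag

section LocalExistence

variable {A : ℝ → R3 → Matrix (Fin 3) (Fin 3) ℝ} {U : Set R3} {T : Set ℝ}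

/-- The determinant is affine in the entry a₃₃, with slope the minor. -/
theorem eq_of_hermDet_eq {c c' : Fin 9 → ℝ} (h : ∀ i ≠ 5, c i = c' i) (hd : hermDet c = hermDet c')
    (hm : hermMinor c' ≠ 0) : c = c' := by
  have h5 : (c 5 - c' 5) * hermMinor c' = 0 := by
    have h0 := h 0 (by decide); have h1 := h 1 (by decide); have h2 := h 2 (by decide)
    have h3 := h 3 (by decide); have h4 := h 4 (by decide); have h6 := h 6 (by decide)
    have h7 := h 7 (by decide); have h8 := h 8 (by decide)
    unfold hermDet at hd
    unfold hermMinor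
    rw [h0, h1, h2, h3, h4, h6, h7, h8] at hd
    linear_combination hd
  funext i
  by_cases hi : i = 5
  · subst hi
    exact sub_eq_zero.1 ((mul_eq_zero.1 h5).resolve_right hm)
  · exact h i hi

theorem imZero_realCoord {z p : C3} (hz : z ∈ imZero 2) (hp : p ∈ imZero 2) :
    realCoord (z - p) 5 = 0 :=
  sub_mem_imZero hz hp

/-- Local existence for the Calabi-Yau equations. -/
theorem exists_isSolution (hU : IsOpen U) (hT : IsOpen T)
    (hA : ∀ i j, AnalyticOnNhd ℝ (fun p : R3 × ℝ => A p.2 p.1 i j) (U ×ˢ T))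
    (hpos : ∀ t ∈ T, ∀ x ∈ U, (A t x).PosDef)
    (hcl : ∀ t ∈ T, ∀ x ∈ U, ∀ j k : Fin 3, fderiv ℝ (fun x => A t x 0 k) x (Pi.single j 1)
      = fderiv ℝ (fun x => A t x 0 j) x (Pi.single k 1))
    (hdet : ∀ x ∈ U, ∀ s ∈ T, ∀ t ∈ T, (A s x).det = (A t x).det)
    (hdet' : ∀ t ∈ T, ∀ x ∈ U, fderiv ℝ (fun x => √(A t x).det) x (Pi.single 0 1) = 0)
    {p : C3} (hp : p ∈ tube U T) (hp1 : p ∈ imZero 1) (hp2 : p ∈ imZero 2) :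
    ∃ r > 0, Metric.ball p r ⊆ tube U T ∧
      ∃ ω f, IsSolution (Metric.ball p r) (sliceComp A) (gaugeComp A) (sliceVol A) ω f := by
  obtain ⟨ρ₁, hρ₁, k, hk⟩ := exists_row_potential hU hT hA hcl hp hp1 hp2
  obtain ⟨ρ₂, hρ₂, f, hf⟩ := exists_holomorphic_density hU hT hA hpos hdet hdet' hp
  obtain ⟨ρ₃, hρ₃, hρ₃U⟩ := Metric.isOpen_iff.1 (isOpen_tube hU hT) p hp
  set φ := gaugePotential (entry A) with hφ
  have hB : ∀ z ∈ tube U T, ∀ i j, AnalyticAt ℝ (entry A i j) z := fun z hz i j =>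
    analyticAt_entry hA hz i j
  have hφan : ∀ z ∈ tube U T, AnalyticAt ℝ φ z := fun z hz => analyticAt_gaugePotential (hB z hz)
  -- The background form: the first summand supplies the first row, the second the remaining block,
  -- so that its components along {y₂ = y₃ = 0} are those of the metrics.
  set η : C3 → C3 [⋀^Fin 2]→L[ℝ] ℝ := fun z => rowForm k z + ddc φ z with hη
  have hηan : ∀ z, ‖z - p‖ < ρ₁ → z ∈ tube U T → AnalyticAt ℝ η z := fun z h1 h2 =>
    (analyticAt_rowForm (hk z h1).1).add (analyticAt_ddc (hφan z h2))
  have hηslice : ∀ z, ‖z - p‖ < ρ₁ → z ∈ tube U T → z ∈ imZero 1 → z ∈ imZero 2 →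
      comp (η z) = sliceComp A z := by
    intro z hz hzU h1 h2
    obtain ⟨hka, G, hG, hG'⟩ := hk z hz
    obtain ⟨hGr, hG3⟩ := hG' h1 h2
    have e1 := comp_rowForm hka hG hGr hG3
    have e2 := comp_ddc_gaugePotential (hB z hzU) h1 h2
    funext i
    rw [hη, comp_add, e1, hφ, e2]
    fin_cases i <;> simp [sliceComp, metricComp, entry]
  have hp0 : ‖p - p‖ < ρ₁ := by simpa using hρ₁
  have hp0' : ‖p - p‖ < ρ₂ := by simpa using hρ₂
  have hfp : f p = sliceVol A p := (hf p hp0').2 hp1 hp2 hp1 hp2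
  have hGp : (A (imL 0 p) (rePart p)).PosDef := hpos _ hp.2 _ hp.1
  have hvol : ∀ z ∈ tube U T, hermDet (sliceComp A z) = sliceVol A z ^ 2 := by
    intro z hz
    have hG := hpos _ hz.2 _ hz.1
    rw [sliceComp, hermDet_metricComp (posDef_isSymm hG), sliceVol, Real.sq_sqrt hG.det_pos.le]
  -- the equation in real coordinates
  set τ : (Fin 6 → ℝ) → C3 := fun x => p + ofRealCoord x with hτ
  have hτ0 : τ 0 = p := by simp [hτ]
  have hτan : ∀ x, AnalyticAt ℝ τ x := fun x =>
    analyticAt_const.add (ofRealCoord.analyticAt x)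
  have hτz : ∀ z, τ (realCoord (z - p)) = z := fun z => by
    simp [hτ, ofRealCoord_realCoord]
  -- At p the background already has the components of the metric, which gives both the
  -- noncharacteristic condition and the compatibility of the determinant with |f|².
  obtain ⟨ρ₄, hρ₄, ψ, hψ, hψ0, hψeq⟩ := exists_mongeAmpere_solution
    (fun i x => comp (η (τ x)) i) (fun x => ‖f (τ x)‖ ^ 2)
    (fun i => by
      obtain ⟨L, hL⟩ := exists_comp_clm i
      simp only [← hL]
      have h1 : AnalyticAt ℝ η (τ 0) := by rw [hτ0]; exact hηan p hp0 hp
      exact (L.analyticAt _).comp (h1.comp (hτan 0)))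
    (by
      have h1 : AnalyticAt ℝ f (τ 0) := by
        rw [hτ0]; exact (hf p hp0').1.restrictScalars
      have h2 : AnalyticAt ℝ (fun x => f (τ x)) 0 := h1.comp (hτan 0)
      have h3 : AnalyticAt ℝ (fun x => (f (τ x)).re) 0 := (Complex.reCLM.analyticAt _).comp h2
      have h4 : AnalyticAt ℝ (fun x => (f (τ x)).im) 0 := (Complex.imCLM.analyticAt _).comp h2
      refine ((h3.mul h3).add (h4.mul h4)).congr (Eventually.of_forall fun x => ?_)
      simp only [Pi.mul_apply, Pi.add_apply]
      rw [← Complex.normSq_eq_norm_sq, Complex.normSq_apply])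
    (by
      simp only [hτ0]
      rw [show (fun i => comp (η p) i) = sliceComp A p from hηslice p hp0 hp hp1 hp2]
      exact (hermMinor_metricComp_pos hGp).ne')
    (by
      simp only [hτ0]
      rw [show (fun i => comp (η p) i) = sliceComp A p from hηslice p hp0 hp hp1 hp2, hvol p hp,
        hfp, Complex.norm_real, Real.norm_eq_abs, sq_abs])
  set Ψ : C3 → ℝ := fun z => ψ (realCoord (z - p)) with hΨ
  have hxball : ∀ z, ‖z - p‖ < ρ₄ → realCoord (z - p) ∈ Metric.ball (0 : Fin 6 → ℝ) ρ₄ :=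
    fun z hz => by simpa using (norm_realCoord_le _).trans_lt hz
  have hΨan : ∀ z, ‖z - p‖ < ρ₄ → AnalyticAt ℝ Ψ z := fun z hz =>
    AnalyticAt.comp (f := fun y => realCoord (y - p)) (hψ _ (hxball z hz))
      (AnalyticAt.comp (f := fun y => y - p) (realCoord.analyticAt _)
        (analyticAt_id.sub analyticAt_const))
  have hΨcomp : ∀ z, ‖z - p‖ < ρ₄ →
      comp (ddc Ψ z) = hess (partial₂ ψ (realCoord (z - p))) := by
    intro z hz
    rw [comp_ddc (hΨan z hz)]
    congr 1
    funext i j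
    exact hessian_comp_realCoord (hψ _ (hxball z hz)) i j
  set ω : C3 → C3 [⋀^Fin 2]→L[ℝ] ℝ := fun z => η z + ddc Ψ z with hω
  have hωcomp : ∀ z, ‖z - p‖ < ρ₄ → ∀ i,
      comp (ω z) i = comp (η z) i + hess (partial₂ ψ (realCoord (z - p))) i := by
    intro z hz i
    rw [hω, comp_add, hΨcomp z hz]
  have hdetω : ∀ z, ‖z - p‖ < ρ₄ → hermDet (comp (ω z)) = ‖f z‖ ^ 2 := by
    intro z hz
    have h1 := hψeq _ (hxball z hz)
    simp only [hτz] at h1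
    rw [← h1]
    congr 1
    funext i
    exact hωcomp z hz i
  -- On {y₃ = 0} the correction dd^cψ can change only a₃₃; along the slices the determinant is
  -- already right, so a₃₃ is unchanged too.
  have hsliceω : ∀ z, ‖z - p‖ < min (min ρ₁ ρ₂) (min ρ₃ ρ₄) → z ∈ imZero 1 → z ∈ imZero 2 →
      comp (ω z) = sliceComp A z := by
    intro z hz h1 h2
    simp only [lt_min_iff] at hz
    have hzU : z ∈ tube U T := hρ₃U (mem_ball_iff_norm.2 hz.2.1)
    refine eq_of_hermDet_eq (fun i hi => ?_) ?_ (hermMinor_metricComp_pos (hpos _ hzU.2 _ hzU.1)).ne'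
    · rw [hωcomp z hz.2.2, hess_partial₂_eq_zero hψ hψ0 (hxball z hz.2.2)
        (imZero_realCoord h2 hp2) i hi, add_zero, hηslice z hz.1.1 hzU h1 h2]
    · rw [hdetω z hz.2.2, hvol z hzU, (hf z hz.1.2).2 h1 h2 hp1 hp2, Complex.norm_real,
        Real.norm_eq_abs, sq_abs]
  have hωan : ∀ z, ‖z - p‖ < min (min ρ₁ ρ₂) (min ρ₃ ρ₄) → AnalyticAt ℝ ω z := by
    intro z hz
    simp only [lt_min_iff] at hz
    exact (hηan z hz.1.1 (hρ₃U (mem_ball_iff_norm.2 hz.2.1))).add (analyticAt_ddc (hΨan z hz.2.2))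
  have h11 : ∀ z, ‖z - p‖ < min (min ρ₁ ρ₂) (min ρ₃ ρ₄) → IsType11 (ω z) := by
    intro z hz u v
    simp only [lt_min_iff] at hz
    obtain ⟨hka, G, hG, -⟩ := hk z hz.1.1
    have e1 := isType11_rowForm hka hG u v
    have e2 := isType11_ddc (hφan z (hρ₃U (mem_ball_iff_norm.2 hz.2.1))) u v
    have e3 := isType11_ddc (hΨan z hz.2.2) u v
    change rowForm k z _ + ddc φ z _ + ddc Ψ z _ = rowForm k z _ + ddc φ z _ + ddc Ψ z _
    rw [e1, e2, e3]
  set ρ := min (min ρ₁ ρ₂) (min ρ₃ ρ₄) with hρ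
  have hρpos : 0 < ρ := lt_min (lt_min hρ₁ hρ₂) (lt_min hρ₃ hρ₄)
  have hpρ : ‖p - p‖ < ρ := by simpa using hρpos
  have hposp : ∀ u : C3, u ≠ 0 → 0 < ω p ![u, Complex.I • u] :=
    pos_of_comp_eq_metricComp (h11 p hpρ) hGp (hsliceω p hpρ hp1 hp2)
  have hfp0 : f p ≠ 0 := by
    rw [hfp, Complex.ofReal_ne_zero]
    exact (Real.sqrt_pos.2 hGp.det_pos).ne'
  -- Positivity of the form and nonvanishing of the density hold at p and persist on a smaller ball.
  have hev := ((hωan p hpρ).continuousAt.eventually (eventually_pos hposp)).and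
    ((hf p hp0').1.continuousAt.eventually_ne hfp0)
  obtain ⟨ε, hε, hεp⟩ := Metric.eventually_nhds_iff_ball.1 hev
  have hball : ∀ z ∈ Metric.ball p (min ρ ε), ‖z - p‖ < ρ := fun z hz =>
    (mem_ball_iff_norm.1 hz).trans_le (min_le_left _ _)
  have hball' : ∀ z ∈ Metric.ball p (min ρ ε), (‖z - p‖ < ρ₁ ∧ ‖z - p‖ < ρ₂) ∧
      ‖z - p‖ < ρ₃ ∧ ‖z - p‖ < ρ₄ := fun z hz => by
    have := hball z hz
    simpa only [hρ, lt_min_iff] using this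
  have htube : ∀ z ∈ Metric.ball p (min ρ ε), z ∈ tube U T := fun z hz =>
    hρ₃U (mem_ball_iff_norm.2 (hball' z hz).2.1)
  refine ⟨min ρ ε, lt_min hρpos hε, htube, ω, f, ?_⟩
  exact
    { analytic := fun z hz => hωan z (hball z hz)
      closed := fun z hz => by
        have h1 := (hk z (hball' z hz).1.1).1
        have h2 := hφan z (htube z hz)
        have h3 := hΨan z (hball' z hz).2.2
        have e : ω = (rowForm k + ddc φ) + ddc Ψ := rfl
        rw [e, extDeriv_add ((analyticAt_rowForm h1).add (analyticAt_ddc h2)).differentiableAt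
          (analyticAt_ddc h3).differentiableAt, extDeriv_add (analyticAt_rowForm h1).differentiableAt
          (analyticAt_ddc h2).differentiableAt, extDeriv_rowForm h1, extDeriv_ddc h2,
          extDeriv_ddc h3, add_zero, add_zero]
      type11 := fun z hz => h11 z (hball z hz)
      pos := fun z hz => (hεp z (Metric.ball_subset_ball (min_le_right _ _) hz)).1
      holomorphic := fun z hz => (hf z (hball' z hz).1.2).1
      ne_zero := fun z hz => (hεp z (Metric.ball_subset_ball (min_le_right _ _) hz)).2
      det_eq := fun z hz => hdetω z (hball' z hz).2.2
      eq_slice := fun z hz => hsliceω z (hball z hz)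
      eq_slice_holomorphic := fun z hz h1 h2 => (hf z (hball' z hz).1.2).2 h1 h2 hp1 hp2
      gauge := fun z hz h2 => by
        obtain ⟨e3, e4, e8⟩ := comp_rowForm_gauge (hk z (hball' z hz).1.1).1
        have hz4 := (hball' z hz).2.2
        have hz0 := fun i hi => hess_partial₂_eq_zero hψ hψ0 (hxball z hz4)
          (imZero_realCoord h2 hp2) i hi
        have e : ∀ i ≠ 5, comp (ω z) i = comp (rowForm k z) i + gaugeComp A z i := fun i hi => by
          rw [hωcomp z hz4, hz0 i hi, add_zero, hη, comp_add]
          rfl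
        refine ⟨?_, ?_, ?_⟩
        · rw [e 3 (by decide), e3, zero_add]
        · rw [e 4 (by decide), e4, zero_add]
        · rw [e 8 (by decide), e8, zero_add] }

end LocalExistence

end SLag

/-! ### Gluing local solutions. -/

open Topology Filter

namespace SLag

section Gluing

variable {A : ℝ → R3 → Matrix (Fin 3) (Fin 3) ℝ} {U : Set R3} {T : Set ℝ}

theorem IsSolution.congr {W : Set C3} (hW : IsOpen W) {a N : C3 → Fin 9 → ℝ} {v : C3 → ℝ}
    {ω ω' : C3 → C3 [⋀^Fin 2]→L[ℝ] ℝ} {f f' : C3 → ℂ} (h : IsSolution W a N v ω f)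
    (hω : Set.EqOn ω ω' W) (hf : Set.EqOn f f' W) : IsSolution W a N v ω' f' where
  analytic := h.analytic.congr hW hω
  closed z hz := by
    rw [← h.closed z hz]
    exact Filter.EventuallyEq.extDeriv_eq (hω.eventuallyEq_of_mem (hW.mem_nhds hz)).symm
  type11 z hz := hω hz ▸ h.type11 z hz
  pos z hz := hω hz ▸ h.pos z hz
  holomorphic := h.holomorphic.congr hW hf
  ne_zero z hz := hf hz ▸ h.ne_zero z hz
  det_eq z hz := hω hz ▸ hf hz ▸ h.det_eq z hz
  eq_slice z hz := hω hz ▸ h.eq_slice z hz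
  eq_slice_holomorphic z hz := hf hz ▸ h.eq_slice_holomorphic z hz
  gauge z hz := hω hz ▸ h.gauge z hz

theorem isSolution_iUnion {ι : Sort*} {W : ι → Set C3} {a N : C3 → Fin 9 → ℝ} {v : C3 → ℝ}
    {ω : C3 → C3 [⋀^Fin 2]→L[ℝ] ℝ} {f : C3 → ℂ} (h : ∀ i, IsSolution (W i) a N v ω f) :
    IsSolution (⋃ i, W i) a N v ω f where
  analytic z hz := by obtain ⟨i, hi⟩ := Set.mem_iUnion.1 hz; exact (h i).analytic z hi
  closed z hz := by obtain ⟨i, hi⟩ := Set.mem_iUnion.1 hz; exact (h i).closed z hi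
  type11 z hz := by obtain ⟨i, hi⟩ := Set.mem_iUnion.1 hz; exact (h i).type11 z hi
  pos z hz := by obtain ⟨i, hi⟩ := Set.mem_iUnion.1 hz; exact (h i).pos z hi
  holomorphic z hz := by obtain ⟨i, hi⟩ := Set.mem_iUnion.1 hz; exact (h i).holomorphic z hi
  ne_zero z hz := by obtain ⟨i, hi⟩ := Set.mem_iUnion.1 hz; exact (h i).ne_zero z hi
  det_eq z hz := by obtain ⟨i, hi⟩ := Set.mem_iUnion.1 hz; exact (h i).det_eq z hi
  eq_slice z hz := by obtain ⟨i, hi⟩ := Set.mem_iUnion.1 hz; exact (h i).eq_slice z hi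
  eq_slice_holomorphic z hz := by
    obtain ⟨i, hi⟩ := Set.mem_iUnion.1 hz; exact (h i).eq_slice_holomorphic z hi
  gauge z hz := by obtain ⟨i, hi⟩ := Set.mem_iUnion.1 hz; exact (h i).gauge z hi

/-- Balls for the sup norm are products of discs, and the j-th disc is centred on the real axis.
Hence overlaps of such balls satisfy the hypotheses of the uniqueness theorem. -/
theorem killIm_mem_ball {j : Fin 3} {p z : C3} {r : ℝ} (hp : p ∈ imZero j)
    (hz : z ∈ Metric.ball p r) : killIm j z ∈ Metric.ball p r := by
  have hr : 0 < r := dist_nonneg.trans_lt hz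
  have hp' : (p j).im = 0 := hp
  rw [mem_ball_iff_norm, pi_norm_lt_iff hr] at hz ⊢
  intro i
  by_cases hi : i = j
  · subst hi
    have e : (killIm i z - p) i = (((z - p) i).re : ℂ) := by
      apply Complex.ext
      · simp [killIm_apply, eI]
      · simp [killIm_apply, eI, hp']
    rw [e, Complex.norm_real]
    exact (Complex.abs_re_le_norm _).trans_lt (hz i)
  · change ‖killIm j z i - p i‖ < r
    rw [killIm_im_of_ne hi]
    exact hz i

/-- Local solutions along the slices glue to a solution on a neighbourhood. -/
theorem exists_global_solution
    (hloc : ∀ p ∈ tube U T, p ∈ imZero 1 → p ∈ imZero 2 →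
      ∃ r > 0, Metric.ball p r ⊆ tube U T ∧
        ∃ ω f, IsSolution (Metric.ball p r) (sliceComp A) (gaugeComp A) (sliceVol A) ω f) :
    ∃ V : Set C3, IsOpen V ∧ V ⊆ tube U T ∧
      (∀ p ∈ tube U T, p ∈ imZero 1 → p ∈ imZero 2 → p ∈ V) ∧
      ∃ ω f, IsSolution V (sliceComp A) (gaugeComp A) (sliceVol A) ω f := by
  classical
  have hloc' : ∀ p : {p // p ∈ tube U T ∧ p ∈ imZero 1 ∧ p ∈ imZero 2}, ∃ r > 0,
      Metric.ball p.1 r ⊆ tube U T ∧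
        ∃ ω f, IsSolution (Metric.ball p.1 r) (sliceComp A) (gaugeComp A) (sliceVol A) ω f :=
    fun p => hloc p.1 p.2.1 p.2.2.1 p.2.2.2
  choose r hr hrU ω f h using hloc'
  set V : Set C3 := ⋃ p, Metric.ball (p : {p // p ∈ tube U T ∧ p ∈ imZero 1 ∧ p ∈ imZero 2}).1 (r p)
    with hV
  have hunique : ∀ p q, ∀ z ∈ Metric.ball p.1 (r p) ∩ Metric.ball q.1 (r q),
      ω p z = ω q z ∧ f p z = f q z := by
    intro p q
    exact IsSolution.unique (Metric.isOpen_ball.inter Metric.isOpen_ball)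
      ((convex_ball _ _).inter (convex_ball _ _))
      (fun z hz => ⟨killIm_mem_ball p.2.2.2 hz.1, killIm_mem_ball q.2.2.2 hz.2⟩)
      (fun z hz => ⟨killIm_mem_ball p.2.2.1 hz.1, killIm_mem_ball q.2.2.1 hz.2⟩)
      ((h q).mono Set.inter_subset_right) ((h p).mono Set.inter_subset_left)
  -- Any choice of a ball containing z gives the same value, by uniqueness on overlaps; the value 0
  -- is taken only outside the union.
  set Ω' : C3 → C3 [⋀^Fin 2]→L[ℝ] ℝ := fun z =>
    if hz : ∃ p, z ∈ Metric.ball p.1 (r p) then ω hz.choose z else 0 with hΩ'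
  set f' : C3 → ℂ := fun z =>
    if hz : ∃ p, z ∈ Metric.ball p.1 (r p) then f hz.choose z else 0 with hf'
  have hsol : ∀ p, IsSolution (Metric.ball p.1 (r p)) (sliceComp A) (gaugeComp A) (sliceVol A)
      Ω' f' := by
    intro p
    refine (h p).congr Metric.isOpen_ball (fun z hz => ?_) (fun z hz => ?_)
    · have hz' : ∃ p, z ∈ Metric.ball p.1 (r p) := ⟨p, hz⟩
      simp only [hΩ', dif_pos hz']
      exact (hunique p _ z ⟨hz, hz'.choose_spec⟩).1
    · have hz' : ∃ p, z ∈ Metric.ball p.1 (r p) := ⟨p, hz⟩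
      simp only [hf', dif_pos hz']
      exact (hunique p _ z ⟨hz, hz'.choose_spec⟩).2
  exact ⟨V, isOpen_iUnion fun p => Metric.isOpen_ball, Set.iUnion_subset hrU,
    fun p h0 h1 h2 => Set.mem_iUnion.2 ⟨⟨p, h0, h1, h2⟩, Metric.mem_ball_self (hr _)⟩,
    Ω', f', isSolution_iUnion hsol⟩

end Gluing

end SLag

/-! ### Wedge products and the volume equation in components. -/

open ComplexConjugate

namespace SLag

section Wedge

/-- The form `α₁ ∧ ⋯ ∧ αₙ`, without factorials. -/
noncomputable def detForm {n : ℕ} (α : Fin n → C3 →ₗ[ℝ] ℂ) : C3 [⋀^Fin n]→ₗ[ℝ] ℂ :=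
  MultilinearMap.alternatization ((MultilinearMap.mkPiAlgebra ℝ (Fin n) ℂ).compLinearMap α)

theorem detForm_apply {n : ℕ} (α : Fin n → C3 →ₗ[ℝ] ℂ) (v : Fin n → C3) :
    detForm α v = (Matrix.of fun j i => α i (v j)).det := by
  rw [detForm, MultilinearMap.alternatization_apply, Matrix.det_apply]
  refine Finset.sum_congr rfl fun σ _ => ?_
  congr 1

theorem domDomCongr_alternatization {ι κ : Type*} [Fintype ι] [DecidableEq ι] [Fintype κ]
    [DecidableEq κ] (e : ι ≃ κ) (m : MultilinearMap ℝ (fun _ : ι => C3) ℂ) :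
    (MultilinearMap.alternatization m).domDomCongr e
      = MultilinearMap.alternatization (m.domDomCongr e) := by
  ext v
  rw [AlternatingMap.domDomCongr_apply, MultilinearMap.alternatization_apply,
    MultilinearMap.alternatization_apply]
  refine Fintype.sum_equiv (Equiv.permCongr e) _ _ fun σ => ?_
  rw [Equiv.Perm.sign_permCongr]
  congr 1
  simp [MultilinearMap.domDomCongr_apply, Equiv.permCongr_apply]

/-- The shuffle normalization makes the wedge of decomposable forms decomposable without factorials.
-/
theorem wedge_detForm {k l : ℕ} (α : Fin k → C3 →ₗ[ℝ] ℂ) (β : Fin l → C3 →ₗ[ℝ] ℂ) :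
    wedge (detForm α) (detForm β) = detForm (Fin.append α β) := by
  unfold wedge detForm
  rw [← MultilinearMap.domCoprod_alternization, ← LinearMap.compMultilinearMap_alternatization,
    domDomCongr_alternatization]
  congr 1
  ext v
  simp [MultilinearMap.domCoprod_apply, Fin.prod_univ_add]

theorem wedge_add_left {k l : ℕ} (a a' : C3 [⋀^Fin k]→ₗ[ℝ] ℂ) (b : C3 [⋀^Fin l]→ₗ[ℝ] ℂ) :
    wedge (a + a') b = wedge a b + wedge a' b := by
  unfold wedge
  rw [← AlternatingMap.domCoprod'_apply, TensorProduct.add_tmul, map_add]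
  ext v
  simp

theorem wedge_add_right {k l : ℕ} (a : C3 [⋀^Fin k]→ₗ[ℝ] ℂ) (b b' : C3 [⋀^Fin l]→ₗ[ℝ] ℂ) :
    wedge a (b + b') = wedge a b + wedge a b' := by
  unfold wedge
  rw [← AlternatingMap.domCoprod'_apply, TensorProduct.tmul_add, map_add]
  ext v
  simp

/-- The forms `dzⱼ`. -/
noncomputable def dz (j : Fin 3) : C3 →ₗ[ℝ] ℂ := LinearMap.proj (R := ℝ) (φ := fun _ => ℂ) j

/-- The forms `dz̄ⱼ`. -/
noncomputable def dzBar (j : Fin 3) : C3 →ₗ[ℝ] ℂ := (Complex.conjCLE : ℂ →ₗ[ℝ] ℂ) ∘ₗ dz j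

theorem dz_apply (j : Fin 3) (u : C3) : dz j u = u j := rfl

theorem dzBar_apply (j : Fin 3) (u : C3) : dzBar j u = conj (u j) := rfl

/-- The matrix of a two-form of type `(1, 1)`. -/
noncomputable def hermMatrix (η : C3 [⋀^Fin 2]→L[ℝ] ℝ) : Matrix (Fin 3) (Fin 3) ℂ :=
  Matrix.of fun j k => η ![eR j, eI k] - η ![eR j, eR k] * Complex.I

theorem det_hermMatrix {η : C3 [⋀^Fin 2]→L[ℝ] ℝ} (h : IsType11 η) :
    (hermMatrix η).det = (hermDet (comp η) : ℝ) := by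
  have hI := Complex.I_sq
  rw [Matrix.det_fin_three]
  simp only [hermMatrix, Matrix.of_apply, hermDet, comp, Fin.isValue, Matrix.cons_val, twoForm_self]
  rw [twoForm_swap η (eR 1) (eR 0), twoForm_swap η (eR 2) (eR 0), twoForm_swap η (eR 2) (eR 1),
    h.symm 1 0, h.symm 2 0, h.symm 2 1]
  apply Complex.ext <;> simp [pow_two] <;> ring

noncomputable def rowCovector (H : Matrix (Fin 3) (Fin 3) ℂ) (j : Fin 3) : C3 →ₗ[ℝ] ℂ :=
  ∑ k, H j k • dzBar k

/-- This is η = (i/2) ∑ hⱼₖ dzⱼ ∧ dz̄ₖ with h = a - ib, the inner sum over k being collected into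
one covector. -/
theorem complexify_eq_sum {η : C3 [⋀^Fin 2]→L[ℝ] ℝ} (h : IsType11 η) :
    complexify η
      = ∑ j, detForm ![(Complex.I / 2) • dz j, rowCovector (hermMatrix η) j] := by
  ext v
  obtain ⟨u, w, rfl⟩ : ∃ u w, v = ![u, w] := ⟨v 0, v 1, by ext i; fin_cases i <;> rfl⟩
  have hu := eq_sum_eR_eI u
  have hw := eq_sum_eR_eI w
  have e : complexify η ![u, w] = ((η ![u, w] : ℝ) : ℂ) := rfl
  rw [e, Fin.sum_univ_three, AlternatingMap.add_apply, AlternatingMap.add_apply]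
  simp only [detForm_apply, Matrix.det_fin_two, Matrix.of_apply, Matrix.cons_val_zero,
    Matrix.cons_val_one, LinearMap.smul_apply, dz_apply, rowCovector, LinearMap.sum_apply,
    dzBar_apply, smul_eq_mul, hermMatrix]
  rw [Fin.sum_univ_three] at hu hw
  conv_lhs => rw [hu, hw]
  simp only [twoForm_add_left, twoForm_add_right,
    twoForm_smul_left, twoForm_smul_right, h.eI_eI, h.eI_eR, twoForm_self, Fin.sum_univ_three]
  rw [twoForm_swap η (eR 1) (eR 0), twoForm_swap η (eR 2) (eR 0), twoForm_swap η (eR 2) (eR 1),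
    h.symm 1 0, h.symm 2 0, h.symm 2 1]
  apply Complex.ext <;> simp <;> ring

/-- The forms `dz₁, dz₂, dz₃, dz̄₁, dz̄₂, dz̄₃`. -/
noncomputable def coframe : Fin 6 → C3 →ₗ[ℝ] ℂ := ![dz 0, dz 1, dz 2, dzBar 0, dzBar 1, dzBar 2]

/-- Of the 27 terms of the cube, those with a repeated index vanish. Two-forms commute, so the other
six agree, and separating α₀ζ₀α₁ζ₁α₂ζ₂ into α's and ζ's is an odd permutation. -/
theorem sum_detForm_pairs (α ζ : Fin 3 → C3 →ₗ[ℝ] ℂ) :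
    wedge (wedge (∑ j, detForm ![α j, ζ j]) (∑ j, detForm ![α j, ζ j])) (∑ j, detForm ![α j, ζ j])
      = (-6 : ℂ) • detForm ![α 0, α 1, α 2, ζ 0, ζ 1, ζ 2] := by
  have hD : ∀ (j k l : Fin 3),
      wedge (wedge (detForm ![α j, ζ j]) (detForm ![α k, ζ k])) (detForm ![α l, ζ l])
        = if j = k ∨ j = l ∨ k = l then 0 else
          -detForm ![α 0, α 1, α 2, ζ 0, ζ 1, ζ 2] := by
    intro j k l
    have e : Fin.append (Fin.append ![α j, ζ j] ![α k, ζ k]) ![α l, ζ l]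
        = ![α j, ζ j, α k, ζ k, α l, ζ l] := by
      funext i
      fin_cases i <;> rfl
    rw [wedge_detForm, wedge_detForm, e]
    ext v
    rw [detForm_apply]
    split_ifs with hjkl
    · rcases hjkl with h | h | h
      · exact Matrix.det_zero_of_column_eq (i := 0) (j := 2) (by decide) fun i => by simp [h]
      · exact Matrix.det_zero_of_column_eq (i := 0) (j := 4) (by decide) fun i => by simp [h]
      · exact Matrix.det_zero_of_column_eq (i := 2) (j := 4) (by decide) fun i => by simp [h]
    · rw [AlternatingMap.neg_apply, detForm_apply]
      have key : ∀ σ : Equiv.Perm (Fin 6), Equiv.Perm.sign σ = -1 →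
          (∀ i, (![α j, ζ j, α k, ζ k, α l, ζ l] : Fin 6 → C3 →ₗ[ℝ] ℂ) i
            = (![α 0, α 1, α 2, ζ 0, ζ 1, ζ 2] : Fin 6 → C3 →ₗ[ℝ] ℂ) (σ i)) →
          (Matrix.of fun j' i => (![α j, ζ j, α k, ζ k, α l, ζ l] : Fin 6 → C3 →ₗ[ℝ] ℂ) i (v j')).det
            = -(Matrix.of fun j' i =>
              (![α 0, α 1, α 2, ζ 0, ζ 1, ζ 2] : Fin 6 → C3 →ₗ[ℝ] ℂ) i (v j')).det := by
        intro σ hσ h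
        have := Matrix.det_permute' σ (Matrix.of fun j' i =>
              (![α 0, α 1, α 2, ζ 0, ζ 1, ζ 2] : Fin 6 → C3 →ₗ[ℝ] ℂ) i (v j'))
        rw [hσ] at this
        simp only [Units.val_neg, Units.val_one, Int.cast_neg, Int.cast_one, neg_mul, one_mul]
          at this
        rw [← this]
        congr 1
        ext a b
        simp [h]
      fin_cases j <;> fin_cases k <;> fin_cases l <;>
        first | exact absurd (by decide) hjkl | skip
      · exact key ⟨![0, 3, 1, 4, 2, 5], ![0, 2, 4, 1, 3, 5], by decide, by decide⟩ (by decide)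
          fun i => by fin_cases i <;> rfl
      · exact key ⟨![0, 3, 2, 5, 1, 4], ![0, 4, 2, 1, 5, 3], by decide, by decide⟩ (by decide)
          fun i => by fin_cases i <;> rfl
      · exact key ⟨![1, 4, 0, 3, 2, 5], ![2, 0, 4, 3, 1, 5], by decide, by decide⟩ (by decide)
          fun i => by fin_cases i <;> rfl
      · exact key ⟨![1, 4, 2, 5, 0, 3], ![4, 0, 2, 5, 1, 3], by decide, by decide⟩ (by decide)
          fun i => by fin_cases i <;> rfl
      · exact key ⟨![2, 5, 0, 3, 1, 4], ![2, 4, 0, 3, 5, 1], by decide, by decide⟩ (by decide)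
          fun i => by fin_cases i <;> rfl
      · exact key ⟨![2, 5, 1, 4, 0, 3], ![4, 2, 0, 5, 3, 1], by decide, by decide⟩ (by decide)
          fun i => by fin_cases i <;> rfl
  simp only [Fin.sum_univ_three, wedge_add_left, wedge_add_right, hD]
  simp
  module

/-- The matrix of the forms `(i/2) dzⱼ, ζⱼ` in terms of the coframe. -/
noncomputable def coframeChange (s t : Matrix (Fin 3) (Fin 3) ℂ) : Matrix (Fin 6) (Fin 6) ℂ :=
  (Matrix.fromBlocks s 0 0 t).reindex finSumFinEquiv finSumFinEquiv

theorem det_coframeChange (s t : Matrix (Fin 3) (Fin 3) ℂ) :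
    (coframeChange s t).det = s.det * t.det := by
  rw [coframeChange, Matrix.det_reindex_self, Matrix.det_fromBlocks_zero₁₂]

theorem detForm_change {P : Matrix (Fin 6) (Fin 6) ℂ} {α β : Fin 6 → C3 →ₗ[ℝ] ℂ}
    (h : ∀ i u, α i u = ∑ k, β k u * P k i) : detForm α = P.det • detForm β := by
  ext v
  rw [AlternatingMap.smul_apply, detForm_apply, detForm_apply, smul_eq_mul, mul_comm,
    ← Matrix.det_mul]
  congr 1
  ext j i
  rw [Matrix.of_apply, h, Matrix.mul_apply]
  rfl

theorem coframe_append (a b : Fin 3 → C3 →ₗ[ℝ] ℂ) (s t : Matrix (Fin 3) (Fin 3) ℂ)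
    (ha : ∀ i u, a i u = ∑ k, dz k u * s k i) (hb : ∀ i u, b i u = ∑ k, dzBar k u * t k i) :
    detForm (Fin.append a b : Fin 6 → C3 →ₗ[ℝ] ℂ) = (s.det * t.det) • detForm coframe := by
  rw [← det_coframeChange]
  refine detForm_change fun i u => ?_
  have hc : coframe = (Fin.append dz dzBar : Fin 6 → C3 →ₗ[ℝ] ℂ) := by
    funext i
    fin_cases i <;> rfl
  rw [hc]
  refine Fin.addCases (m := 3) (n := 3) (fun i => ?_) (fun i => ?_) i
  · have := Fin.sum_univ_add (a := 3) (b := 3) (fun k : Fin (3 + 3) =>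
      (Fin.append dz dzBar : Fin (3 + 3) → C3 →ₗ[ℝ] ℂ) k u * coframeChange s t k (Fin.castAdd 3 i))
    refine Eq.trans ?_ this.symm
    simp only [Fin.append_left, Fin.append_right, coframeChange, Matrix.reindex_apply,
      Matrix.submatrix_apply, finSumFinEquiv_symm_apply_castAdd, finSumFinEquiv_symm_apply_natAdd,
      Matrix.fromBlocks_apply₁₁, Matrix.fromBlocks_apply₂₁, Matrix.zero_apply, mul_zero,
      Finset.sum_const_zero, add_zero, ha]
  · have := Fin.sum_univ_add (a := 3) (b := 3) (fun k : Fin (3 + 3) =>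
      (Fin.append dz dzBar : Fin (3 + 3) → C3 →ₗ[ℝ] ℂ) k u * coframeChange s t k (Fin.natAdd 3 i))
    refine Eq.trans ?_ this.symm
    simp only [Fin.append_left, Fin.append_right, coframeChange, Matrix.reindex_apply,
      Matrix.submatrix_apply, finSumFinEquiv_symm_apply_castAdd, finSumFinEquiv_symm_apply_natAdd,
      Matrix.fromBlocks_apply₁₂, Matrix.fromBlocks_apply₂₂, Matrix.zero_apply, mul_zero,
      Finset.sum_const_zero, zero_add, hb]

/-- The factor -6 from reordering and (i/2)³ from the three covectors combine to `normalizedConst`;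
the remaining factor is the determinant of the Hermitian matrix. -/
theorem wedge_cube {η : C3 [⋀^Fin 2]→L[ℝ] ℝ} (h : IsType11 η) :
    wedge (wedge (complexify η) (complexify η)) (complexify η)
      = (normalizedConst * (hermDet (comp η) : ℝ)) • detForm coframe := by
  rw [complexify_eq_sum h, sum_detForm_pairs (fun j => (Complex.I / 2) • dz j)]
  have e : (![(Complex.I / 2) • dz 0, (Complex.I / 2) • dz 1, (Complex.I / 2) • dz 2,
      rowCovector (hermMatrix η) 0, rowCovector (hermMatrix η) 1, rowCovector (hermMatrix η) 2] :
      Fin 6 → C3 →ₗ[ℝ] ℂ)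
      = (Fin.append (fun j => (Complex.I / 2) • dz j) (rowCovector (hermMatrix η)) :
        Fin 6 → C3 →ₗ[ℝ] ℂ) := by
    funext i
    fin_cases i <;> rfl
  rw [e, coframe_append _ _ ((Complex.I / 2) • 1) (hermMatrix η).transpose
    (fun i u => by
      simp [Matrix.one_apply]
      fin_cases i <;> simp [mul_comm])
    (fun i u => by
      rw [rowCovector, LinearMap.sum_apply]
      refine Finset.sum_congr rfl fun k _ => ?_
      rw [LinearMap.smul_apply, smul_eq_mul, mul_comm]
      rfl),
    Matrix.det_transpose, det_hermMatrix h, Matrix.det_smul, Matrix.det_one, smul_smul]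
  congr 1
  simp [normalizedConst, Nat.factorial]
  ring

theorem realify_eq (Ω : C3 [⋀^Fin 3]→L[ℂ] ℂ) : realify Ω = Ω eR • detForm dz := by
  ext v
  have hb : ∀ v : Fin 3 → C3, Ω v = (Matrix.of fun j i => v j i).det * Ω eR := by
    intro v
    have h1 := Ω.toAlternatingMap.eq_smul_basis_det (Pi.basisFun ℂ (Fin 3))
    have h2 : (Pi.basisFun ℂ (Fin 3) : Fin 3 → C3) = eR := by
      funext i
      simp [eR]
    have h3 := congrArg (fun L : C3 [⋀^Fin 3]→ₗ[ℂ] ℂ => L v) h1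
    simp only [AlternatingMap.smul_apply, smul_eq_mul, h2] at h3
    refine h3.trans ?_
    rw [mul_comm, Pi.basisFun_det_apply]
    rfl
  rw [AlternatingMap.smul_apply, detForm_apply, smul_eq_mul, mul_comm]
  exact hb v

theorem wedge_conj (Ω : C3 [⋀^Fin 3]→L[ℂ] ℂ) :
    wedge (realify Ω) (conjForm (realify Ω)) = ((‖Ω eR‖ ^ 2 : ℝ) : ℂ) • detForm coframe := by
  set g := Ω eR with hg
  have e1 : realify Ω = detForm ![g • dz 0, dz 1, dz 2] := by
    rw [realify_eq]
    ext v
    rw [AlternatingMap.smul_apply, detForm_apply, detForm_apply, Matrix.det_fin_three,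
      Matrix.det_fin_three]
    simp
    ring
  have e2 : conjForm (realify Ω) = detForm ![conj g • dzBar 0, dzBar 1, dzBar 2] := by
    rw [e1]
    ext v
    change conj (detForm ![g • dz 0, dz 1, dz 2] v) = _
    rw [detForm_apply, detForm_apply, Matrix.det_fin_three, Matrix.det_fin_three]
    simp [dz_apply, dzBar_apply]
  rw [e2, e1, wedge_detForm]
  have := coframe_append ![g • dz 0, dz 1, dz 2] ![conj g • dzBar 0, dzBar 1, dzBar 2]
    (Matrix.diagonal ![g, 1, 1]) (Matrix.diagonal ![conj g, 1, 1])
    (fun i u => by fin_cases i <;> simp [Matrix.diagonal_apply, mul_comm])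
    (fun i u => by fin_cases i <;> simp [Matrix.diagonal_apply, mul_comm])
  refine this.trans ?_
  congr 1
  rw [Matrix.det_diagonal, Matrix.det_diagonal]
  simp [Fin.prod_univ_three, Complex.mul_conj, Complex.normSq_eq_norm_sq]

theorem detForm_coframe_ne_zero : detForm coframe ≠ 0 := by
  intro h
  have h1 : detForm coframe realBasis = 0 := by rw [h]; rfl
  rw [detForm_apply] at h1
  have h2 : (Matrix.of fun j i => coframe i (realBasis j))
      = (Matrix.fromBlocks (1 : Matrix (Fin 3) (Fin 3) ℂ) 1 (Complex.I • 1)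
          (-Complex.I • 1)).reindex (finSumFinEquiv (m := 3) (n := 3))
          (finSumFinEquiv (m := 3) (n := 3)) := by
    ext j i
    obtain ⟨j, rfl⟩ := (finSumFinEquiv (m := 3) (n := 3)).surjective j
    obtain ⟨i, rfl⟩ := (finSumFinEquiv (m := 3) (n := 3)).surjective i
    rw [Matrix.reindex_apply, Matrix.submatrix_apply, Equiv.symm_apply_apply,
      Equiv.symm_apply_apply]
    have c1 : ∀ i : Fin 3, coframe (finSumFinEquiv (m := 3) (n := 3) (Sum.inl i)) = dz i := fun i =>
      by fin_cases i <;> rfl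
    have c2 : ∀ i : Fin 3, coframe (finSumFinEquiv (m := 3) (n := 3) (Sum.inr i)) = dzBar i :=
      fun i => by fin_cases i <;> rfl
    have b1 : ∀ i : Fin 3, realBasis (finSumFinEquiv (m := 3) (n := 3) (Sum.inl i)) = eR i :=
      fun i => by fin_cases i <;> rfl
    have b2 : ∀ i : Fin 3, realBasis (finSumFinEquiv (m := 3) (n := 3) (Sum.inr i)) = eI i :=
      fun i => by fin_cases i <;> rfl
    rw [Matrix.of_apply]
    rcases i with i | i <;> rcases j with j | j <;> rcases eq_or_ne i j with rfl | hij
    all_goals first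
      | simp [c1, c2, b1, b2, eR, eI, dz_apply, dzBar_apply]; done
      | simp [c1, c2, b1, b2, eR, eI, dz_apply, dzBar_apply, hij, hij.symm]
  rw [h2] at h1
  have h3 := Matrix.det_reindex_self (finSumFinEquiv (m := 3) (n := 3))
    (Matrix.fromBlocks (1 : Matrix (Fin 3) (Fin 3) ℂ) 1 (Complex.I • 1) (-Complex.I • 1))
  rw [Matrix.det_fromBlocks_one₁₁, mul_one, ← sub_smul, Matrix.det_smul, Matrix.det_one] at h3
  have h4 := h3.symm.trans h1
  have h5 : -Complex.I - Complex.I ≠ 0 := by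
    intro h
    have := congrArg Complex.im h
    norm_num at this
  simp [h5] at h4

/-- The Calabi-Yau equation in components. -/
theorem volume_eq_iff {η : C3 [⋀^Fin 2]→L[ℝ] ℝ} (h : IsType11 η) (Ω : C3 [⋀^Fin 3]→L[ℂ] ℂ)
    (c : ℂ) : wedge (wedge (complexify η) (complexify η)) (complexify η)
        = c • wedge (realify Ω) (conjForm (realify Ω)) ↔
      normalizedConst * (hermDet (comp η) : ℝ) = c * ((‖Ω eR‖ ^ 2 : ℝ) : ℂ) := by
  rw [wedge_cube h, wedge_conj, smul_smul]
  exact (smul_left_injective ℂ detForm_coframe_ne_zero).eq_iff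

end Wedge

end SLag

/-! ### Harmonicity of the one-form in coordinates. -/

open Topology

namespace SLag

section Harmonic

variable {G : R3 → Matrix (Fin 3) (Fin 3) ℝ} {U : Set R3} {x : R3}

/-- The coordinate directions of `ℝ³`. -/
def eX (j : Fin 3) : R3 := Pi.single j 1

theorem flat_apply (x : R3) (w : Fin 1 → R3) :
    flat G (fun _ => Pi.single 0 1) x w = ∑ k, G x 0 k * w 0 k := by
  change Matrix.toBilin' (G x) (Pi.single 0 1) (w 0) = _
  rw [Matrix.toBilin'_apply']
  simp [dotProduct, Matrix.mulVec, Pi.single_apply]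

theorem differentiableAt_flat (hd : ∀ i j, DifferentiableAt ℝ (fun x => G x i j) x) :
    DifferentiableAt ℝ (flat G fun _ => Pi.single 0 1) x := by
  have e : (flat G fun _ => Pi.single 0 1) = fun x => ∑ k, G x 0 k •
      ContinuousAlternatingMap.ofSubsingleton ℝ R3 ℝ (0 : Fin 1)
        (ContinuousLinearMap.proj (R := ℝ) (φ := fun _ : Fin 3 => ℝ) k) := by
    funext x
    ext w
    rw [flat_apply]
    simp [Fin.sum_univ_three]
  rw [e]
  exact DifferentiableAt.fun_sum fun k _ => (hd 0 k).smul_const _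

theorem extDeriv_flat_apply (hd : ∀ i j, DifferentiableAt ℝ (fun x => G x i j) x) (j k : Fin 3) :
    extDeriv (flat G fun _ => Pi.single 0 1) x ![eX j, eX k]
      = fderiv ℝ (fun x => G x 0 k) x (eX j) - fderiv ℝ (fun x => G x 0 j) x (eX k) := by
  rw [extDeriv_apply (differentiableAt_flat hd), Fin.sum_univ_two]
  have e : ∀ (w : Fin 1 → R3) (l : Fin 3), w 0 = eX l →
      (fun x => flat G (fun _ => Pi.single 0 1) x w) = fun x => G x 0 l := by
    intro w l hw
    funext x
    rw [flat_apply, hw]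
    simp [eX, Pi.single_apply]
  rw [e _ k rfl, e _ j rfl]
  simp [sub_eq_add_neg]

theorem sharp_flat (h : (G x).PosDef) :
    sharp G (flat G fun _ => Pi.single 0 1) x = eX 0 := by
  have e : (fun j => flat G (fun _ => Pi.single 0 1) x fun _ => Pi.single j 1)
      = (G x).mulVec (eX 0) := by
    funext j
    rw [flat_apply]
    have hs := (posDef_isSymm h).apply 0 j
    simp [eX, Pi.single_apply, hs]
  rw [sharp, e, Matrix.mulVec_mulVec, Matrix.nonsing_inv_mul _ h.det_pos.ne'.isUnit,
    Matrix.one_mulVec]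

/-- Raising the index recovers ∂/∂x₁, so the star is √det dx₂ ∧ dx₃ and coclosedness becomes ∂₁√det
= 0. -/
theorem hodgeStar_flat (h : (G x).PosDef) :
    hodgeStar G (flat G fun _ => Pi.single 0 1) x
      = √(G x).det • stdVol.curryLeft (eX 0) := by
  rw [hodgeStar, sharp_flat h]
  rfl

theorem extDeriv_smul_const_apply {g : R3 → ℝ} (hg : DifferentiableAt ℝ g x) :
    extDeriv (fun x => g x • stdVol.curryLeft (eX 0)) x eX = fderiv ℝ g x (eX 0) := by
  rw [extDeriv_apply (hg.smul_const _), Fin.sum_univ_three]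
  have e : ∀ w : Fin 2 → R3, fderiv ℝ (fun x => (g x • stdVol.curryLeft (eX 0)) w) x
      = stdVol.curryLeft (eX 0) w • fderiv ℝ g x := by
    intro w
    exact (hg.hasFDerivAt.mul_const _).fderiv
  rw [e, e, e]
  have s0 : stdVol.curryLeft (eX 0) ((0 : Fin 3).removeNth eX) = 1 := by
    change (Matrix.of (Matrix.vecCons (eX 0) ((0 : Fin 3).removeNth eX)) :
      Matrix (Fin 3) (Fin 3) ℝ).det = 1
    rw [Matrix.det_fin_three]
    simp [eX, Fin.tail]
  have s1 : stdVol.curryLeft (eX 0) ((1 : Fin 3).removeNth eX) = 0 := by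
    change (Matrix.of (Matrix.vecCons (eX 0) ((1 : Fin 3).removeNth eX)) :
      Matrix (Fin 3) (Fin 3) ℝ).det = 0
    rw [Matrix.det_fin_three]
    simp [eX, Fin.removeNth, Fin.succAbove]
  have s2 : stdVol.curryLeft (eX 0) ((2 : Fin 3).removeNth eX) = 0 := by
    change (Matrix.of (Matrix.vecCons (eX 0) ((2 : Fin 3).removeNth eX)) :
      Matrix (Fin 3) (Fin 3) ℝ).det = 0
    rw [Matrix.det_fin_three]
    simp [eX, Fin.removeNth, Fin.succAbove]
  rw [s0, s1, s2]
  simp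

/-- Harmonicity of `(∂/∂x₁)^♭` in coordinates. -/
theorem isHarmonicOn_flat_iff (hU : IsOpen U) (hpos : ∀ x ∈ U, (G x).PosDef)
    (hd : ∀ x ∈ U, ∀ i j, DifferentiableAt ℝ (fun x => G x i j) x)
    (hv : ∀ x ∈ U, DifferentiableAt ℝ (fun x => √(G x).det) x) :
    IsHarmonicOn G (flat G fun _ => Pi.single 0 1) U ↔
      (∀ x ∈ U, ∀ j k : Fin 3, fderiv ℝ (fun x => G x 0 k) x (Pi.single j 1)
        = fderiv ℝ (fun x => G x 0 j) x (Pi.single k 1)) ∧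
      ∀ x ∈ U, fderiv ℝ (fun x => √(G x).det) x (Pi.single 0 1) = 0 := by
  have hb : (Pi.basisFun ℝ (Fin 3) : Fin 3 → R3) = eX := by
    funext i
    simp [eX]
  refine and_congr (forall₂_congr fun x hx => ?_) (forall₂_congr fun x hx => ?_)
  · constructor
    · intro h j k
      have := extDeriv_flat_apply (hd x hx) j k
      rw [h] at this
      exact (sub_eq_zero.1 this.symm)
    · intro h
      apply ContinuousAlternatingMap.toAlternatingMap_injective
      refine Module.Basis.ext_alternating (Pi.basisFun ℝ (Fin 3)) fun v _ => ?_
      have e : (fun i => Pi.basisFun ℝ (Fin 3) (v i)) = ![eX (v 0), eX (v 1)] := by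
        rw [hb]
        funext i
        fin_cases i <;> rfl
      rw [e]
      exact (extDeriv_flat_apply (hd x hx) _ _).trans (sub_eq_zero.2 (h _ _))
  · have h1 : hodgeStar G (flat G fun _ => Pi.single 0 1) =ᶠ[𝓝 x]
        fun x => √(G x).det • stdVol.curryLeft (eX 0) := by
      filter_upwards [hU.mem_nhds hx] with y hy
      exact hodgeStar_flat (hpos y hy)
    rw [h1.extDeriv_eq]
    have h2 := extDeriv_smul_const_apply (hv x hx)
    constructor
    · intro h
      rw [h] at h2
      exact h2.symm
    · intro h
      apply ContinuousAlternatingMap.toAlternatingMap_injective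
      have h3 := AlternatingMap.eq_smul_basis_det (Pi.basisFun ℝ (Fin 3))
        (extDeriv (fun x => √(G x).det • stdVol.curryLeft (eX 0)) x).toAlternatingMap
      rw [h3, hb]
      have h4 : (extDeriv (fun x => √(G x).det • stdVol.curryLeft (eX 0)) x).toAlternatingMap eX
        = 0 := h2.trans h
      rw [h4, zero_smul]
      rfl

end Harmonic

end SLag

/-! ### Slices, and the Calabi-Yau structure of a harmonic family. -/

open Topology

namespace SLag

section Slices

variable {A : ℝ → R3 → Matrix (Fin 3) (Fin 3) ℝ} {U : Set R3} {T : Set ℝ}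

theorem sliceMap_im_zero (t : ℝ) (x : R3) : imL 0 (sliceMap t x) = t := by
  simp [imL_apply, sliceMap, realIncl]

theorem rePart_sliceMap (t : ℝ) (x : R3) : rePart (sliceMap t x) = x := by
  funext j
  by_cases h : j = 0
  · subst h; simp [rePart_apply, sliceMap, realIncl]
  · simp [rePart_apply, sliceMap, realIncl, h]

theorem sliceMap_mem_imZero (t : ℝ) (x : R3) {j : Fin 3} (hj : j ≠ 0) : sliceMap t x ∈ imZero j := by
  simp [imZero, sliceMap, realIncl, hj]

theorem sliceMap_zero (x : R3) : sliceMap 0 x = realIncl x := by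
  simp [sliceMap]

theorem realIncl_eX (j : Fin 3) : realIncl (eX j) = eR j := by
  funext k
  by_cases h : k = j
  · subst h; simp [realIncl, eX, eR]
  · simp [realIncl, eX, eR, h]

theorem realIncl_eq_sum (u : R3) : realIncl u = ∑ j, u j • eR j := by
  funext k
  simp [realIncl, eR, Pi.single_apply]

theorem twoForm_realIncl (η : C3 [⋀^Fin 2]→L[ℝ] ℝ) (u v : R3) :
    η ![realIncl u, realIncl v] = ∑ j, ∑ k, η ![eR j, eR k] * (u j * v k) := by
  rw [realIncl_eq_sum, realIncl_eq_sum]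
  simp only [Fin.sum_univ_three, twoForm_add_left, twoForm_add_right, twoForm_smul_left,
    twoForm_smul_right]
  ring

theorem twoForm_realIncl_I (η : C3 [⋀^Fin 2]→L[ℝ] ℝ) (u v : R3) :
    η ![realIncl u, Complex.I • realIncl v] = ∑ j, ∑ k, η ![eR j, eI k] * (u j * v k) := by
  have hs : ∀ (c : ℝ) (u : C3), Complex.I • (c • u) = c • (Complex.I • u) := fun c u =>
    smul_comm _ _ _
  rw [realIncl_eq_sum, realIncl_eq_sum]
  simp only [Fin.sum_univ_three, smul_add, hs, I_smul_eR, twoForm_add_left, twoForm_add_right,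
    twoForm_smul_left, twoForm_smul_right]
  ring

theorem threeForm_realIncl (Ω : C3 [⋀^Fin 3]→L[ℂ] ℂ) (u : Fin 3 → R3) :
    Ω (fun k => realIncl (u k)) = (stdVol u : ℝ) * Ω eR := by
  have h := congrArg (fun L : C3 [⋀^Fin 3]→ₗ[ℝ] ℂ => L fun k => realIncl (u k)) (realify_eq Ω)
  simp only [AlternatingMap.smul_apply, detForm_apply, smul_eq_mul] at h
  refine h.trans ?_
  have h2 : stdVol u = (Matrix.of u : Matrix (Fin 3) (Fin 3) ℝ).det := rfl
  rw [h2, Matrix.det_fin_three, Matrix.det_fin_three]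
  simp [dz_apply, realIncl]
  ring

theorem toBilin_eq_sum (G : Matrix (Fin 3) (Fin 3) ℝ) (u v : R3) :
    Matrix.toBilin' G u v = ∑ j, ∑ k, G j k * (u j * v k) := by
  rw [Matrix.toBilin'_apply]
  refine Finset.sum_congr rfl fun j _ => Finset.sum_congr rfl fun k _ => ?_
  ring

theorem stdVol_eX : stdVol eX = 1 := by
  change (Matrix.of eX : Matrix (Fin 3) (Fin 3) ℝ).det = 1
  rw [Matrix.det_fin_three]
  simp [eX]

/-- The standard holomorphic volume form. -/
noncomputable def holVol : C3 [⋀^Fin 3]→L[ℂ] ℂ :=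
  { (Matrix.detRowAlternating : C3 [⋀^Fin 3]→ₗ[ℂ] ℂ) with
    cont := Continuous.matrix_det (A := fun v : Fin 3 → C3 => Matrix.of v) continuous_id }

theorem holVol_eR : holVol eR = 1 := by
  change (Matrix.of eR : Matrix (Fin 3) (Fin 3) ℂ).det = 1
  rw [Matrix.det_fin_three]
  simp [eR]

theorem normalizedConst_ne_zero : normalizedConst ≠ 0 := by
  unfold normalizedConst
  simp [Nat.factorial]

theorem components_of_comp_eq {η : C3 [⋀^Fin 2]→L[ℝ] ℝ} (h : IsType11 η)
    {G : Matrix (Fin 3) (Fin 3) ℝ} (hs : G.IsSymm) (hc : comp η = metricComp G) (j k : Fin 3) :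
    η ![eR j, eI k] = G j k ∧ η ![eR j, eR k] = 0 := by
  have hc' := fun i => congrFun hc i
  have c0 := hc' 0; have c1 := hc' 1; have c2 := hc' 2; have c3 := hc' 3; have c4 := hc' 4
  have c5 := hc' 5; have c6 := hc' 6; have c7 := hc' 7; have c8 := hc' 8
  simp only [comp, metricComp, Fin.isValue, Matrix.cons_val] at c0 c1 c2 c3 c4 c5 c6 c7 c8
  have d6 := twoForm_swap η (eR 1) (eR 0); have d7 := twoForm_swap η (eR 2) (eR 0)
  have d8 := twoForm_swap η (eR 2) (eR 1)
  rw [c6, neg_zero] at d6; rw [c7, neg_zero] at d7; rw [c8, neg_zero] at d8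
  have e1 := h.symm 1 0; have e2 := h.symm 2 0; have e3 := h.symm 2 1
  rw [c1, ← hs.apply 0 1] at e1; rw [c2, ← hs.apply 0 2] at e2; rw [c4, ← hs.apply 1 2] at e3
  fin_cases j <;> fin_cases k
  exacts [⟨c0, twoForm_self _ _⟩, ⟨c1, c6⟩, ⟨c2, c7⟩, ⟨e1, d6⟩, ⟨c3, twoForm_self _ _⟩, ⟨c4, c8⟩,
    ⟨e2, d7⟩, ⟨e3, d8⟩, ⟨c5, twoForm_self _ _⟩]

/-- From a harmonic family to a Calabi-Yau structure. -/
theorem exists_calabiYau (hU : IsOpen U) (hT : IsOpen T) (hT0 : (0 : ℝ) ∈ T)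
    (hA : ∀ i j, AnalyticOnNhd ℝ (fun p : R3 × ℝ => A p.2 p.1 i j) (U ×ˢ T))
    (hpos : ∀ t ∈ T, ∀ x ∈ U, (A t x).PosDef)
    (hcl : ∀ t ∈ T, ∀ x ∈ U, ∀ j k : Fin 3, fderiv ℝ (fun x => A t x 0 k) x (Pi.single j 1)
      = fderiv ℝ (fun x => A t x 0 j) x (Pi.single k 1))
    (hdet : ∀ x ∈ U, ∀ s ∈ T, ∀ t ∈ T, (A s x).det = (A t x).det)
    (hdet' : ∀ t ∈ T, ∀ x ∈ U, fderiv ℝ (fun x => √(A t x).det) x (Pi.single 0 1) = 0) :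
    ∃ V Ω ω, IsStandardComplexification U V ∧ (∀ t ∈ T, slice V t = U) ∧
      (∀ t ∉ T, slice V t = ∅) ∧ IsCalabiYau V Ω ω normalizedConst ∧
      ∀ t ∈ T, IsSpecialLagrangianSlice V Ω ω t ∧ IsCalibratedSlice V Ω t (A t) ∧
        InducesMetricOnSlice V ω t (A t) := by
  obtain ⟨V, hV, hVt, hVs, ω, f, h⟩ := exists_global_solution (A := A) (U := U) (T := T)
    fun p hp h1 h2 => exists_isSolution hU hT hA hpos hcl hdet hdet' hp h1 h2
  -- The domain lies in the tube over U and T and contains all its points with y₂ = y₃ = 0, so every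
  -- slice is determined exactly.
  have hmem : ∀ t x, sliceMap t x ∈ V ↔ x ∈ U ∧ t ∈ T := by
    intro t x
    constructor
    · intro hx
      have := hVt hx
      rwa [tube, Set.mem_ofPred_eq, rePart_sliceMap, sliceMap_im_zero] at this
    · intro hx
      refine hVs _ ?_ (sliceMap_mem_imZero t x (by decide)) (sliceMap_mem_imZero t x (by decide))
      rwa [tube, Set.mem_ofPred_eq, rePart_sliceMap, sliceMap_im_zero]
  have hcomp : ∀ t x, sliceMap t x ∈ V → ∀ j k, ω (sliceMap t x) ![eR j, eI k] = A t x j k ∧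
      ω (sliceMap t x) ![eR j, eR k] = 0 := by
    intro t x hx
    have hxt := (hmem t x).1 hx
    refine components_of_comp_eq (h.type11 _ hx) (posDef_isSymm (hpos t hxt.2 x hxt.1)) ?_
    rw [h.eq_slice _ hx (sliceMap_mem_imZero t x (by decide)) (sliceMap_mem_imZero t x (by decide)),
      sliceComp, rePart_sliceMap, sliceMap_im_zero]
  have hf : ∀ t x, sliceMap t x ∈ V → f (sliceMap t x) = (√(A t x).det : ℝ) := by
    intro t x hx
    rw [h.eq_slice_holomorphic _ hx (sliceMap_mem_imZero t x (by decide))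
      (sliceMap_mem_imZero t x (by decide)), sliceVol, rePart_sliceMap, sliceMap_im_zero]
  have hΩ : ∀ t x, sliceMap t x ∈ V → ∀ u : Fin 3 → R3,
      (f (sliceMap t x) • holVol) (fun k => realIncl (u k))
        = ((√(A t x).det * stdVol u : ℝ) : ℂ) := by
    intro t x hx u
    rw [threeForm_realIncl]
    change _ * (f (sliceMap t x) * holVol eR) = _
    rw [holVol_eR, hf t x hx]
    push_cast
    ring
  refine ⟨V, fun z => f z • holVol, ω, ⟨hV, fun x hx => ?_, ?_⟩, fun t ht => ?_, fun t ht => ?_,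
    ⟨?_, fun z hz => ?_, ⟨?_, h.closed, h.type11, h.pos⟩, fun z hz => ?_⟩, fun t ht => ⟨?_, ?_, ?_⟩⟩
  · rw [← sliceMap_zero]
    exact (hmem 0 x).2 ⟨hx, hT0⟩
  · ext x
    constructor
    · rintro ⟨z, hz, rfl⟩
      exact (hVt hz).1
    · intro hx
      exact ⟨sliceMap 0 x, (hmem 0 x).2 ⟨hx, hT0⟩, rePart_sliceMap 0 x⟩
  · ext x
    exact (hmem t x).trans ⟨fun h => h.1, fun h => ⟨h, ht⟩⟩
  · ext x
    exact (hmem t x).trans ⟨fun h => ht h.2, fun h => h.elim⟩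
  · exact fun z hz => ((h.holomorphic z hz).differentiableAt.smul_const _).differentiableWithinAt
  · intro h0
    have h1 : (f z • holVol) eR = 0 := by rw [h0]; rfl
    change f z * holVol eR = 0 at h1
    rw [holVol_eR, mul_one] at h1
    exact h.ne_zero z hz h1
  · exact fun z hz => (h.analytic z hz).contDiffAt.contDiffWithinAt
  · rw [volume_eq_iff (h.type11 z hz)]
    change _ = _ * ((‖f z * holVol eR‖ ^ 2 : ℝ) : ℂ)
    rw [holVol_eR, mul_one, h.det_eq z hz]
  · intro x hx
    refine ⟨fun u => ?_, fun u => ?_⟩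
    · rw [hΩ t x hx, Complex.ofReal_im]
    · have e : (fun k => realIncl (u k)) = ![realIncl (u 0), realIncl (u 1)] := by
        funext k
        fin_cases k <;> rfl
      rw [e, twoForm_realIncl]
      exact Finset.sum_eq_zero fun j _ => Finset.sum_eq_zero fun k _ => by
        rw [(hcomp t x hx j k).2, zero_mul]
  · intro x hx u
    rw [hΩ t x hx, Complex.ofReal_re]
    rfl
  · intro x hx u v
    rw [twoForm_realIncl_I, toBilin_eq_sum]
    exact Finset.sum_congr rfl fun j _ => Finset.sum_congr rfl fun k _ => by
      rw [(hcomp t x hx j k).1]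

end Slices

end SLag

/-! ### From a Calabi-Yau structure to identities along the slices. -/

open Topology Filter

namespace SLag

section Converse

variable {A : ℝ → R3 → Matrix (Fin 3) (Fin 3) ℝ} {U : Set R3} {T : Set ℝ} {V : Set C3}
  {Ω : C3 → C3 [⋀^Fin 3]→L[ℂ] ℂ} {ω : C3 → C3 [⋀^Fin 2]→L[ℝ] ℝ}

theorem InducesMetricOnSlice.entry_eq {t : ℝ} {G : R3 → Matrix (Fin 3) (Fin 3) ℝ}
    (h : InducesMetricOnSlice V ω t G) {x : R3} (hx : sliceMap t x ∈ V) (j k : Fin 3) :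
    ω (sliceMap t x) ![eR j, eI k] = G x j k := by
  have h1 := h x hx (eX j) (eX k)
  rw [realIncl_eX, realIncl_eX, I_smul_eR] at h1
  rw [h1, eX, eX, Matrix.toBilin'_single]

/-- For a normalized structure, calibrated slices are Lagrangian with phase zero. -/
theorem isSpecialLagrangianSlice_of_isCalibratedSlice (h : IsCalabiYau V Ω ω normalizedConst)
    {t : ℝ} {G : R3 → Matrix (Fin 3) (Fin 3) ℝ} (hpos : ∀ x ∈ slice V t, (G x).PosDef)
    (hc : IsCalibratedSlice V Ω t G) (hm : InducesMetricOnSlice V ω t G) :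
    IsSpecialLagrangianSlice V Ω ω t := by
  intro x hx
  have hxV : sliceMap t x ∈ V := hx
  set η := ω (sliceMap t x) with hη
  have h11 : IsType11 η := h.kahler.type_one_one _ hxV
  have hG := hpos x hx
  have hs := posDef_isSymm hG
  have hre : (Ω (sliceMap t x) eR).re = √(G x).det := by
    have h1 := hc x hx eX
    simp only [realIncl_eX] at h1
    refine h1.trans ?_
    change √(G x).det * stdVol eX = _
    rw [stdVol_eX, mul_one]
  have hvol := (volume_eq_iff h11 _ _).1 (h.volume_eq _ hxV)
  have hvol' := Complex.ofReal_injective (mul_left_cancel₀ normalizedConst_ne_zero hvol)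
  have ha : ∀ j k, η ![eR j, eI k] = G x j k := fun j k => hm.entry_eq hxV j k
  set b6 := η ![eR 0, eR 1] with hb6
  set b7 := η ![eR 0, eR 2] with hb7
  set b8 := η ![eR 1, eR 2] with hb8
  -- The expansion det(A + iB) = det A - bᵀAb, where b is the axial vector of the antisymmetric B.
  have hQ : hermDet (comp η) = (G x).det
      - ∑ i, ∑ j, G x i j * ((![b8, -b7, b6] : R3) i * (![b8, -b7, b6] : R3) j) := by
    rw [Matrix.det_fin_three]
    simp [hermDet, comp, ha, Fin.sum_univ_three, ← hb6, ← hb7, ← hb8]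
    rw [hs.apply 0 1, hs.apply 0 2, hs.apply 1 2]
    ring
  have hnorm : ‖Ω (sliceMap t x) eR‖ ^ 2 = (G x).det + (Ω (sliceMap t x) eR).im ^ 2 := by
    rw [← Complex.normSq_eq_norm_sq, Complex.normSq_apply, hre, ← pow_two, ← pow_two,
      Real.sq_sqrt hG.det_pos.le]
  rw [hQ, hnorm] at hvol'
  -- The volume equation now reads -bᵀAb = (Im g)², with g the coefficient of Ω: the left side is at
  -- most 0 and the right side at least 0, so both vanish.
  have hw : (![b8, -b7, b6] : R3) = 0 := by
    by_contra hw
    have := posDef_sum_pos hG hw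
    nlinarith [sq_nonneg (Ω (sliceMap t x) eR).im]
  have him : (Ω (sliceMap t x) eR).im = 0 := by
    rw [hw] at hvol'
    simp at hvol'
    exact hvol'
  have e8 : b8 = 0 := congrFun hw 0
  have e7 : b7 = 0 := neg_eq_zero.1 (congrFun hw 1)
  have e6 : b6 = 0 := congrFun hw 2
  refine ⟨fun u => ?_, fun u => ?_⟩
  · rw [threeForm_realIncl, Complex.im_ofReal_mul, him, mul_zero]
  · have e : (fun k => realIncl (u k)) = ![realIncl (u 0), realIncl (u 1)] := by
      funext k
      fin_cases k <;> rfl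
    rw [e, twoForm_realIncl]
    simp only [Fin.sum_univ_three, twoForm_self]
    rw [twoForm_swap _ (eR 1) (eR 0), twoForm_swap _ (eR 2) (eR 0), twoForm_swap _ (eR 2) (eR 1),
      ← hb6, ← hb7, ← hb8, e6, e7, e8]
    ring

/-- The slice parametrization as a linear map of space and time. -/
noncomputable def sliceL : R3 × ℝ →L[ℝ] C3 :=
  LinearMap.toContinuousLinearMap
    { toFun := fun q => sliceMap q.2 q.1
      map_add' := fun p q => by
        funext k
        by_cases h : k = 0
        · subst h; simp [sliceMap, realIncl]; ring
        · simp [sliceMap, realIncl, h]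
      map_smul' := fun c q => by
        funext k
        by_cases h : k = 0
        · subst h; simp [sliceMap, realIncl]; ring
        · simp [sliceMap, realIncl, h] }

theorem sliceL_apply (q : R3 × ℝ) : sliceL q = sliceMap q.2 q.1 := rfl

theorem sliceL_space (j : Fin 3) : sliceL (eX j, 0) = eR j := by
  rw [sliceL_apply, sliceMap_zero, realIncl_eX]

theorem sliceL_time : sliceL (0, 1) = eI 0 := by
  funext k
  by_cases h : k = 0
  · subst h; simp [sliceL_apply, sliceMap, realIncl, eI]
  · simp [sliceL_apply, sliceMap, realIncl, eI, h]

theorem fderiv_slice {E : Type*} [NormedAddCommGroup E] [NormedSpace ℝ E] {F : C3 → E}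
    {Φ : R3 × ℝ → E} {q : R3 × ℝ} (hF : DifferentiableAt ℝ F (sliceL q))
    (h : ∀ᶠ p in 𝓝 q, F (sliceL p) = Φ p) (w : R3 × ℝ) :
    fderiv ℝ Φ q w = fderiv ℝ F (sliceL q) (sliceL w) := by
  have h1 : HasFDerivAt (fun p => F (sliceL p)) ((fderiv ℝ F (sliceL q)).comp sliceL) q :=
    hF.hasFDerivAt.comp q sliceL.hasFDerivAt
  have h2 : (fun p => F (sliceL p)) =ᶠ[𝓝 q] Φ := h
  rw [← h2.fderiv_eq]
  exact congrArg (· w) h1.fderiv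

/-- The points of space-time whose slice point lies in the complexification. -/
def sliceDomain (U : Set R3) (T : Set ℝ) (V : Set C3) : Set (R3 × ℝ) :=
  (U ×ˢ T) ∩ sliceL ⁻¹' V

theorem isOpen_sliceDomain (hU : IsOpen U) (hT : IsOpen T) (hV : IsOpen V) :
    IsOpen (sliceDomain U T V) :=
  (hU.prod hT).inter (hV.preimage sliceL.continuous)

/-- The determinant is stationary in time and in the first coordinate. -/
theorem fderiv_det_eq_zero {c : ℂ} (hU : IsOpen U) (hT : IsOpen T) (hV : IsOpen V)
    (h : IsCalabiYau V Ω ω c)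
    (hsl : ∀ t ∈ T, IsSpecialLagrangianSlice V Ω ω t) (hpos : ∀ t ∈ T, ∀ x ∈ U, (A t x).PosDef)
    (hm : ∀ t ∈ T, InducesMetricOnSlice V ω t (A t)) {q : R3 × ℝ} (hq : q ∈ sliceDomain U T V) :
    fderiv ℝ (fun p : R3 × ℝ => (A p.2 p.1).det) q (eX 0, 0) = 0 ∧
      fderiv ℝ (fun p : R3 × ℝ => (A p.2 p.1).det) q (0, 1) = 0 := by
  set g : C3 → ℂ := fun z => Ω z eR with hg
  have hev := (isOpen_sliceDomain hU hT hV).mem_nhds hq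
  have hgd : DifferentiableAt ℂ g (sliceL q) :=
    (ContinuousAlternatingMap.apply ℂ C3 ℂ eR).differentiableAt.comp _
      ((h.holomorphic).differentiableAt (hV.mem_nhds hq.2))
  have hgR : HasFDerivAt g ((fderiv ℂ g (sliceL q)).restrictScalars ℝ) (sliceL q) :=
    hgd.hasFDerivAt.restrictScalars ℝ
  have him : ∀ p ∈ sliceDomain U T V, (g (sliceL p)).im = 0 := by
    intro p hp
    have h1 := (hsl p.2 hp.1.2 p.1 hp.2).1 eX
    simp only [realIncl_eX] at h1
    exact h1
  have himd : ∀ w, (fderiv ℂ g (sliceL q) (sliceL w)).im = 0 := by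
    intro w
    have h1 : HasFDerivAt (fun z => (g z).im)
        (Complex.imCLM.comp ((fderiv ℂ g (sliceL q)).restrictScalars ℝ)) (sliceL q) :=
      Complex.imCLM.hasFDerivAt.comp _ hgR
    have h2 := fderiv_slice (Φ := fun _ => (0 : ℝ)) h1.differentiableAt
      (by filter_upwards [hev] with p hp using him p hp) w
    rw [h1.fderiv] at h2
    simpa using h2.symm
  have hCR : fderiv ℂ g (sliceL q) (eI 0) = Complex.I * fderiv ℂ g (sliceL q) (eR 0) := by
    rw [← I_smul_eR, map_smul, smul_eq_mul]
  -- The derivatives along x₁ and y₁ are both real and differ by the factor i.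
  have hR0 : fderiv ℂ g (sliceL q) (eR 0) = 0 := by
    have h1 := himd (eX 0, 0)
    have h2 := himd (0, 1)
    rw [sliceL_space] at h1
    rw [sliceL_time, hCR] at h2
    exact Complex.ext (by simpa using h2) h1
  have hI0 : fderiv ℂ g (sliceL q) (eI 0) = 0 := by rw [hCR, hR0, mul_zero]
  -- the determinant in terms of `g`
  set r : ℝ := (c / normalizedConst).re with hr
  have hdet : ∀ p ∈ sliceDomain U T V,
      r * ((g (sliceL p)).re * (g (sliceL p)).re) = (A p.2 p.1).det := by
    intro p hp
    have h11 : IsType11 (ω (sliceL p)) := h.kahler.type_one_one _ hp.2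
    have hGp := hpos p.2 hp.1.2 p.1 hp.1.1
    have hb : ∀ j k, ω (sliceL p) ![eR j, eR k] = 0 := by
      intro j k
      have h1 := (hsl p.2 hp.1.2 p.1 hp.2).2 ![eX j, eX k]
      have e : (fun i => realIncl ((![eX j, eX k] : Fin 2 → R3) i)) = ![eR j, eR k] := by
        funext i
        fin_cases i
        exacts [realIncl_eX j, realIncl_eX k]
      rwa [e] at h1
    have hcomp : comp (ω (sliceL p)) = metricComp (A p.2 p.1) := by
      have ha := fun j k => (hm p.2 hp.1.2).entry_eq (x := p.1) hp.2 j k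
      rw [← sliceL_apply] at ha
      funext i
      fin_cases i
      exacts [ha 0 0, ha 0 1, ha 0 2, ha 1 1, ha 1 2, ha 2 2, hb 0 1, hb 0 2, hb 1 2]
    have hvol := (volume_eq_iff h11 _ _).1 (h.volume_eq _ hp.2)
    rw [hcomp, hermDet_metricComp (posDef_isSymm hGp)] at hvol
    have h2 : ((A p.2 p.1).det : ℂ) = (c / normalizedConst) * ((‖g (sliceL p)‖ ^ 2 : ℝ) : ℂ) := by
      rw [div_mul_eq_mul_div, eq_div_iff normalizedConst_ne_zero, mul_comm]
      exact hvol
    have h3 := congrArg Complex.re h2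
    rw [Complex.ofReal_re, Complex.re_mul_ofReal, ← Complex.normSq_eq_norm_sq,
      Complex.normSq_apply, him p hp] at h3
    rw [h3, mul_zero, add_zero]
  have hF : HasFDerivAt (fun z => r * ((g z).re * (g z).re)) _ (sliceL q) :=
    ((Complex.reCLM.hasFDerivAt.comp _ hgR).mul (Complex.reCLM.hasFDerivAt.comp _ hgR)).const_mul r
  have key : ∀ w, fderiv ℂ g (sliceL q) (sliceL w) = 0 →
      fderiv ℝ (fun p : R3 × ℝ => (A p.2 p.1).det) q w = 0 := by
    intro w hw
    rw [fderiv_slice (Φ := fun p : R3 × ℝ => (A p.2 p.1).det) hF.differentiableAt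
      (by filter_upwards [hev] with p hp using hdet p hp) w, hF.fderiv]
    simp [hw]
  exact ⟨key _ (by rw [sliceL_space]; exact hR0), key _ (by rw [sliceL_time]; exact hI0)⟩

/-- The first row of the metric is closed. -/
theorem fderiv_row_symm {c : ℂ} (hU : IsOpen U) (hT : IsOpen T) (hV : IsOpen V)
    (h : IsCalabiYau V Ω ω c)
    (hsl : ∀ t ∈ T, IsSpecialLagrangianSlice V Ω ω t) (hpos : ∀ t ∈ T, ∀ x ∈ U, (A t x).PosDef)
    (hm : ∀ t ∈ T, InducesMetricOnSlice V ω t (A t)) {q : R3 × ℝ} (hq : q ∈ sliceDomain U T V)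
    (j k : Fin 3) :
    fderiv ℝ (fun p : R3 × ℝ => A p.2 p.1 0 k) q (eX j, 0)
      = fderiv ℝ (fun p : R3 × ℝ => A p.2 p.1 0 j) q (eX k, 0) := by
  have hev := (isOpen_sliceDomain hU hT hV).mem_nhds hq
  have hωd : DifferentiableAt ℝ ω (sliceL q) :=
    (h.kahler.smooth.contDiffAt (hV.mem_nhds hq.2)).differentiableAt (by simp)
  have hd : ∀ u v, HasFDerivAt (fun z => ω z ![u, v])
      ((ContinuousAlternatingMap.apply ℝ C3 ℝ ![u, v]).comp (fderiv ℝ ω (sliceL q))) (sliceL q) :=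
    fun u v => (ContinuousAlternatingMap.apply ℝ C3 ℝ ![u, v]).hasFDerivAt.comp _ hωd.hasFDerivAt
  have ha : ∀ j k, fderiv ℝ (fun p : R3 × ℝ => A p.2 p.1 0 k) q (eX j, 0)
      = fderiv ℝ ω (sliceL q) (eR j) ![eR k, eI 0] := by
    intro j k
    rw [fderiv_slice (F := fun z => ω z ![eR k, eI 0]) (hd _ _).differentiableAt
      (by
        filter_upwards [hev] with p hp
        have h1 := (hm p.2 hp.1.2).entry_eq (x := p.1) hp.2 k 0
        rw [← sliceL_apply] at h1
        rw [h1, (posDef_isSymm (hpos p.2 hp.1.2 p.1 hp.1.1)).apply 0 k]) (eX j, 0),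
      (hd _ _).fderiv, sliceL_space]
    rfl
  -- Moving along y₁ passes from one Lagrangian slice to the next, so this component stays zero and
  -- one of the three terms of dω drops out.
  have hb : fderiv ℝ ω (sliceL q) (eI 0) ![eR j, eR k] = 0 := by
    have h1 := fderiv_slice (F := fun z => ω z ![eR j, eR k]) (Φ := fun _ => (0 : ℝ))
      (hd _ _).differentiableAt
      (by
        filter_upwards [hev] with p hp
        have h1 := (hsl p.2 hp.1.2 p.1 hp.2).2 ![eX j, eX k]
        have e : (fun i => realIncl ((![eX j, eX k] : Fin 2 → R3) i)) = ![eR j, eR k] := by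
          funext i
          fin_cases i
          exacts [realIncl_eX j, realIncl_eX k]
        rwa [e] at h1) (0, 1)
    rw [(hd _ _).fderiv, sliceL_time] at h1
    simpa using h1.symm
  have hcl := closed_relation hωd (h.kahler.closed _ hq.2) (eI 0) (eR j) (eR k)
  have hsw : ∀ m l, fderiv ℝ ω (sliceL q) m ![eI 0, eR l]
      = -fderiv ℝ ω (sliceL q) m ![eR l, eI 0] := fun m l => twoForm_swap _ _ _
  rw [hb, hsw, hsw] at hcl
  rw [ha, ha]
  linarith

end Converse

end SLag

/-! ### Analytic continuation in t and the equivalence. -/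

open Topology Filter

namespace SLag

section Continuation

variable {A : ℝ → R3 → Matrix (Fin 3) (Fin 3) ℝ} {U : Set R3} {T : Set ℝ}

theorem eq_const_of_deriv_eventually_zero {φ : ℝ → ℝ} (hT : IsOpen T) (hTc : IsPreconnected T)
    (hT0 : (0 : ℝ) ∈ T) (hφ : AnalyticOnNhd ℝ φ T) (h : ∀ᶠ t in 𝓝 0, deriv φ t = 0) :
    ∀ s ∈ T, ∀ t ∈ T, φ s = φ t := by
  have h1 : Set.EqOn (deriv φ) 0 T :=
    hφ.deriv.eqOn_zero_of_preconnected_of_eventuallyEq_zero hTc hT0 h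
  intro s hs t ht
  exact hT.is_const_of_deriv_eq_zero hTc
    (fun u hu => (hφ u hu).differentiableAt.differentiableWithinAt) h1 hs ht

theorem fderiv_space {F : R3 × ℝ → ℝ} {x : R3} {t : ℝ} (hF : DifferentiableAt ℝ F (x, t)) (w : R3) :
    fderiv ℝ (fun y => F (y, t)) x w = fderiv ℝ F (x, t) (w, 0) := by
  have h1 := HasFDerivAt.comp (g := F) (f := fun y : R3 => (y, t)) x hF.hasFDerivAt
    ((hasFDerivAt_id x).prodMk (hasFDerivAt_const t x))
  have h2 : fderiv ℝ (fun y => F (y, t)) x = _ := h1.fderiv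
  rw [h2]; rfl

theorem deriv_time {F : R3 × ℝ → ℝ} {x : R3} {t : ℝ} (hF : DifferentiableAt ℝ F (x, t)) :
    deriv (fun s => F (x, s)) t = fderiv ℝ F (x, t) (0, 1) :=
  (hF.hasFDerivAt.comp_hasDerivAt t
    ((hasDerivAt_const t x).prodMk (hasDerivAt_id t))).deriv

theorem analyticOnNhd_det
    (hA : ∀ i j, AnalyticOnNhd ℝ (fun p : R3 × ℝ => A p.2 p.1 i j) (U ×ˢ T)) :
    AnalyticOnNhd ℝ (fun p : R3 × ℝ => (A p.2 p.1).det) (U ×ˢ T) := by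
  intro p hp
  have h1 := fun i j => hA i j p hp
  simp only [Matrix.det_fin_three]
  exact ((((((h1 0 0).mul (h1 1 1)).mul (h1 2 2)).sub (((h1 0 0).mul (h1 1 2)).mul (h1 2 1))).sub
    (((h1 0 1).mul (h1 1 0)).mul (h1 2 2))).add (((h1 0 1).mul (h1 1 2)).mul (h1 2 0))).add
    (((h1 0 2).mul (h1 1 0)).mul (h1 2 1)) |>.sub (((h1 0 2).mul (h1 1 1)).mul (h1 2 0))

/-- From a Calabi-Yau structure to a harmonic family. -/
theorem harmonic_of_calabiYau {V : Set C3} {Ω : C3 → C3 [⋀^Fin 3]→L[ℂ] ℂ}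
    {ω : C3 → C3 [⋀^Fin 2]→L[ℝ] ℝ} {c : ℂ} (hU : IsOpen U) (hT : IsOpen T)
    (hTc : IsPreconnected T) (hT0 : (0 : ℝ) ∈ T)
    (hA : ∀ i j, AnalyticOnNhd ℝ (fun p : R3 × ℝ => A p.2 p.1 i j) (U ×ˢ T))
    (hpos : ∀ t ∈ T, ∀ x ∈ U, (A t x).PosDef) (hV : IsStandardComplexification U V)
    (h : IsCalabiYau V Ω ω c) (hsl : ∀ t ∈ T, IsSpecialLagrangianSlice V Ω ω t)
    (hm : ∀ t ∈ T, InducesMetricOnSlice V ω t (A t)) :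
    (∀ x ∈ U, ∀ s ∈ T, ∀ t ∈ T, (A s x).det = (A t x).det) ∧
      (∀ t ∈ T, ∀ x ∈ U, ∀ j k : Fin 3, fderiv ℝ (fun x => A t x 0 k) x (Pi.single j 1)
        = fderiv ℝ (fun x => A t x 0 j) x (Pi.single k 1)) ∧
      ∀ t ∈ T, ∀ x ∈ U, fderiv ℝ (fun x => √(A t x).det) x (Pi.single 0 1) = 0 := by
  have hdom : ∀ x ∈ U, (x, (0 : ℝ)) ∈ sliceDomain U T V := fun x hx =>
    ⟨⟨hx, hT0⟩, by rw [Set.mem_preimage, sliceL_apply, sliceMap_zero]; exact hV.subset x hx⟩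
  -- A standard complexification guarantees slice points over x only for t near 0; the remaining t
  -- are reached by analytic continuation along the interval.
  have hdomt : ∀ x ∈ U, ∀ᶠ t in 𝓝 (0 : ℝ), (x, t) ∈ sliceDomain U T V := fun x hx =>
    (Continuous.prodMk_right x).continuousAt.eventually
      ((isOpen_sliceDomain hU hT hV.isOpen).mem_nhds (hdom x hx))
  have hDan := analyticOnNhd_det hA
  have hstat := fun q hq => fderiv_det_eq_zero (A := A) (q := q) hU hT hV.isOpen h hsl hpos hm hq
  have hrow := fun q hq => fderiv_row_symm (A := A) (q := q) hU hT hV.isOpen h hsl hpos hm hq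
  have hline : ∀ x : R3, x ∈ U → ∀ {F : R3 × ℝ → ℝ}, AnalyticOnNhd ℝ F (U ×ˢ T) →
      AnalyticOnNhd ℝ (fun t => F (x, t)) T := fun x hx F hF t ht =>
    AnalyticAt.comp (f := fun t : ℝ => (x, t)) (hF _ ⟨hx, ht⟩)
      (analyticAt_const.prod analyticAt_id)
  have hconst : ∀ x ∈ U, ∀ s ∈ T, ∀ t ∈ T, (A s x).det = (A t x).det := by
    intro x hx
    refine eq_const_of_deriv_eventually_zero (φ := fun t => (A t x).det) hT hTc hT0
      (hline x hx hDan) ?_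
    filter_upwards [hdomt x hx] with t ht
    rw [deriv_time (F := fun p : R3 × ℝ => (A p.2 p.1).det) (hDan _ ht.1).differentiableAt]
    exact (hstat _ ht).2
  refine ⟨hconst, fun t ht x hx j k => ?_, fun t ht x hx => ?_⟩
  · have han : ∀ j k : Fin 3, AnalyticOnNhd ℝ
        (fun t => fderiv ℝ (fun p : R3 × ℝ => A p.2 p.1 0 k) (x, t) (eX j, 0)) T := by
      intro j k
      refine hline x hx (F := fun p => fderiv ℝ (fun p : R3 × ℝ => A p.2 p.1 0 k) p (eX j, 0)) ?_
      exact (ContinuousLinearMap.apply ℝ ℝ _).comp_analyticOnNhd (hA 0 k).fderiv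
    have h0 := ((han j k).sub (han k j)).eqOn_zero_of_preconnected_of_eventuallyEq_zero hTc hT0
      (by
        filter_upwards [hdomt x hx] with s hs
        exact sub_eq_zero.2 (hrow _ hs j k)) ht
    have hd : ∀ k : Fin 3, DifferentiableAt ℝ (fun p : R3 × ℝ => A p.2 p.1 0 k) (x, t) := fun k =>
      (hA 0 k _ ⟨hx, ht⟩).differentiableAt
    have e1 := fderiv_space (hd k) (Pi.single j 1)
    have e2 := fderiv_space (hd j) (Pi.single k 1)
    rw [e1, e2]
    exact sub_eq_zero.1 h0
  -- The determinant is already known to be constant in t, so it is enough to differentiate at t =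
  -- 0, where the slice is all of U.
  · have h1 : (fun y => √(A t y).det) =ᶠ[𝓝 x] fun y => √(A 0 y).det := by
      filter_upwards [hU.mem_nhds hx] with y hy
      rw [hconst y hy t ht 0 hT0]
    rw [h1.fderiv_eq]
    have hd := (hDan (x, 0) ⟨hx, hT0⟩).differentiableAt
    have h2 : fderiv ℝ (fun y => (A 0 y).det) x (Pi.single 0 1) = 0 :=
      (fderiv_space hd _).trans (hstat _ (hdom x hx)).1
    have h3 : HasFDerivAt (fun y => (A 0 y).det) (fderiv ℝ (fun y => (A 0 y).det) x) x :=
      (DifferentiableAt.comp (g := fun p : R3 × ℝ => (A p.2 p.1).det) (f := fun y => (y, (0 : ℝ))) x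
        hd (differentiableAt_id.prodMk (differentiableAt_const _))).hasFDerivAt
    rw [(h3.sqrt (hpos 0 hT0 x hx).det_pos.ne').fderiv]
    change _ * fderiv ℝ (fun y => (A 0 y).det) x (Pi.single 0 1) = 0
    rw [h2, mul_zero]

/-- The first condition in coordinates. -/
theorem harmonic_family_iff (hU : IsOpen U)
    (hA : ∀ i j, AnalyticOnNhd ℝ (fun p : R3 × ℝ => A p.2 p.1 i j) (U ×ˢ T))
    (hpos : ∀ t ∈ T, ∀ x ∈ U, (A t x).PosDef) :
    (∀ t ∈ T, IsHarmonicOn (A t) (flat (A t) fun _ => Pi.single 0 1) U) ↔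
      (∀ t ∈ T, ∀ x ∈ U, ∀ j k : Fin 3, fderiv ℝ (fun x => A t x 0 k) x (Pi.single j 1)
        = fderiv ℝ (fun x => A t x 0 j) x (Pi.single k 1)) ∧
      ∀ t ∈ T, ∀ x ∈ U, fderiv ℝ (fun x => √(A t x).det) x (Pi.single 0 1) = 0 := by
  rw [← forall₂_and]
  refine forall₂_congr fun t ht => isHarmonicOn_flat_iff hU (hpos t ht) (fun x hx i j => ?_)
    fun x hx => (analyticAt_sqrt_det hA hpos hx ht).differentiableAt
  exact DifferentiableAt.comp (g := fun p : R3 × ℝ => A p.2 p.1 i j) (f := fun y => (y, t)) x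
    (hA i j _ ⟨hx, ht⟩).differentiableAt
    (differentiableAt_id.prodMk (differentiableAt_const _))

end Continuation

end SLag

theorem mainTheorem4 (U : Set (Fin 3 → ℝ)) (hU : IsOpen U)
    (T : Set ℝ) (hT : IsOpen T) (hTc : T.OrdConnected) (hT0 : (0 : ℝ) ∈ T)
    (A : ℝ → (Fin 3 → ℝ) → Matrix (Fin 3) (Fin 3) ℝ)
    (hA : ∀ i j, AnalyticOnNhd ℝ (fun p : (Fin 3 → ℝ) × ℝ => A p.2 p.1 i j) (U ×ˢ T))
    (hpos : ∀ t ∈ T, ∀ x ∈ U, (A t x).PosDef) :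
    List.TFAE [
      -- the determinant does not depend on `t` and `(∂/∂x₁)^♭` is harmonic for every `t`
      (∀ x ∈ U, ∀ s ∈ T, ∀ t ∈ T, (A s x).det = (A t x).det) ∧
        (∀ t ∈ T, SLag.IsHarmonicOn (A t) (SLag.flat (A t) (fun _ => Pi.single 0 1)) U),
      -- some Calabi-Yau structure, special Lagrangian in the sense `ω| = 0`, `Im Ω| = 0`
      ∃ V Ω ω c, SLag.IsStandardComplexification U V ∧ SLag.IsCalabiYau V Ω ω c ∧
        ∀ t ∈ T, SLag.IsSpecialLagrangianSlice V Ω ω t ∧ SLag.InducesMetricOnSlice V ω t (A t),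
      -- some normalized Calabi-Yau structure, special Lagrangian in the sense `Re Ω| = Vol`
      ∃ V Ω ω, SLag.IsStandardComplexification U V ∧
        SLag.IsCalabiYau V Ω ω SLag.normalizedConst ∧
        ∀ t ∈ T, SLag.IsCalibratedSlice V Ω t (A t) ∧ SLag.InducesMetricOnSlice V ω t (A t),
      -- all of this, with horizontal slices that are exactly copies of `U`, one for every `t ∈ T`
      ∃ V Ω ω, SLag.IsStandardComplexification U V ∧
        (∀ t ∈ T, SLag.slice V t = U) ∧ (∀ t ∉ T, SLag.slice V t = ∅) ∧
        SLag.IsCalabiYau V Ω ω SLag.normalizedConst ∧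
        ∀ t ∈ T, SLag.IsSpecialLagrangianSlice V Ω ω t ∧ SLag.IsCalibratedSlice V Ω t (A t) ∧
          SLag.InducesMetricOnSlice V ω t (A t)] := by
  have hiff := SLag.harmonic_family_iff hU hA hpos
  tfae_have 1 → 4 := fun ⟨hdet, hharm⟩ =>
    SLag.exists_calabiYau hU hT hT0 hA hpos (hiff.1 hharm).1 hdet (hiff.1 hharm).2
  tfae_have 4 → 3 := fun ⟨V, Ω, ω, hV, _, _, hCY, h⟩ =>
    ⟨V, Ω, ω, hV, hCY, fun t ht => (h t ht).2⟩
  tfae_have 3 → 2 := by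
    rintro ⟨V, Ω, ω, hV, hCY, h⟩
    refine ⟨V, Ω, ω, _, hV, hCY, fun t ht => ⟨?_, (h t ht).2⟩⟩
    refine SLag.isSpecialLagrangianSlice_of_isCalibratedSlice hCY (fun x hx => hpos t ht x ?_)
      (h t ht).1 (h t ht).2
    -- Positive definiteness is given over U only; slice points have real part in U.
    rw [← hV.re_eq]
    exact ⟨_, hx, SLag.rePart_sliceMap t x⟩
  tfae_have 2 → 1 := by
    rintro ⟨V, Ω, ω, c, hV, hCY, h⟩
    obtain ⟨h1, h2, h3⟩ := SLag.harmonic_of_calabiYau hU hT hTc.isPreconnected hT0 hA hpos hV hCY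
      (fun t ht => (h t ht).1) fun t ht => (h t ht).2
    exact ⟨h1, hiff.2 ⟨h2, h3⟩⟩
  tfae_finish
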